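/- **Setting.** For $k_F>0$ let $B_F=\{p\in\mathbb Z^3:|p|\le k_F\}$, $N=|B_F|$, $\hbar=N^{-1/3}$, $\kappa=k_FN^{-1/3}$, $e(p)=|\hbar^2p^2-\kappa^2|$. On the fermionic Fock space $\mathcal F$ over $L^2(\mathbb T^3)$, with $a_p^*,a_p$ creating and annihilating the plane wave of momentum $p\in\mathbb Z^3$, put $\mathcal N=\sum_pa_p^*a_p$, $\mathbb H_0=\sum_pe(p)a_p^*a_p$ and, for $0<\delta<1/6$ and $0<\theta<1/2$, $\mathcal N_\delta=\sum_{p:\,||p|-k_F|>\theta N^{-\delta}}a_p^*a_p$. *Patches.* Fix $c_0\ge1$. Let $p_1,\dots,p_M$ be subsets of the unit sphere with centers $\hat\omega_\alpha$ such that $p_\alpha$ contains the cap $\{|x-\hat\omega_\alpha|\le (c_0\sqrt M)^{-1}\}$ and is contained in the cap $\{|x-\hat\omega_\alpha|\le c_0/\sqrt M\}$; the $p_\alpha$ and $\hat\omega_\alpha$ come in pairs related by $x\mapsto-x$; and the patches $\{x\in\mathbb R^3:k_F-R\le|x|\le k_F+R,\ x/|x|\in p_\alpha\}$ have mutual distances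 larger than $R$ (any two points of different patches are more than $R$ apart). Let $B_\alpha$ be the set of lattice points in the $\alpha$-th patch. Let $\Gamma^{\rm nor}$ be the set of $k\in\mathbb Z^3$ with $|k|<R$ and $k_3>0$, or $k_3=0<k_2$, or $k_3=k_2=0<k_1$. Put $\mathcal I_k^\pm=\{\alpha:\pm k\cdot\hat\omega_\alpha\ge N^{-\delta}\}$ and $\mathcal I_k=\mathcal I_k^+\cup\mathcal I_k^-$. For $\alpha\in\mathcal I_k^\pm$ let $\mathcal P_\alpha(k)$ be the set of $p\in B_F^c\cap B_\alpha$ with $p\mp k\in B_F\cap B_\alpha$, $n_\alpha(k)=|\mathcal P_\alpha(k)|^{1/2}$ and $c_\alpha(k)=n_\alpha(k)^{-1}\sum_{p\in\mathcal P_\alpha(k)}a_{p\mp k}a_p$. Let $$\mathbb D_B=2\kappa\hbar\sum_{k\in\Gamma^{\rm nor}}\sum_{\alpha\in\mathcal I_k}|k\cdot\hat\omega_\alpha|\,c_\alpha^*(k)c_\alpha(k).$$ *The transformation $Z$.* Let $\hat V:\mathbb Z^3\to[0,\infty)$. For $k\in\Gamma^{\rm nor}$ let $D,W,\widetilde W$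 be the matrices on $\mathcal I_k$ with $D_{\alpha\beta}=\delta_{\alpha\beta}|k\cdot\hat\omega_\alpha|/|k|$; $W_{\alpha\beta}=\frac{\hat V(k)}{2\hbar\kappa N|k|}n_\alpha(k)n_\beta(k)$ if $\alpha,\beta$ lie both in $\mathcal I_k^+$ or both in $\mathcal I_k^-$, and $0$ otherwise; $\widetilde W_{\alpha\beta}$ given by the same expression if they lie on different sides, and $0$ otherwise. Put $E=[(D+W-\widetilde W)^{1/2}(D+W+\widetilde W)(D+W-\widetilde W)^{1/2}]^{1/2}$ and let $O(k)$ be the orthogonal factor in the polar decomposition of $(D+W-\widetilde W)^{1/2}E^{-1/2}$. Let $d,b$ be the $\mathcal I_k^+$-blocks of $D,W$, let $A$ be the orthogonal factor in the polar decomposition of $(d+2b)^{1/2}d^{1/2}$, and, identifying $\mathcal I_k^-$ with $\mathcal I_k^+$ by the antipodal map, let $\widetilde O(k)=U\begin{pmatrix}1&0\\0&A\end{pmatrix}U^T$ with $U=\frac1{\sqrt2}\begin{pmatrix}1&1\\1&-1\end{pmatrix}$. Let $L(k)=\log(O(k)\widetilde O(k))$ for a fixed branch of the logarithm on the unit circle,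 with cut away from $1$ and $\log1=0$, and $$Z=\exp\Big(\sum_{k\in\Gamma^{\rm nor}}\sum_{\alpha,\beta\in\mathcal I_k}L(k)_{\alpha,\beta}\,c_\alpha^*(k)c_\beta(k)\Big).$$ **Lemma.** Let $\hat V\ge0$ with $\sum_{k\in\mathbb Z^3}\hat V(k)(1+|k|)<\infty$, $0<\delta<1/6$, $0<\theta<1/2$, $c_0\ge1$, and fix the branch of the logarithm. Assume that $R\gg1$ and $N^{2\delta}R^2\ll M\ll N^{2/3-2\delta}R^{-4}$. Then $Z$ leaves the form domain of $\mathbb H_0$ invariant and there is a constant $C>0$ such that for all $\psi$ in the form domain of $\mathbb H_0$ $$\big|\langle Z\psi,(\mathbb H_0-\mathbb D_B)Z\psi\rangle-\langle\psi,(\mathbb H_0-\mathbb D_B)\psi\rangle\big|\le C\hbar\Big(M^{-1/2}\|\mathcal N_\delta^{1/2}\psi\|^2+R^3M^{3/2}N^{-2/3+\delta}\|\mathcal N_\delta^{1/2}\mathcal N\psi\|\,\|\mathcal N_\delta^{1/2}\psi\|\Big),$$ where the right side is read as $+\infty$ if $\|\mathcal N_\delta^{1/2}\mathcal N\psi\|=\infty$.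 More precisely, there are $C,\varepsilon>0$, depending only on $\hat V,\delta,\theta,c_0$ and the branch of the logarithm, such that this holds for all $k_F>0$, all $R$ and $M$ with $\varepsilon R\ge1$, $N^{2\delta}R^2\le\varepsilon M$ and $M\le\varepsilon N^{2/3-2\delta}R^{-4}$, and all patch decompositions as above. -/

import Mathlib

open scoped ENNReal Matrix.Norms.L2Operator

noncomputable section

namespace FermiPatch

/-! ### Momenta, the Fermi ball and the scaling parameters -/

/-- Momentum space: the lattice of integer vectors in three dimensions. -/
abbrev Mom : Type := Fin 3 → ℤ

/-- Euclidean three-space. -/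
abbrev E3 : Type := EuclideanSpace ℝ (Fin 3)

/-- A lattice momentum as a Euclidean vector; `‖vec p‖` is the Euclidean length of `p`. -/
def vec (p : Mom) : E3 := WithLp.toLp 2 (fun i => (p i : ℝ))

open Classical in
/-- The finite set of all lattice momenta of Euclidean length at most `r`. -/
def latticeBall (r : ℝ) : Finset Mom :=
  (Finset.Icc (fun _ => -⌈r⌉) (fun _ => ⌈r⌉)).filter (fun p => ‖vec p‖ ≤ r)

theorem mem_latticeBall {r : ℝ} {p : Mom} : p ∈ latticeBall r ↔ ‖vec p‖ ≤ r := by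
  classical
  unfold latticeBall
  rw [Finset.mem_filter, and_iff_right_iff_imp]
  intro h
  have hi : ∀ i, |(p i : ℝ)| ≤ (⌈r⌉ : ℝ) := fun i => by
    have h1 : ‖(vec p) i‖ ≤ ‖vec p‖ := PiLp.norm_apply_le (vec p) i
    have h2 : ‖(vec p) i‖ = |(p i : ℝ)| := rfl
    rw [h2] at h1
    exact (h1.trans h).trans (Int.le_ceil r)
  rw [Finset.mem_Icc]
  constructor
  · intro i
    have := (abs_le.mp (hi i)).1
    exact_mod_cast this
  · intro i
    have := (abs_le.mp (hi i)).2
    exact_mod_cast this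

/-- The number `N` of momenta in the Fermi ball of radius `kF`. -/
def numN (kF : ℝ) : ℕ := (latticeBall kF).card

/-- `ħ = N^{-1/3}`. -/
def hbar (kF : ℝ) : ℝ := (numN kF : ℝ) ^ (-(1 / 3) : ℝ)

/-- `κ = kF N^{-1/3}`. -/
def kappa (kF : ℝ) : ℝ := kF * hbar kF

/-- The excitation energy `e(p) = |ħ² p² - κ²|`. -/
def disp (kF : ℝ) (p : Mom) : ℝ := |hbar kF ^ 2 * ‖vec p‖ ^ 2 - kappa kF ^ 2|

/-! ### Fermionic Fock space over the torus, in the plane-wave basis -/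

/-- Fermionic Fock space over `L²(𝕋³)` in occupation number representation: the orthonormal basis
consists of the Slater determinants of the plane waves with momenta in the finite sets `S`, and
`ψ S` is the coefficient of `ψ` at the Slater determinant of `S`. The vacuum is the basis vector
of `S = ∅`, and the `n`-particle sector is spanned by the sets of cardinality `n`. -/
abbrev Fock : Type := lp (fun _ : Finset Mom => ℂ) 2

open Classical in
/-- The fermionic sign `(-1)^{#{q ∈ S : q < p}}`, for the lexicographic order of momenta. -/
def jwSign (p : Mom) (S : Finset Mom) : ℂ :=
  (-1) ^ (S.filter (fun q => toLex q < toLex p)).card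

theorem norm_jwSign (p : Mom) (S : Finset Mom) : ‖jwSign p S‖ = 1 := by
  simp [jwSign]

open Classical in
/-- Coefficients of `a_p ψ`. -/
def annFun (p : Mom) (ψ : Finset Mom → ℂ) (S : Finset Mom) : ℂ :=
  if p ∈ S then 0 else jwSign p S * ψ (insert p S)

theorem annFun_sum_le (p : Mom) (ψ : Fock) (s : Finset (Finset Mom)) :
    ∑ S ∈ s, ‖annFun p ψ S‖ ^ (2 : ℝ≥0∞).toReal ≤ ‖ψ‖ ^ (2 : ℝ≥0∞).toReal := by
  classical
  have h2 : (0 : ℝ) < (2 : ℝ≥0∞).toReal := by norm_num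
  have h1 : ∑ S ∈ s, ‖annFun p ψ S‖ ^ (2 : ℝ≥0∞).toReal
      = ∑ S ∈ s.filter (fun S => p ∉ S), ‖ψ (insert p S)‖ ^ (2 : ℝ≥0∞).toReal := by
    rw [Finset.sum_filter]
    refine Finset.sum_congr rfl fun S _ => ?_
    by_cases h : p ∈ S
    · simp [annFun, h]
    · simp [annFun, h, norm_jwSign]
  have h3 : Set.InjOn (fun S : Finset Mom => insert p S) (s.filter (fun S => p ∉ S)) := by
    intro S hS T hT hST
    have hS' : p ∉ S := by simpa using (Finset.mem_filter.mp (Finset.mem_coe.mp hS)).2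
    have hT' : p ∉ T := by simpa using (Finset.mem_filter.mp (Finset.mem_coe.mp hT)).2
    have := congrArg (fun U => Finset.erase U p) hST
    simpa [Finset.erase_insert hS', Finset.erase_insert hT'] using this
  rw [h1, ← Finset.sum_image (f := fun T => ‖ψ T‖ ^ (2 : ℝ≥0∞).toReal) h3]
  exact lp.sum_rpow_le_norm_rpow h2 ψ _

/-- The annihilation operator `a_p` of the plane wave with momentum `p`. -/
def ann (p : Mom) : Fock →L[ℂ] Fock :=
  LinearMap.mkContinuous
    { toFun := fun ψ => ⟨annFun p ψ, memℓp_gen' (annFun_sum_le p ψ)⟩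
      map_add' := fun ψ φ => by
        ext S
        change annFun p (⇑(ψ + φ)) S = annFun p ψ S + annFun p φ S
        by_cases h : p ∈ S <;> simp [annFun, h, mul_add]
      map_smul' := fun c ψ => by
        ext S
        change annFun p (⇑(c • ψ)) S = c * annFun p ψ S
        by_cases h : p ∈ S <;> simp [annFun, h, mul_left_comm] }
    1
    (fun ψ => by
      rw [one_mul]
      exact lp.norm_le_of_forall_sum_le (by norm_num) (norm_nonneg ψ) (annFun_sum_le p ψ))

/-- The creation operator `a_p^*`. -/
def cre (p : Mom) : Fock →L[ℂ] Fock := ContinuousLinearMap.adjoint (ann p)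

open Classical in
theorem ann_apply (p : Mom) (ψ : Fock) (S : Finset Mom) :
    ann p ψ S = if p ∈ S then 0 else jwSign p S * ψ (insert p S) := rfl

open Classical in
/-- `a_p^* a_p` is the projection onto the configurations that contain `p`. Consequently an
operator `∑ g(p) a_p^* a_p` is multiplication by `∑_{p ∈ S} g(p)`. -/
theorem cre_ann_apply (p : Mom) (ψ : Fock) (S : Finset Mom) :
    cre p (ann p ψ) S = if p ∈ S then ψ S else 0 := by
  have h0 : ∀ φ : Fock, φ S = inner ℂ (lp.single 2 S (1 : ℂ) : Fock) φ := fun φ => by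
    simp [lp.inner_single_left]
  rw [h0, cre, ContinuousLinearMap.adjoint_inner_right]
  by_cases h : p ∈ S
  · have h1 : ann p (lp.single 2 S (1 : ℂ)) =
        lp.single 2 (S.erase p) (jwSign p (S.erase p)) := by
      ext T
      rw [ann_apply, lp.single_apply, lp.single_apply]
      by_cases hT : p ∈ T
      · have : T ≠ S.erase p := fun e => by simp [e] at hT
        simp [hT, this]
      · by_cases e : T = S.erase p
        · subst e
          simp [Finset.insert_erase h]
        · have : insert p T ≠ S := fun e' => e (by rw [← e', Finset.erase_insert hT])
          simp [hT, e, this]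
    rw [h1, lp.inner_single_left, ann_apply]
    have hn : jwSign p (S.erase p) * (starRingEnd ℂ) (jwSign p (S.erase p)) = 1 := by
      rw [Complex.mul_conj, Complex.normSq_eq_norm_sq, norm_jwSign]
      norm_num
    simp only [Finset.mem_erase, ne_eq, not_true_eq_false, false_and, if_false,
      Finset.insert_erase h, h, if_true, RCLike.inner_apply]
    linear_combination (ψ S) * hn
  · have h1 : ann p (lp.single 2 S (1 : ℂ)) = 0 := by
      ext T
      rw [ann_apply, lp.single_apply]
      have : insert p T ≠ S := fun e => h (by rw [← e]; exact Finset.mem_insert_self p T)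
      simp [this]
    rw [h1, inner_zero_left]
    simp [h]

/-- For a weight `w ≥ 0` on configurations, the value `‖w^{1/2} ψ‖² = ⟨ψ, w ψ⟩ ∈ [0, ∞]` of the
quadratic form of the self-adjoint operator of multiplication by `w`. -/
def diagForm (w : Finset Mom → ℝ) (ψ : Fock) : ℝ≥0∞ :=
  ∑' S : Finset Mom, ENNReal.ofReal (w S) * ‖ψ S‖ₑ ^ 2

/-- The quadratic form of the kinetic energy `ℍ₀ = ∑_p e(p) a_p^* a_p`. -/
def kinForm (kF : ℝ) (ψ : Fock) : ℝ≥0∞ := diagForm (fun S => ∑ p ∈ S, disp kF p) ψ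

open Classical in
/-- The eigenvalue on the configuration `S` of the gapped number operator
`𝒩_δ = ∑_{p : ||p| - kF| > θ N^{-δ}} a_p^* a_p`: the number of momenta in `S` at distance larger
than `θ N^{-δ}` from the Fermi sphere. -/
def gapNum (kF δ θ : ℝ) (S : Finset Mom) : ℝ :=
  ((S.filter (fun p => θ * (numN kF : ℝ) ^ (-δ) < |‖vec p‖ - kF|)).card : ℝ)

/-- `‖𝒩_δ^{1/2} ψ‖`. -/
def gapNorm (kF δ θ : ℝ) (ψ : Fock) : ℝ≥0∞ :=
  (diagForm (fun S => gapNum kF δ θ S) ψ) ^ (1 / 2 : ℝ)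

/-- `‖𝒩_δ^{1/2} 𝒩 ψ‖`, where `𝒩 = ∑_p a_p^* a_p` has the eigenvalue `S.card`. -/
def gapNumNorm (kF δ θ : ℝ) (ψ : Fock) : ℝ≥0∞ :=
  (diagForm (fun S => gapNum kF δ θ S * (S.card : ℝ) ^ 2) ψ) ^ (1 / 2 : ℝ)

/-! ### Patches -/

/-- The part of the shell `kF - R ≤ |x| ≤ kF + R` that projects radially into the subset `A` of
the unit sphere. -/
def thicken (kF R : ℝ) (A : Set E3) : Set E3 :=
  {x | kF - R ≤ ‖x‖ ∧ ‖x‖ ≤ kF + R ∧ ‖x‖⁻¹ • x ∈ A}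

/-- A decomposition of the shell of thickness `2R` around the Fermi sphere into `M` patches. The
patches are given by their radial projections to the unit sphere; they have diameter of order
`M^{-1/2}` in all directions (with ratios controlled by `c₀`), are separated by corridors larger
than `R`, and come in pairs of antipodal patches. -/
structure PatchDecomposition (kF R c₀ : ℝ) (M : ℕ) where
  /-- radial projection of the patch to the unit sphere -/
  patch : Fin M → Set E3
  /-- normalized patch center -/
  center : Fin M → E3
  /-- index of the antipodal patch -/
  mirror : Fin M → Fin M
  norm_center : ∀ α, ‖center α‖ = 1
  patch_subset : ∀ α, ∀ x ∈ patch α, ‖x‖ = 1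
  inner_cap : ∀ α, ∀ x : E3, ‖x‖ = 1 → ‖x - center α‖ ≤ 1 / (c₀ * √(M : ℝ)) → x ∈ patch α
  outer_cap : ∀ α, ∀ x ∈ patch α, ‖x - center α‖ ≤ c₀ / √(M : ℝ)
  corridor : ∀ α β, α ≠ β → ∀ x ∈ thicken kF R (patch α), ∀ y ∈ thicken kF R (patch β),
    R < ‖x - y‖
  mirror_mirror : ∀ α, mirror (mirror α) = α
  patch_mirror : ∀ α, patch (mirror α) = {x | -x ∈ patch α}
  center_mirror : ∀ α, center (mirror α) = -center α

open Classical in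
/-- The set `Γ^nor` of lattice vectors `k` with `|k| < R` in the northern half space. -/
def gammaNor (R : ℝ) : Finset Mom :=
  (latticeBall R).filter (fun k => ‖vec k‖ < R ∧
    (0 < k 2 ∨ (k 2 = 0 ∧ 0 < k 1) ∨ (k 2 = 0 ∧ k 1 = 0 ∧ 0 < k 0)))

/-- A branch of the complex logarithm on the unit circle with `log 1 = 0`: its imaginary part
takes values in an interval `[a - 2π, a]` with `0 < a < 2π`, so that the cut is at `e^{ia} ≠ 1`. -/
def IsLogBranch (lg : ℂ → ℂ) : Prop :=
  ∃ a : ℝ, 0 < a ∧ a < 2 * Real.pi ∧ ∀ z : ℂ, ‖z‖ = 1 →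
    Complex.exp (lg z) = z ∧ a - 2 * Real.pi ≤ (lg z).im ∧ (lg z).im ≤ a

/-- The positive square root of a real positive semidefinite matrix. -/
def msqrt {ι : Type} [Fintype ι] [DecidableEq ι] (A : Matrix ι ι ℝ) : Matrix ι ι ℝ :=
  cfc Real.sqrt A

/-- The orthogonal factor `X (Xᵀ X)^{-1/2}` in the polar decomposition of an invertible matrix. -/
def polarO {ι : Type} [Fintype ι] [DecidableEq ι] (X : Matrix ι ι ℝ) : Matrix ι ι ℝ :=
  X * (msqrt (X.transpose * X))⁻¹

namespace PatchDecomposition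

variable {kF R c₀ : ℝ} {M : ℕ} (P : PatchDecomposition kF R c₀ M)

/-- `k · ω̂_α`. -/
def kdot (k : Mom) (α : Fin M) : ℝ := inner ℝ (vec k) (P.center α)

/-- The lattice momenta in the patch `B_α`. -/
def InPatch (α : Fin M) (p : Mom) : Prop := vec p ∈ thicken kF R (P.patch α)

open Classical in
/-- The `p ∈ B_F^c ∩ B_α` with `p - k ∈ B_F ∩ B_α`. -/
def pairs (α : Fin M) (k : Mom) : Finset Mom :=
  (latticeBall (kF + R)).filter (fun p =>
    (kF < ‖vec p‖ ∧ P.InPatch α p) ∧ (‖vec (p - k)‖ ≤ kF ∧ P.InPatch α (p - k)))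

/-- The normalization `n_α(k)`, the square root of the number of pairs. -/
def nrm (α : Fin M) (k : Mom) : ℝ := √((P.pairs α k).card : ℝ)

/-- `b_α(k) = n_α(k)^{-1} ∑_p a_{p-k} a_p`, the adjoint of `b_α^*(k)`. -/
def bop (α : Fin M) (k : Mom) : Fock →L[ℂ] Fock :=
  (((P.nrm α k)⁻¹ : ℝ) : ℂ) • ∑ p ∈ P.pairs α k, ann (p - k) * ann p

open Classical in
/-- `ℐ_k^+ = {α : k · ω̂_α ≥ N^{-δ}}`. -/
def Iplus (δ : ℝ) (k : Mom) : Finset (Fin M) :=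
  Finset.univ.filter (fun α => (numN kF : ℝ) ^ (-δ) ≤ P.kdot k α)

open Classical in
/-- `ℐ_k^- = {α : k · ω̂_α ≤ -N^{-δ}}`. -/
def Iminus (δ : ℝ) (k : Mom) : Finset (Fin M) :=
  Finset.univ.filter (fun α => P.kdot k α ≤ -(numN kF : ℝ) ^ (-δ))

open Classical in
/-- `c_α(k)` is `b_α(k)` for `α ∈ ℐ_k^+` and `b_α(-k)` for `α ∈ ℐ_k^-`. -/
def cop (δ : ℝ) (α : Fin M) (k : Mom) : Fock →L[ℂ] Fock :=
  if α ∈ P.Iplus δ k then P.bop α k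
  else if α ∈ P.Iminus δ k then P.bop α (-k) else 0

open Classical in
/-- The normalization of `c_α(k)`: `n_α(k)` for `α ∈ ℐ_k^+` and `n_α(-k)` for `α ∈ ℐ_k^-`. -/
def cnrm (δ : ℝ) (α : Fin M) (k : Mom) : ℝ :=
  if α ∈ P.Iplus δ k then P.nrm α k
  else if α ∈ P.Iminus δ k then P.nrm α (-k) else 0

/-- `𝔻_B = 2κħ ∑_{k ∈ Γ^nor} ∑_{α ∈ ℐ_k} |k · ω̂_α| c_α^*(k) c_α(k)`. -/
def DB (δ : ℝ) : Fock →L[ℂ] Fock :=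
  ((2 * kappa kF * hbar kF : ℝ) : ℂ) • ∑ k ∈ gammaNor R, ∑ α ∈ P.Iplus δ k ∪ P.Iminus δ k,
    ((|P.kdot k α| : ℝ) : ℂ) •
      (ContinuousLinearMap.adjoint (P.cop δ α k) * P.cop δ α k)

/-! ### The one-particle kernel -/

/-- The index set `ℐ_k = ℐ_k^+ ∪ ℐ_k^-`, where `ℐ_k^-` is identified with a second copy of `ℐ_k^+`
through the antipodal map of patches. -/
abbrev Idx (δ : ℝ) (k : Mom) : Type := {α // α ∈ P.Iplus δ k} ⊕ {α // α ∈ P.Iplus δ k}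

/-- The patch label that belongs to an index. -/
def lab {δ : ℝ} {k : Mom} : P.Idx δ k → Fin M
  | Sum.inl α => α.1
  | Sum.inr α => P.mirror α.1

/-- `|k̂ · ω̂_α|`. -/
def khat (k : Mom) (α : Fin M) : ℝ := |P.kdot k α| / ‖vec k‖

/-- The common prefactor `V̂(k) / (2ħκN|k|)` of `W(k)` and `W̃(k)`. -/
def wpre (_ : PatchDecomposition kF R c₀ M) (Vhat : Mom → ℝ) (k : Mom) : ℝ :=
  Vhat k / (2 * hbar kF * kappa kF * (numN kF : ℝ) * ‖vec k‖)

/-- `D(k)`. -/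
def matD (δ : ℝ) (k : Mom) : Matrix (P.Idx δ k) (P.Idx δ k) ℝ :=
  Matrix.diagonal (fun s => P.khat k (P.lab s))

/-- `W(k)`: coupling of patches on the same side of the equator. -/
def matW (Vhat : Mom → ℝ) (δ : ℝ) (k : Mom) : Matrix (P.Idx δ k) (P.Idx δ k) ℝ :=
  Matrix.of fun s t => if s.isLeft = t.isLeft then
    P.wpre Vhat k * P.cnrm δ (P.lab s) k * P.cnrm δ (P.lab t) k else 0

/-- `W̃(k)`: coupling of patches on opposite sides of the equator. -/
def matWt (Vhat : Mom → ℝ) (δ : ℝ) (k : Mom) : Matrix (P.Idx δ k) (P.Idx δ k) ℝ :=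
  Matrix.of fun s t => if s.isLeft = t.isLeft then 0 else
    P.wpre Vhat k * P.cnrm δ (P.lab s) k * P.cnrm δ (P.lab t) k

/-- `E = [(D+W-W̃)^{1/2} (D+W+W̃) (D+W-W̃)^{1/2}]^{1/2}`. -/
def matE (Vhat : Mom → ℝ) (δ : ℝ) (k : Mom) : Matrix (P.Idx δ k) (P.Idx δ k) ℝ :=
  msqrt (msqrt (P.matD δ k + P.matW Vhat δ k - P.matWt Vhat δ k) *
    (P.matD δ k + P.matW Vhat δ k + P.matWt Vhat δ k) *
    msqrt (P.matD δ k + P.matW Vhat δ k - P.matWt Vhat δ k))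

/-- `O(k)`: the orthogonal factor of `S₁ = (D+W-W̃)^{1/2} E^{-1/2}`. -/
def matO (Vhat : Mom → ℝ) (δ : ℝ) (k : Mom) : Matrix (P.Idx δ k) (P.Idx δ k) ℝ :=
  polarO (msqrt (P.matD δ k + P.matW Vhat δ k - P.matWt Vhat δ k) *
    (msqrt (P.matE Vhat δ k))⁻¹)

/-- `d`: the block of `D(k)` that belongs to `ℐ_k^+`. -/
def matd (δ : ℝ) (k : Mom) :
    Matrix {α // α ∈ P.Iplus δ k} {α // α ∈ P.Iplus δ k} ℝ :=
  Matrix.diagonal (fun α => P.khat k α.1)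

/-- `b`: the block of `W(k)` that belongs to `ℐ_k^+`. -/
def matb (Vhat : Mom → ℝ) (δ : ℝ) (k : Mom) :
    Matrix {α // α ∈ P.Iplus δ k} {α // α ∈ P.Iplus δ k} ℝ :=
  Matrix.of fun α β => P.wpre Vhat k * P.cnrm δ α.1 k * P.cnrm δ β.1 k

/-- `A`: the orthogonal factor of `X = (d+2b)^{1/2} d^{1/2}`. -/
def matA (Vhat : Mom → ℝ) (δ : ℝ) (k : Mom) :
    Matrix {α // α ∈ P.Iplus δ k} {α // α ∈ P.Iplus δ k} ℝ :=
  polarO (msqrt (P.matd δ k + (2 : ℝ) • P.matb Vhat δ k) * msqrt (P.matd δ k))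

/-- `U = 2^{-1/2} [[1, 1], [1, -1]]`. -/
def matU (δ : ℝ) (k : Mom) : Matrix (P.Idx δ k) (P.Idx δ k) ℝ :=
  (√2)⁻¹ • Matrix.fromBlocks 1 1 1 (-1)

/-- `Õ(k) = U diag(1, A) Uᵀ`. -/
def matOt (Vhat : Mom → ℝ) (δ : ℝ) (k : Mom) : Matrix (P.Idx δ k) (P.Idx δ k) ℝ :=
  P.matU δ k * Matrix.fromBlocks 1 0 0 (P.matA Vhat δ k) * (P.matU δ k).transpose

/-- `L(k) = log (O(k) Õ(k))`, by the functional calculus of the unitary matrix `O(k) Õ(k)`. -/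
def matL (lg : ℂ → ℂ) (Vhat : Mom → ℝ) (δ : ℝ) (k : Mom) :
    Matrix (P.Idx δ k) (P.Idx δ k) ℂ :=
  cfc lg ((P.matO Vhat δ k * P.matOt Vhat δ k).map (fun x : ℝ => (x : ℂ)))

/-- `Z = exp (∑_{k ∈ Γ^nor} ∑_{α, β ∈ ℐ_k} L(k)_{α,β} c_α^*(k) c_β(k))`. -/
def Z (lg : ℂ → ℂ) (Vhat : Mom → ℝ) (δ : ℝ) : Fock →L[ℂ] Fock :=
  NormedSpace.exp (∑ k ∈ gammaNor R, ∑ s : P.Idx δ k, ∑ t : P.Idx δ k,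
    P.matL lg Vhat δ k s t •
      (ContinuousLinearMap.adjoint (P.cop δ (P.lab s) k) * P.cop δ (P.lab t) k))

/-- `⟨ψ, (ℍ₀ - 𝔻_B) ψ⟩` for `ψ` in the form domain of `ℍ₀`. -/
def diffForm (δ : ℝ) (ψ : Fock) : ℝ :=
  (kinForm kF ψ).toReal - (inner ℂ ψ (P.DB δ ψ)).re

end PatchDecomposition

end FermiPatch

end

noncomputable section

namespace FermiPatch

/-! ### Canonical anticommutation relations -/

/-! Write Z = exp(B) with B = ∑ L(k)_{αβ} c_α^*(k) c_β(k). Since L(k) is the logarithm of a unitary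
matrix, B is skew-adjoint. With X = ℍ₀ - 𝔻_B and ψ_t = exp(tB)ψ, the derivative of ⟨ψ_t, Xψ_t⟩ is
⟨ψ_t, [X, B]ψ_t⟩, so the claim reduces to a bound on this commutator for 0 ≤ t ≤ 1.

If the dispersion were linear in every patch and the c_α(k) were exactly bosonic, ℍ₀ and 𝔻_B would
have the same commutator with each c_α(k), and X would commute with B. Two errors remain, collected
in `resid`. First, the energy of a pair differs from 2κħ|k·ω̂_α| by O(ħ|k|M^{-1/2})
(`Wide.linearization`, `abs_weight_le`). Second, the bosonic commutation relations fail by a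
one-body operator bounded by 2𝒩/(n_α(k) n_α(l)) (`norm_errOp_apply_le`), which the lower bound
`Wide.le_nrm` on the number of pairs makes small. Both errors, and the c_α(k) themselves, are square
summable over the patches: distinct patches are disjoint, and by `Wide.gap` every pair contains a
momentum counted by 𝒩_δ, so the sums are bounded by expectations of 𝒩_δ (`sum_norm_wbop_sq_le`).

The coefficients are controlled by showing that the Hilbert–Schmidt norm of L(k) is O(V̂(k))
uniformly in the scaling regime. Symmetric and antisymmetric combinations of antipodal patches
decouple, and both blocks of O(k)Õ(k) turn out to be the same orthogonal matrix, the polar factor of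
d^{1/2}h^{-1} with h⁴ = d^{1/2}(d+2b)d^{1/2}. A Riccati equation for a geometric mean bounds its
Hilbert–Schmidt distance to 1 by 2 tr(d^{-1}b) (`polar_factors`). The upper bound `Wide.nrm_sq_le`
on the number of pairs makes this trace O(V̂(k)), and the logarithm is Lipschitz at 1 because the
cut stays away from 1 (`hs_cfc_log_le`).

Two points complete the argument. The estimates hold at ψ_t and have to be pulled back to ψ: B
commutes with the number operator of the relevant modes, and 𝒩_δ grows at most exponentially by
Grönwall (`abs_comm_gapOp_le`, `re_inner_flow_le`). The unboundedness of ℍ₀ is harmless because B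
acts only on modes in the ball of radius kF + R, and all other occupation numbers are conserved
(`kinForm_sub`). -/

open Classical in
theorem jwSign_insert {p q : Mom} {S : Finset Mom} (hp : p ∉ S) :
    jwSign q (insert p S) = (if toLex p < toLex q then -1 else 1) * jwSign q S := by
  unfold jwSign
  by_cases h : toLex p < toLex q
  · rw [Finset.filter_insert, if_pos h, if_pos h, Finset.card_insert_of_notMem (by simp [hp]),
      pow_succ]
    ring
  · rw [Finset.filter_insert, if_neg h, if_neg h, one_mul]

theorem jwSign_mul_self (p : Mom) (S : Finset Mom) : jwSign p S * jwSign p S = 1 := by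
  rw [jwSign, ← mul_pow]
  simp

theorem conj_jwSign (p : Mom) (S : Finset Mom) : (starRingEnd ℂ) (jwSign p S) = jwSign p S := by
  simp [jwSign]

-- Exactly one of the two comparisons holds. This relative sign is the source of the anticommutation
-- relations between different modes.
open Classical in
theorem lex_sign {p q : Mom} (h : p ≠ q) :
    (if toLex p < toLex q then (-1 : ℂ) else 1) = - (if toLex q < toLex p then (-1 : ℂ) else 1) := by
  have h' : toLex p ≠ toLex q := fun e => h (toLex.injective e)
  have h0 : toLex p < toLex q ∨ toLex q < toLex p := lt_or_gt_of_ne h'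
  rcases h0 with h1 | h1
  · have h2 : ¬ toLex q < toLex p := lt_asymm h1
    simp only [h1, h2, if_true, if_false]
  · have h2 : ¬ toLex p < toLex q := lt_asymm h1
    simp only [h1, h2, if_true, if_false, neg_neg]

theorem fock_apply_eq_inner (φ : Fock) (S : Finset Mom) :
    φ S = inner ℂ (lp.single 2 S (1 : ℂ) : Fock) φ := by
  simp [lp.inner_single_left]

open Classical in
theorem cre_apply (p : Mom) (ψ : Fock) (S : Finset Mom) :
    cre p ψ S = if p ∈ S then jwSign p (S.erase p) * ψ (S.erase p) else 0 := by
  rw [fock_apply_eq_inner, cre, ContinuousLinearMap.adjoint_inner_right]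
  by_cases h : p ∈ S
  · have h1 : ann p (lp.single 2 S (1 : ℂ)) =
        lp.single 2 (S.erase p) (jwSign p (S.erase p)) := by
      ext T
      rw [ann_apply, lp.single_apply, lp.single_apply]
      by_cases hT : p ∈ T
      · have : T ≠ S.erase p := fun e => by simp [e] at hT
        simp [hT, this]
      · by_cases e : T = S.erase p
        · subst e
          simp [Finset.insert_erase h]
        · have : insert p T ≠ S := fun e' => e (by rw [← e', Finset.erase_insert hT])
          simp [hT, e, this]
    rw [h1, lp.inner_single_left, if_pos h, RCLike.inner_apply, conj_jwSign, mul_comm]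
  · have h1 : ann p (lp.single 2 S (1 : ℂ)) = 0 := by
      ext T
      rw [ann_apply, lp.single_apply]
      have : insert p T ≠ S := fun e => h (by rw [← e]; exact Finset.mem_insert_self p T)
      simp [this]
    rw [h1, inner_zero_left, if_neg h]

theorem ann_anticomm (p q : Mom) : ann p * ann q = - (ann q * ann p) := by
  classical
  ext ψ S
  change ann p (ann q ψ) S = - (ann q (ann p ψ) S)
  simp only [ann_apply]
  by_cases h : p = q
  · subst h
    simp
  by_cases hp : p ∈ S
  · simp [hp]
  by_cases hq : q ∈ S
  · simp [hq]
  have h' : q ≠ p := fun e => h e.symm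
  simp only [hp, hq, Finset.mem_insert, h, h', or_self, if_false, jwSign_insert hp,
    jwSign_insert hq, lex_sign h', Finset.insert_comm q p S]
  ring

theorem ann_mul_self (p : Mom) : ann p * ann p = 0 := by
  have h : (2 : ℂ) • (ann p * ann p) = 0 := by
    have h := ann_anticomm p p
    rw [two_smul]
    nth_rewrite 1 [h]
    simp
  simpa using h

theorem ann_cre_of_ne {p q : Mom} (h : p ≠ q) : ann p * cre q = - (cre q * ann p) := by
  classical
  ext ψ S
  change ann p (cre q ψ) S = - (cre q (ann p ψ) S)
  have h' : q ≠ p := fun e => h e.symm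
  rw [ann_apply, cre_apply, cre_apply, ann_apply]
  by_cases hp : p ∈ S
  · have : p ∈ S.erase q := Finset.mem_erase.2 ⟨h, hp⟩
    simp [hp, this]
  by_cases hq : q ∈ S
  · obtain ⟨T, hT, rfl⟩ : ∃ T, q ∉ T ∧ S = insert q T :=
      ⟨S.erase q, by simp, (Finset.insert_erase hq).symm⟩
    have hpT : p ∉ T := fun e => hp (Finset.mem_insert_of_mem e)
    have e1 : (insert p (insert q T)).erase q = insert p T := by
      rw [Finset.insert_comm, Finset.erase_insert]
      simp [h', hT]
    have e2 : (insert q T).erase q = T := Finset.erase_insert hT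
    rw [e1, e2]
    simp only [hp, hpT, hq, if_false, if_true, Finset.mem_insert, or_true,
      jwSign_insert hT, jwSign_insert hpT, lex_sign h]
    split_ifs <;> ring
  · simp [hp, hq, h']

theorem ann_cre_self (p : Mom) : ann p * cre p = 1 - cre p * ann p := by
  classical
  ext ψ S
  change ann p (cre p ψ) S = ψ S - cre p (ann p ψ) S
  rw [ann_apply, cre_apply, cre_ann_apply]
  by_cases hp : p ∈ S
  · simp [hp]
  · simp only [hp, if_false, Finset.mem_insert, true_or, if_true, Finset.erase_insert hp, sub_zero]
    rw [← mul_assoc, jwSign_mul_self, one_mul]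

theorem star_ann (p : Mom) : star (ann p) = cre p := rfl

theorem star_cre (p : Mom) : star (cre p) = ann p := by
  rw [← star_ann, star_star]

theorem norm_ann_apply_le (p : Mom) (ψ : Fock) : ‖ann p ψ‖ ≤ ‖ψ‖ := by
  have h : ‖ann p‖ ≤ 1 := LinearMap.mkContinuous_norm_le _ zero_le_one _
  simpa using (ann p).le_of_opNorm_le h ψ

/-- `a_q^* a_q` shifts: `[a_q^* a_q, a_p] = -δ_{pq} a_p`. -/
theorem num_ann_of_ne {p q : Mom} (h : p ≠ q) : cre q * ann q * ann p = ann p * (cre q * ann q) := by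
  have h' : ann p * cre q = - (cre q * ann p) := ann_cre_of_ne h
  rw [mul_assoc, ann_anticomm q p, ← mul_assoc (ann p), h']
  noncomm_ring

theorem num_ann_self (p : Mom) : cre p * ann p * ann p = ann p * (cre p * ann p) - ann p := by
  rw [mul_assoc, ann_mul_self, mul_zero, ← mul_assoc, ann_cre_self, sub_mul, one_mul, mul_assoc,
    ann_mul_self, mul_zero, sub_zero, sub_self]

/-- The second quantization `∑_{p ∈ Λ} w(p) a_p^* a_p`. -/
def numOp (Λ : Finset Mom) (w : Mom → ℝ) : Fock →L[ℂ] Fock :=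
  ∑ p ∈ Λ, ((w p : ℝ) : ℂ) • (cre p * ann p)

theorem star_numOp (Λ : Finset Mom) (w : Mom → ℝ) : star (numOp Λ w) = numOp Λ w := by
  simp [numOp, star_sum, star_smul, star_mul, star_ann, star_cre]

theorem numOp_mul_ann {Λ : Finset Mom} (w : Mom → ℝ) {p : Mom} (hp : p ∈ Λ) :
    numOp Λ w * ann p = ann p * numOp Λ w - ((w p : ℝ) : ℂ) • ann p := by
  classical
  rw [numOp, Finset.sum_mul, Finset.mul_sum, ← Finset.add_sum_erase Λ _ hp,
    ← Finset.add_sum_erase Λ (fun i => ann p * _) hp]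
  rw [Finset.sum_congr rfl (g := fun i => ann p * (((w i : ℝ) : ℂ) • (cre i * ann i)))]
  · rw [smul_mul_assoc, num_ann_self, smul_sub, mul_smul_comm]
    abel
  · intro i hi
    rw [smul_mul_assoc, num_ann_of_ne (Finset.ne_of_mem_erase hi).symm, mul_smul_comm]

theorem numOp_mul_ann_ann {Λ : Finset Mom} (w : Mom → ℝ) {p q : Mom} (hp : p ∈ Λ) (hq : q ∈ Λ) :
    numOp Λ w * (ann p * ann q) =
      (ann p * ann q) * numOp Λ w - ((w p + w q : ℝ) : ℂ) • (ann p * ann q) := by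
  rw [← mul_assoc, numOp_mul_ann w hp, sub_mul, mul_assoc, numOp_mul_ann w hq, mul_sub,
    mul_smul_comm, smul_mul_assoc, Complex.ofReal_add, add_smul, mul_assoc]
  abel

theorem inner_numOp (Λ : Finset Mom) (w : Mom → ℝ) (ψ : Fock) :
    inner ℂ ψ (numOp Λ w ψ) = ((∑ p ∈ Λ, w p * ‖ann p ψ‖ ^ 2 : ℝ) : ℂ) := by
  rw [numOp, sum_apply, inner_sum, Complex.ofReal_sum]
  refine Finset.sum_congr rfl fun p _ => ?_
  rw [smul_apply, inner_smul_right]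
  have h : (cre p * ann p) ψ = ContinuousLinearMap.adjoint (ann p) (ann p ψ) := rfl
  rw [h, ContinuousLinearMap.adjoint_inner_right, inner_self_eq_norm_sq_to_K]
  push_cast
  rfl

theorem re_inner_numOp (Λ : Finset Mom) (w : Mom → ℝ) (ψ : Fock) :
    (inner ℂ ψ (numOp Λ w ψ)).re = ∑ p ∈ Λ, w p * ‖ann p ψ‖ ^ 2 := by
  rw [inner_numOp, Complex.ofReal_re]

/-- The number operator of the modes in `Λ`. -/
abbrev numΛ (Λ : Finset Mom) : Fock →L[ℂ] Fock := numOp Λ (fun _ => 1)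

theorem inner_adj (A : Fock →L[ℂ] Fock) (x y : Fock) :
    inner ℂ x (A y) = inner ℂ (star A x) y := by
  rw [ContinuousLinearMap.star_eq_adjoint, ContinuousLinearMap.adjoint_inner_left]

theorem inner_adj_left (A : Fock →L[ℂ] Fock) (x y : Fock) :
    inner ℂ (A x) y = inner ℂ x (star A y) := by
  rw [ContinuousLinearMap.star_eq_adjoint, ContinuousLinearMap.adjoint_inner_right]

/-- The inner sum is ⟨a_p x, 𝒩 a_p x⟩, and moving 𝒩 past a_p costs one unit; the outer sum then
rebuilds 𝒩. Both sides are the expectation of 𝒩(𝒩 - 1). -/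
theorem sum_norm_ann_ann (Λ : Finset Mom) (x : Fock) :
    ∑ p ∈ Λ, ∑ q ∈ Λ, ‖ann q (ann p x)‖ ^ 2 = ‖numΛ Λ x‖ ^ 2 - ∑ p ∈ Λ, ‖ann p x‖ ^ 2 := by
  have h1 : ∀ p ∈ Λ, ∑ q ∈ Λ, ‖ann q (ann p x)‖ ^ 2 =
      (inner ℂ (ann p x) (ann p (numΛ Λ x))).re - ‖ann p x‖ ^ 2 := by
    intro p hp
    have e := re_inner_numOp Λ (fun _ => 1) (ann p x)
    simp only [one_mul] at e
    rw [← e]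
    have e2 : numΛ Λ (ann p x) = ann p (numΛ Λ x) - ann p x := by
      have := congrArg (fun A : Fock →L[ℂ] Fock => A x) (numOp_mul_ann (fun _ => 1) hp)
      simpa using this
    rw [e2, inner_sub_right, Complex.sub_re, inner_self_eq_norm_sq_to_K]
    congr 1
    norm_cast
  rw [Finset.sum_congr rfl h1, Finset.sum_sub_distrib]
  congr 1
  have h2 : ∀ p, (inner ℂ (ann p x) (ann p (numΛ Λ x))) = inner ℂ ((cre p * ann p) x) (numΛ Λ x) := by
    intro p
    rw [inner_adj, star_ann]
    rfl
  simp_rw [h2]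
  rw [← Complex.re_sum, ← sum_inner, ← sum_apply]
  have h3 : ∑ p ∈ Λ, cre p * ann p = numΛ Λ := by simp [numOp]
  rw [h3, inner_self_eq_norm_sq_to_K]
  norm_cast

/-- One-body operators that map modes injectively to modes are bounded by the number operator. -/
theorem norm_sum_cre_ann_le {ι : Type*} (s : Finset ι) (f g : ι → Mom) (Λ : Finset Mom)
    (hf : Set.InjOn f s) (hg : Set.InjOn g s) (hfΛ : ∀ i ∈ s, f i ∈ Λ) (hgΛ : ∀ i ∈ s, g i ∈ Λ)
    (x : Fock) : ‖∑ i ∈ s, cre (f i) (ann (g i) x)‖ ≤ ‖numΛ Λ x‖ := by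
  classical
  refine le_of_sq_le_sq ?_ (norm_nonneg _)
  -- Normal ordering a Gram entry leaves a diagonal term (`f` is injective) minus a product of
  -- two-particle amplitudes, which is split symmetrically so that each half can be summed over
  -- distinct pairs of modes.
  have key : ∀ i ∈ s, ∀ j ∈ s, (inner ℂ (cre (f i) (ann (g i) x)) (cre (f j) (ann (g j) x))).re ≤
      (if i = j then ‖ann (g i) x‖ ^ 2 else 0) +
        (‖ann (f j) (ann (g i) x)‖ ^ 2 + ‖ann (f i) (ann (g j) x)‖ ^ 2) / 2 := by
    intro i hi j hj
    have e1 : inner ℂ (cre (f i) (ann (g i) x)) (cre (f j) (ann (g j) x)) =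
        (if i = j then ((‖ann (g i) x‖ ^ 2 : ℝ) : ℂ) else 0) -
          inner ℂ (ann (f j) (ann (g i) x)) (ann (f i) (ann (g j) x)) := by
      have e0 : inner ℂ (cre (f i) (ann (g i) x)) (cre (f j) (ann (g j) x)) =
          inner ℂ (ann (g i) x) ((ann (f i) * cre (f j)) (ann (g j) x)) := by
        rw [inner_adj_left, star_cre]
        rfl
      have e2 : inner ℂ (ann (f j) (ann (g i) x)) (ann (f i) (ann (g j) x)) =
          inner ℂ (ann (g i) x) ((cre (f j) * ann (f i)) (ann (g j) x)) := by
        rw [inner_adj_left, star_ann]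
        rfl
      rw [e0, e2]
      by_cases hij : i = j
      · subst hij
        rw [if_pos rfl, ann_cre_self, sub_apply, inner_sub_right,
          one_apply_eq_self, inner_self_eq_norm_sq_to_K]
        norm_cast
      · have : f i ≠ f j := fun e => hij (hf hi hj e)
        rw [if_neg hij, ann_cre_of_ne this, neg_apply, inner_neg_right, zero_sub]
    rw [e1, Complex.sub_re]
    have h3 : -(inner ℂ (ann (f j) (ann (g i) x)) (ann (f i) (ann (g j) x))).re ≤
        ‖ann (f j) (ann (g i) x)‖ * ‖ann (f i) (ann (g j) x)‖ := by
      refine le_trans (neg_le_abs _) ((Complex.abs_re_le_norm _).trans (norm_inner_le_norm _ _))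
    have h4 : (if i = j then ((‖ann (g i) x‖ ^ 2 : ℝ) : ℂ) else 0).re =
        if i = j then ‖ann (g i) x‖ ^ 2 else 0 := by
      split_ifs
      · exact Complex.ofReal_re _
      · rfl
    rw [h4]
    nlinarith [sq_nonneg (‖ann (f j) (ann (g i) x)‖ - ‖ann (f i) (ann (g j) x)‖)]
  have h1 : ‖∑ i ∈ s, cre (f i) (ann (g i) x)‖ ^ 2 =
      ∑ i ∈ s, ∑ j ∈ s, (inner ℂ (cre (f i) (ann (g i) x)) (cre (f j) (ann (g j) x))).re := by
    have := inner_self_eq_norm_sq_to_K (𝕜 := ℂ) (∑ i ∈ s, cre (f i) (ann (g i) x))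
    have h2 := congrArg Complex.re this
    rw [sum_inner, Complex.re_sum] at h2
    simp_rw [inner_sum, Complex.re_sum] at h2
    rw [h2]
    norm_cast
  rw [h1]
  have hS : ∑ i ∈ s, ∑ j ∈ s, ‖ann (f j) (ann (g i) x)‖ ^ 2 ≤
      ∑ p ∈ Λ, ∑ q ∈ Λ, ‖ann q (ann p x)‖ ^ 2 := by
    have a1 : ∀ i ∈ s, ∑ j ∈ s, ‖ann (f j) (ann (g i) x)‖ ^ 2 ≤ ∑ q ∈ Λ, ‖ann q (ann (g i) x)‖ ^ 2 := by
      intro i _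
      rw [← Finset.sum_image (f := fun q => ‖ann q (ann (g i) x)‖ ^ 2) hf]
      exact Finset.sum_le_sum_of_subset_of_nonneg (Finset.image_subset_iff.2 hfΛ)
        fun _ _ _ => sq_nonneg _
    refine (Finset.sum_le_sum a1).trans ?_
    rw [← Finset.sum_image (f := fun p => ∑ q ∈ Λ, ‖ann q (ann p x)‖ ^ 2) hg]
    exact Finset.sum_le_sum_of_subset_of_nonneg (Finset.image_subset_iff.2 hgΛ)
      fun _ _ _ => Finset.sum_nonneg fun _ _ => sq_nonneg _
  have hS' : ∑ i ∈ s, ∑ j ∈ s, ‖ann (f i) (ann (g j) x)‖ ^ 2 =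
      ∑ i ∈ s, ∑ j ∈ s, ‖ann (f j) (ann (g i) x)‖ ^ 2 := Finset.sum_comm
  have hD : ∑ i ∈ s, ‖ann (g i) x‖ ^ 2 ≤ ∑ p ∈ Λ, ‖ann p x‖ ^ 2 := by
    rw [← Finset.sum_image (f := fun q => ‖ann q x‖ ^ 2) hg]
    exact Finset.sum_le_sum_of_subset_of_nonneg (Finset.image_subset_iff.2 hgΛ)
      fun _ _ _ => sq_nonneg _
  have h5 := Finset.sum_le_sum fun i hi => Finset.sum_le_sum (key i hi)
  refine h5.trans ?_
  simp_rw [Finset.sum_add_distrib, ← Finset.sum_div, Finset.sum_add_distrib]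
  rw [hS']
  have h6 : ∑ i ∈ s, ∑ j ∈ s, (if i = j then ‖ann (g i) x‖ ^ 2 else 0) = ∑ i ∈ s, ‖ann (g i) x‖ ^ 2 :=
    Finset.sum_congr rfl fun i hi => by rw [Finset.sum_ite_eq, if_pos hi]
  rw [h6]
  -- The diagonal contributes ⟨x, 𝒩x⟩ and the rest ⟨x, 𝒩(𝒩 - 1)x⟩, which add up to ‖𝒩x‖².
  have h7 := sum_norm_ann_ann Λ x
  linarith

/-! ### Square roots and polar decompositions of real matrices -/

section Matrices

set_option linter.unusedSectionVars false

variable {ι κ : Type} [Fintype ι] [DecidableEq ι] [Fintype κ]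

theorem PosSemidef.transpose_eq {A : Matrix ι ι ℝ} (hA : A.PosSemidef) : A.transpose = A := by
  rw [← Matrix.conjTranspose_eq_transpose_of_trivial]
  exact hA.1

theorem msqrt_isSelfAdjoint (A : Matrix ι ι ℝ) : IsSelfAdjoint (msqrt A) :=
  cfc_predicate Real.sqrt A

theorem spectrum_nonneg {A : Matrix ι ι ℝ} (hA : A.PosSemidef) :
    ∀ x ∈ spectrum ℝ A, 0 ≤ x := fun _ hx =>
  (Matrix.posSemidef_iff_isHermitian_and_spectrum_nonneg.1 hA).2 hx

theorem msqrt_posSemidef {A : Matrix ι ι ℝ} (hA : A.PosSemidef) : (msqrt A).PosSemidef := by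
  rw [Matrix.posSemidef_iff_isHermitian_and_spectrum_nonneg]
  refine ⟨msqrt_isSelfAdjoint A, ?_⟩
  have hs : IsSelfAdjoint A := hA.1
  rw [msqrt, cfc_map_spectrum (R := ℝ) Real.sqrt A hs Real.continuous_sqrt.continuousOn]
  rintro _ ⟨x, _, rfl⟩
  exact Real.sqrt_nonneg x

theorem msqrt_mul_msqrt {A : Matrix ι ι ℝ} (hA : A.PosSemidef) : msqrt A * msqrt A = A := by
  have hs : IsSelfAdjoint A := hA.1
  rw [msqrt, ← cfc_mul Real.sqrt Real.sqrt A Real.continuous_sqrt.continuousOn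
    Real.continuous_sqrt.continuousOn]
  conv_rhs => rw [← cfc_id ℝ A hs]
  exact cfc_congr fun x hx => Real.mul_self_sqrt (spectrum_nonneg hA x hx)

/-- Uniqueness of the positive root, since √(x²) = x on a nonnegative spectrum. Explicit candidates
for roots are verified through it by squaring. -/
theorem msqrt_eq {A B : Matrix ι ι ℝ} (hB : B.PosSemidef) (h : B * B = A) : msqrt A = B := by
  have hs : IsSelfAdjoint B := hB.1
  have h1 : A = cfc (fun x : ℝ => x * x) B := by
    rw [cfc_mul (fun x : ℝ => x) (fun x : ℝ => x) B continuousOn_id continuousOn_id, cfc_id' ℝ B hs, h]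
  rw [msqrt, h1, ← cfc_comp Real.sqrt (fun x : ℝ => x * x) B hs
    Real.continuous_sqrt.continuousOn (by fun_prop)]
  conv_rhs => rw [← cfc_id ℝ B hs]
  exact cfc_congr fun x hx => Real.sqrt_mul_self (spectrum_nonneg hB x hx)

theorem posDef_of_isUnit {A : Matrix ι ι ℝ} (hA : A.PosSemidef) (hu : IsUnit A) : A.PosDef := by
  have h := hA
  rw [← msqrt_mul_msqrt hA]
  have ht : (msqrt A).conjTranspose = msqrt A := (msqrt_posSemidef hA).1
  have hu' : IsUnit (msqrt A) := by
    rw [← msqrt_mul_msqrt hA] at hu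
    rw [Matrix.isUnit_iff_isUnit_det, Matrix.det_mul] at hu
    exact (Matrix.isUnit_iff_isUnit_det _).2 (isUnit_of_mul_isUnit_left hu)
  have := Matrix.PosDef.conjTranspose_mul_self (msqrt A) (Matrix.mulVec_injective_of_isUnit hu')
  rwa [ht] at this

theorem msqrt_posDef {A : Matrix ι ι ℝ} (hA : A.PosDef) : (msqrt A).PosDef := by
  refine posDef_of_isUnit (msqrt_posSemidef hA.posSemidef) ?_
  have hu := hA.isUnit
  rw [← msqrt_mul_msqrt hA.posSemidef, Matrix.isUnit_iff_isUnit_det, Matrix.det_mul] at hu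
  exact (Matrix.isUnit_iff_isUnit_det _).2 (isUnit_of_mul_isUnit_left hu)

theorem PosDef.mul_inv {A : Matrix ι ι ℝ} (hA : A.PosDef) : A * A⁻¹ = 1 :=
  Matrix.mul_nonsing_inv A ((Matrix.isUnit_iff_isUnit_det A).1 hA.isUnit)

theorem PosDef.inv_mul {A : Matrix ι ι ℝ} (hA : A.PosDef) : A⁻¹ * A = 1 :=
  Matrix.nonsing_inv_mul A ((Matrix.isUnit_iff_isUnit_det A).1 hA.isUnit)

theorem PosDef.transpose_eq {A : Matrix ι ι ℝ} (hA : A.PosDef) : A.transpose = A :=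
  PosSemidef.transpose_eq hA.posSemidef

theorem PosSemidef.conj {A : Matrix ι ι ℝ} (hA : A.PosSemidef) (X : Matrix ι κ ℝ) :
    (X.transpose * A * X).PosSemidef := by
  have := hA.conjTranspose_mul_mul_same X
  rwa [Matrix.conjTranspose_eq_transpose_of_trivial] at this

theorem PosDef.conj {A : Matrix ι ι ℝ} (hA : A.PosDef) {X : Matrix ι ι ℝ} (hX : IsUnit X) :
    (X.transpose * A * X).PosDef := by
  have := hA.conjTranspose_mul_mul_same (Matrix.mulVec_injective_of_isUnit hX)
  rwa [Matrix.conjTranspose_eq_transpose_of_trivial] at this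

/-- Uniqueness of the polar decomposition: (OH)ᵀ(OH) = H². It computes polar factors from any
factorization into an orthogonal and a positive matrix. -/
theorem polarO_eq {O H : Matrix ι ι ℝ} (hO : O.transpose * O = 1) (hH : H.PosDef) :
    polarO (O * H) = O := by
  have h : msqrt ((O * H).transpose * (O * H)) = H := by
    refine msqrt_eq hH.posSemidef ?_
    rw [Matrix.transpose_mul, PosDef.transpose_eq hH]
    calc H * H = H * 1 * H := by rw [mul_one]
      _ = _ := by rw [← hO]; simp only [mul_assoc]
  rw [polarO, h, mul_assoc, PosDef.mul_inv hH, mul_one]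

/-! ### The Hilbert–Schmidt norm -/

/-- The Hilbert–Schmidt norm of a matrix. -/
def hs {𝕜 : Type} [RCLike 𝕜] (F : Matrix ι κ 𝕜) : ℝ :=
  ‖(WithLp.toLp 2 (fun p : ι × κ => F p.1 p.2) : EuclideanSpace 𝕜 (ι × κ))‖

theorem hs_nonneg {𝕜 : Type} [RCLike 𝕜] (F : Matrix ι κ 𝕜) : 0 ≤ hs F := norm_nonneg _

theorem hs_sq {𝕜 : Type} [RCLike 𝕜] (F : Matrix ι κ 𝕜) : hs F ^ 2 = ∑ i, ∑ j, ‖F i j‖ ^ 2 := by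
  rw [hs, EuclideanSpace.norm_sq_eq, Fintype.sum_prod_type]

theorem hs_add_le {𝕜 : Type} [RCLike 𝕜] (F G : Matrix ι κ 𝕜) : hs (F + G) ≤ hs F + hs G :=
  norm_add_le (WithLp.toLp 2 (fun p : ι × κ => F p.1 p.2) : EuclideanSpace 𝕜 (ι × κ))
    (WithLp.toLp 2 (fun p : ι × κ => G p.1 p.2))

theorem hs_neg {𝕜 : Type} [RCLike 𝕜] (F : Matrix ι κ 𝕜) : hs (-F) = hs F :=
  norm_neg (WithLp.toLp 2 (fun p : ι × κ => F p.1 p.2) : EuclideanSpace 𝕜 (ι × κ))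

theorem hs_sub_le {𝕜 : Type} [RCLike 𝕜] (F G : Matrix ι κ 𝕜) : hs (F - G) ≤ hs F + hs G := by
  rw [sub_eq_add_neg, ← hs_neg G]
  exact hs_add_le F (-G)

theorem trace_transpose_mul (F G : Matrix ι κ ℝ) :
    (F.transpose * G).trace = ∑ i, ∑ j, F i j * G i j := by
  rw [Finset.sum_comm]
  simp [Matrix.trace, Matrix.mul_apply]

theorem hs_sq_eq_trace (F : Matrix ι κ ℝ) : hs F ^ 2 = (F.transpose * F).trace := by
  rw [hs_sq, trace_transpose_mul]
  simp [sq]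

theorem hs_transpose (F : Matrix ι ι ℝ) : hs F.transpose = hs F := by
  refine (sq_eq_sq₀ (hs_nonneg _) (hs_nonneg _)).1 ?_
  rw [hs_sq, hs_sq, Finset.sum_comm]
  rfl

theorem trace_transpose_mul_le (F G : Matrix ι κ ℝ) : (F.transpose * G).trace ≤ hs F * hs G := by
  rw [trace_transpose_mul]
  have h := real_inner_le_norm (WithLp.toLp 2 (fun p : ι × κ => G p.1 p.2) : EuclideanSpace ℝ (ι × κ))
    (WithLp.toLp 2 (fun p : ι × κ => F p.1 p.2))
  rw [PiLp.inner_apply, Fintype.sum_prod_type] at h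
  rw [mul_comm (hs F)]
  refine le_trans (le_of_eq ?_) h
  simp

/-- The pairing of F with A F B is the trace of (F B^{1/2})ᵀ A (F B^{1/2}), hence nonnegative;
pairing F with F + A F B and using Cauchy–Schwarz gives the bound. No spectral gap enters, so
perturbation equations of this Sylvester type are solved with constant 1. -/
theorem hs_le_hs_add_mul_mul {A : Matrix ι ι ℝ} {B : Matrix ι ι ℝ} (hA : A.PosSemidef)
    (hB : B.PosSemidef) (F : Matrix ι ι ℝ) : hs F ≤ hs (F + A * F * B) := by
  have h1 : 0 ≤ (F.transpose * (A * F * B)).trace := by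
    have e : (F.transpose * (A * F * B)).trace =
        ((F * msqrt B).transpose * A * (F * msqrt B)).trace := by
      conv_lhs => rw [← msqrt_mul_msqrt hB]
      rw [Matrix.transpose_mul, PosSemidef.transpose_eq (msqrt_posSemidef hB)]
      simp only [← mul_assoc]
      rw [Matrix.trace_mul_comm]
      simp only [← mul_assoc]
    rw [e]
    exact (PosSemidef.conj hA _).trace_nonneg
  have h2 := trace_transpose_mul_le F (F + A * F * B)
  rw [mul_add, Matrix.trace_add, ← hs_sq_eq_trace] at h2
  rcases (hs_nonneg F).eq_or_lt with h0 | h0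
  · rw [← h0]
    exact hs_nonneg _
  · nlinarith

theorem hs_mul_le_of_contraction {C : Matrix ι ι ℝ} (hC : (1 - C * C.transpose).PosSemidef)
    (F : Matrix ι ι ℝ) : hs (F * C) ≤ hs F := by
  refine (sq_le_sq₀ (hs_nonneg _) (hs_nonneg _)).1 ?_
  have h1 := (PosSemidef.conj hC F.transpose).trace_nonneg
  rw [Matrix.transpose_transpose] at h1
  rw [hs_sq_eq_trace, hs_sq_eq_trace, Matrix.trace_mul_comm, Matrix.trace_mul_comm F.transpose]
  rw [mul_sub, sub_mul, mul_one, Matrix.trace_sub, sub_nonneg] at h1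
  refine le_trans (le_of_eq ?_) h1
  rw [Matrix.transpose_mul]
  simp only [mul_assoc]

/-- Entrywise Cauchy–Schwarz |T_ij|² ≤ T_ii T_jj, summed. Positivity is what turns the trace
identity of the Riccati equation into a norm bound. -/
theorem hs_le_trace {T : Matrix ι ι ℝ} (hT : T.PosSemidef) : hs T ≤ T.trace := by
  refine (sq_le_sq₀ (hs_nonneg _) hT.trace_nonneg).1 ?_
  set R := msqrt T with hR
  have hRt : R.transpose = R := PosSemidef.transpose_eq (msqrt_posSemidef hT)
  have e : ∀ i j, T i j = ∑ l, R l i * R l j := fun i j => by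
    conv_lhs => rw [← msqrt_mul_msqrt hT, ← hR]
    nth_rewrite 1 [← hRt]
    rfl
  have h1 : ∀ i j, ‖T i j‖ ^ 2 ≤ T i i * T j j := fun i j => by
    rw [Real.norm_eq_abs, sq_abs, e i j, e i i, e j j]
    have := Finset.sum_mul_sq_le_sq_mul_sq Finset.univ (fun l => R l i) (fun l => R l j)
    simpa [sq] using this
  rw [hs_sq, sq, Matrix.trace, Finset.sum_mul_sum]
  exact Finset.sum_le_sum fun i _ => Finset.sum_le_sum fun j _ => h1 i j

/-! ### Geometric means and the distance of polar factors to the identity -/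

/-- Testing the equation on an eigenvector v of G with eigenvalue 1 + λ gives (1 + λ)²⟨v, Dv⟩ = ⟨v,
(D + B)v⟩ ≥ ⟨v, Dv⟩, and 1 + λ > 0. -/
theorem posSemidef_sub_one_of_riccati {G D B : Matrix ι ι ℝ} (hG : G.PosDef) (hD : D.PosDef)
    (hB : B.PosSemidef) (h : G * D * G = D + B) : (G - 1).PosSemidef := by
  have hT : (G - 1).IsHermitian := hG.1.sub Matrix.isHermitian_one
  rw [hT.posSemidef_iff_eigenvalues_nonneg]
  intro i
  set v : ι → ℝ := (hT.eigenvectorBasis i).ofLp with hv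
  have hv0 : v ≠ 0 := fun h0 => by
    have := hT.eigenvectorBasis.orthonormal.ne_zero i
    exact this (by ext j; exact congrFun h0 j)
  have h1 : (G - 1).mulVec v = hT.eigenvalues i • v := hT.mulVec_eigenvectorBasis i
  have h2 : G.mulVec v = (1 + hT.eigenvalues i) • v := by
    rw [Matrix.sub_mulVec, Matrix.one_mulVec] at h1
    rw [add_smul, one_smul, ← h1]
    abel
  have hDp : 0 < v ⬝ᵥ D.mulVec v := by simpa using hD.dotProduct_mulVec_pos hv0
  have hBp : 0 ≤ v ⬝ᵥ B.mulVec v := by simpa using hB.dotProduct_mulVec_nonneg v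
  have hGp : 0 < v ⬝ᵥ G.mulVec v := by simpa using hG.dotProduct_mulVec_pos hv0
  have hvv : 0 ≤ v ⬝ᵥ v := Finset.sum_nonneg fun i _ => mul_self_nonneg _
  have h3 : v ⬝ᵥ (G * D * G).mulVec v = (1 + hT.eigenvalues i) ^ 2 * (v ⬝ᵥ D.mulVec v) := by
    rw [← Matrix.mulVec_mulVec, ← Matrix.mulVec_mulVec, h2, Matrix.mulVec_smul, Matrix.mulVec_smul,
      dotProduct_smul, Matrix.dotProduct_mulVec, ← Matrix.mulVec_transpose, PosDef.transpose_eq hG,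
      h2, smul_dotProduct]
    simp only [smul_eq_mul]
    ring
  rw [h, Matrix.add_mulVec, dotProduct_add] at h3
  rw [h2, dotProduct_smul, smul_eq_mul] at hGp
  have hpos : 0 < 1 + hT.eigenvalues i := by
    by_contra h0
    exact hGp.not_ge (mul_nonpos_of_nonpos_of_nonneg (not_lt.1 h0) hvv)
  change 0 ≤ hT.eigenvalues i
  by_contra hneg
  push Not at hneg
  have : (1 + hT.eigenvalues i) ^ 2 < 1 := by nlinarith
  nlinarith

/-- Put G = 1 + T, multiply the equation by D⁻¹ and take traces: the two linear terms both have
trace tr T by cyclicity, and the quadratic term D⁻¹TDT has nonnegative trace and can be dropped. -/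
theorem trace_sub_one_le_of_riccati {G D B : Matrix ι ι ℝ} (hG : G.PosDef) (hD : D.PosDef)
    (h : G * D * G = D + (2 : ℝ) • B) : (G - 1).trace ≤ (D⁻¹ * B).trace := by
  set T := G - 1 with hTdef
  have hGT : G = 1 + T := by rw [hTdef]; abel
  have hTt : T.transpose = T := by
    rw [hTdef, Matrix.transpose_sub, PosDef.transpose_eq hG, Matrix.transpose_one]
  have h1 : D⁻¹ * (G * D * G) = 1 + (2 : ℝ) • (D⁻¹ * B) := by
    rw [h, mul_add, PosDef.inv_mul hD, mul_smul_comm]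
  have h2 : D⁻¹ * (G * D * G) = 1 + (D⁻¹ * T * D) + T + D⁻¹ * (T.transpose * D * T) := by
    have : D⁻¹ * (G * D * G) = D⁻¹ * D + (D⁻¹ * T * D) + (D⁻¹ * D) * T + D⁻¹ * (T * D * T) := by
      rw [hGT]
      noncomm_ring
    rw [this, hTt, PosDef.inv_mul hD, one_mul]
  have h3 : 0 ≤ (D⁻¹ * (T.transpose * D * T)).trace := by
    have hDi := hD.inv.posSemidef
    have e : (D⁻¹ * (T.transpose * D * T)).trace =
        ((T * msqrt D⁻¹).transpose * D * (T * msqrt D⁻¹)).trace := by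
      conv_lhs => rw [← msqrt_mul_msqrt hDi]
      rw [Matrix.transpose_mul, PosSemidef.transpose_eq (msqrt_posSemidef hDi)]
      rw [mul_assoc (msqrt D⁻¹), Matrix.trace_mul_comm]
      simp only [← mul_assoc]
    rw [e]
    exact (PosSemidef.conj hD.posSemidef _).trace_nonneg
  have h4 : (D⁻¹ * T * D).trace = T.trace := by
    rw [Matrix.trace_mul_comm, ← mul_assoc, PosDef.mul_inv hD, one_mul]
  have h5 := congrArg Matrix.trace (h1.symm.trans h2)
  simp only [Matrix.trace_add, Matrix.trace_smul, smul_eq_mul, h4] at h5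
  linarith

theorem posSemidef_one_sub_inv {G : Matrix ι ι ℝ} (hG : G.PosDef) (h : (G - 1).PosSemidef) :
    (1 - G⁻¹).PosSemidef := by
  obtain ⟨K, hK, hKK⟩ : ∃ K : Matrix ι ι ℝ, K.PosDef ∧ K * K = G :=
    ⟨msqrt G, msqrt_posDef hG, msqrt_mul_msqrt hG.posSemidef⟩
  have h1 := PosSemidef.conj h K⁻¹
  have e : (K⁻¹).transpose * (G - 1) * K⁻¹ = 1 - G⁻¹ := by
    rw [PosDef.transpose_eq hK.inv, ← hKK, Matrix.mul_inv_rev, mul_sub, sub_mul, mul_one,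
      ← mul_assoc, PosDef.inv_mul hK, one_mul, PosDef.mul_inv hK]
  rwa [e] at h1

section PolarFactor

variable {s B : Matrix ι ι ℝ}

/-- The data `Q`, `h`, `K` entering the polar factor of `s h⁻¹`. -/
theorem polar_factor_data (hs : s.PosDef) (hB : B.PosSemidef) :
    ∃ Q h G K : Matrix ι ι ℝ, Q.PosDef ∧ h.PosDef ∧ G.PosDef ∧ K.PosDef ∧
      msqrt (s * (s * s + (2 : ℝ) • B) * s) = Q ∧ Q * Q = s * (s * s + (2 : ℝ) • B) * s ∧
      msqrt Q = h ∧ h * h = Q ∧ G = s⁻¹ * Q * s⁻¹ ∧ K * K = G ∧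
      G * (s * s) * G = s * s + (2 : ℝ) • B := by
  have hst := PosDef.transpose_eq hs
  have hsit := PosDef.transpose_eq hs.inv
  have hD : (s * s).PosDef := by
    have := PosDef.conj (Matrix.PosDef.one (n := ι) (R := ℝ)) hs.isUnit
    rwa [hst, mul_one] at this
  have hB2 : ((2 : ℝ) • B).PosSemidef := hB.smul (by norm_num)
  have hr : (s * s + (2 : ℝ) • B).PosDef := hD.add_posSemidef hB2
  have hQ2 : (s * (s * s + (2 : ℝ) • B) * s).PosDef := by
    have := PosDef.conj hr hs.isUnit
    rwa [hst] at this
  set Q := msqrt (s * (s * s + (2 : ℝ) • B) * s) with hQdef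
  have hQ : Q.PosDef := msqrt_posDef hQ2
  have hQQ : Q * Q = s * (s * s + (2 : ℝ) • B) * s := msqrt_mul_msqrt hQ2.posSemidef
  -- This matrix is the geometric mean of (s²)⁻¹ and s² + 2B, that is, the positive solution G of
  -- the Riccati equation G s² G = s² + 2B.
  have hG : (s⁻¹ * Q * s⁻¹).PosDef := by
    have := PosDef.conj hQ hs.inv.isUnit
    rwa [hsit] at this
  refine ⟨Q, msqrt Q, s⁻¹ * Q * s⁻¹, msqrt (s⁻¹ * Q * s⁻¹), hQ, msqrt_posDef hQ, hG,
    msqrt_posDef hG, rfl, hQQ, rfl, msqrt_mul_msqrt hQ.posSemidef, rfl,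
    msqrt_mul_msqrt hG.posSemidef, ?_⟩
  calc s⁻¹ * Q * s⁻¹ * (s * s) * (s⁻¹ * Q * s⁻¹)
      = s⁻¹ * Q * (s⁻¹ * s) * (s * s⁻¹) * Q * s⁻¹ := by simp only [mul_assoc]
    _ = s⁻¹ * (Q * Q) * s⁻¹ := by
        rw [PosDef.inv_mul hs, PosDef.mul_inv hs]
        simp only [mul_assoc, mul_one]
    _ = (s⁻¹ * s) * (s * s + (2 : ℝ) • B) * (s * s⁻¹) := by
        rw [hQQ]
        simp only [mul_assoc]
    _ = _ := by rw [PosDef.inv_mul hs, PosDef.mul_inv hs, one_mul, mul_one]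

/-- The polar factors of `s h⁻¹` and `r (√(√(r s² r)))⁻¹`, with `r = √(s² + 2B)` and
`h⁴ = s r² s`, are related by the polar factor of `r s`; and the first one is close to the identity
if `B` is small relative to `s²`. -/
theorem polar_factors (hs : s.PosDef) (hB : B.PosSemidef) :
    ∃ O : Matrix ι ι ℝ, O.transpose * O = 1 ∧
      polarO (s * (msqrt (msqrt (s * (s * s + (2 : ℝ) • B) * s)))⁻¹) = O ∧
      polarO (msqrt (s * s + (2 : ℝ) • B) * (msqrt (msqrt (msqrt (s * s + (2 : ℝ) • B) * (s * s) *
        msqrt (s * s + (2 : ℝ) • B))))⁻¹) * polarO (msqrt (s * s + (2 : ℝ) • B) * s) = O ∧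
      FermiPatch.hs (O - 1) ≤ 2 * ((s * s)⁻¹ * B).trace := by
  obtain ⟨Q, h, G, K, hQ, hh, hG, hK, eQ, eQQ, eh, ehh, eG, eKK, eric⟩ := polar_factor_data hs hB
  have hst := PosDef.transpose_eq hs
  have hsit := PosDef.transpose_eq hs.inv
  have hht := PosDef.transpose_eq hh
  have hhit := PosDef.transpose_eq hh.inv
  have hKt := PosDef.transpose_eq hK
  have hKit := PosDef.transpose_eq hK.inv
  have hQt := PosDef.transpose_eq hQ
  have hQit := PosDef.transpose_eq hQ.inv
  have ss := PosDef.mul_inv hs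
  have ss' := PosDef.inv_mul hs
  have kk := PosDef.mul_inv hK
  have kk' := PosDef.inv_mul hK
  have h1 := PosDef.mul_inv hh
  have h1' := PosDef.inv_mul hh
  have q1 := PosDef.mul_inv hQ
  have q1' := PosDef.inv_mul hQ
  have hD : (s * s).PosDef := by
    have := PosDef.conj (Matrix.PosDef.one (n := ι) (R := ℝ)) hs.isUnit
    rwa [hst, mul_one] at this
  have hB2 : ((2 : ℝ) • B).PosSemidef := hB.smul (by norm_num)
  have hr2 : (s * s + (2 : ℝ) • B).PosDef := hD.add_posSemidef hB2
  set r := msqrt (s * s + (2 : ℝ) • B) with hr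
  have hrp : r.PosDef := msqrt_posDef hr2
  have hrr : r * r = s * s + (2 : ℝ) • B := msqrt_mul_msqrt hr2.posSemidef
  have hrt := PosDef.transpose_eq hrp
  rw [eQ, eh]
  have cs : ∀ X, s⁻¹ * (s * X) = X := fun X => by rw [← mul_assoc, ss', one_mul]
  have cs' : ∀ X, s * (s⁻¹ * X) = X := fun X => by rw [← mul_assoc, ss, one_mul]
  have ck : ∀ X, K⁻¹ * (K * X) = X := fun X => by rw [← mul_assoc, kk', one_mul]
  have ck' : ∀ X, K * (K⁻¹ * X) = X := fun X => by rw [← mul_assoc, kk, one_mul]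
  have ch : ∀ X, h⁻¹ * (h * X) = X := fun X => by rw [← mul_assoc, h1', one_mul]
  have ch' : ∀ X, h * (h⁻¹ * X) = X := fun X => by rw [← mul_assoc, h1, one_mul]
  -- the orthogonal factor and its inverse
  set O := K⁻¹ * s⁻¹ * h with hO
  have hOt : O.transpose = h * s⁻¹ * K⁻¹ := by
    rw [hO, Matrix.transpose_mul, Matrix.transpose_mul, hht, hsit, hKit, mul_assoc]
  have hinv : (h * s⁻¹ * K⁻¹) * (K * s * h⁻¹) = 1 := by
    simp only [mul_assoc, ck, cs, h1]
  -- This identity makes K⁻¹s⁻¹h and K s h⁻¹ the same matrix. The transpose of the first is the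
  -- inverse of the second, so O is orthogonal.
  have hGK : K * K = s⁻¹ * h * h * s⁻¹ := by
    rw [eKK, eG, ← ehh]
    simp only [mul_assoc]
  have hO2 : O = K * s * h⁻¹ := by
    have e1 : O * (h * s⁻¹) = K := by
      rw [hO]
      calc K⁻¹ * s⁻¹ * h * (h * s⁻¹) = K⁻¹ * (s⁻¹ * h * h * s⁻¹) := by simp only [mul_assoc]
        _ = K := by rw [← hGK, ck]
    calc O = O * (h * s⁻¹) * (s * h⁻¹) := by simp only [mul_assoc, cs, h1, mul_one]
      _ = _ := by rw [e1, mul_assoc]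
  have hOO : O.transpose * O = 1 := by
    rw [hOt, hO2]
    exact hinv
  have hOO' : O * O.transpose = 1 := mul_eq_one_comm.1 hOO
  have hOu : IsUnit O := IsUnit.of_mul_eq_one _ hOO'
  refine ⟨O, hOO, ?_, ?_, ?_⟩
  · have hp : (O.transpose * K⁻¹ * O).PosDef := PosDef.conj hK.inv hOu
    -- By construction s h⁻¹ = K⁻¹O; conjugation by O moves the positive factor to the right.
    have e : s * h⁻¹ = O * (O.transpose * K⁻¹ * O) := by
      calc s * h⁻¹ = K⁻¹ * (K * s * h⁻¹) := by simp only [mul_assoc, ck]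
        _ = (O * O.transpose) * K⁻¹ * O := by rw [← hO2, hOO', one_mul]
        _ = _ := by simp only [mul_assoc]
    rw [e, polarO_eq hOO hp]
  · -- the polar factor of `r s`
    set A := r * s * Q⁻¹ with hA
    have hAt : A.transpose = Q⁻¹ * s * r := by
      rw [hA, Matrix.transpose_mul, Matrix.transpose_mul, hQit, hst, hrt, mul_assoc]
    have hAA : A.transpose * A = 1 := by
      rw [hAt, hA]
      calc Q⁻¹ * s * r * (r * s * Q⁻¹) = Q⁻¹ * (s * (r * r) * s) * Q⁻¹ := by simp only [mul_assoc]
        _ = Q⁻¹ * Q * (Q * Q⁻¹) := by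
            rw [hrr, ← eQQ]
            simp only [mul_assoc]
        _ = 1 := by rw [q1, q1', one_mul]
    have hAA' : A * A.transpose = 1 := mul_eq_one_comm.1 hAA
    have hAu : IsUnit A.transpose := IsUnit.of_mul_eq_one _ hAA
    have hrs : r * s = A * Q := by rw [hA, mul_assoc, q1', mul_one]
    have e1 : polarO (r * s) = A := by rw [hrs, polarO_eq hAA hQ]
    have hsr : s * r = Q * A.transpose := by
      have := congrArg Matrix.transpose hrs
      rwa [Matrix.transpose_mul, Matrix.transpose_mul, hst, hrt, hQt] at this
    have cA : ∀ X, A.transpose * (A * X) = X := fun X => by rw [← mul_assoc, hAA, one_mul]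
    -- From r s = A Q one gets r s² r = (AQ)(AQ)ᵀ = A Q² Aᵀ, so its square root and fourth root are
    -- Q and h conjugated by A.
    have e2 : msqrt (r * (s * s) * r) = A * Q * A.transpose := by
      refine msqrt_eq ?_ ?_
      · have := PosSemidef.conj hQ.posSemidef A.transpose
        rwa [Matrix.transpose_transpose] at this
      · calc A * Q * A.transpose * (A * Q * A.transpose) = (A * Q) * (Q * A.transpose) := by
              simp only [mul_assoc, cA]
          _ = _ := by
              rw [← hrs, ← hsr]
              simp only [mul_assoc]
    have e3 : msqrt (A * Q * A.transpose) = A * h * A.transpose := by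
      refine msqrt_eq ?_ ?_
      · have := PosSemidef.conj hh.posSemidef A.transpose
        rwa [Matrix.transpose_transpose] at this
      · rw [← ehh]
        simp only [mul_assoc, cA]
    have e4 : (A * h * A.transpose)⁻¹ = A * h⁻¹ * A.transpose := by
      refine Matrix.inv_eq_left_inv ?_
      simp only [mul_assoc, cA, ch, hAA']
    have hp : ((O * A.transpose).transpose * K * (O * A.transpose)).PosDef :=
      PosDef.conj hK (hOu.mul hAu)
    have hOA : (O * A.transpose).transpose * (O * A.transpose) = 1 := by
      rw [Matrix.transpose_mul, Matrix.transpose_transpose]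
      calc A * O.transpose * (O * A.transpose) = A * (O.transpose * O) * A.transpose := by
            simp only [mul_assoc]
        _ = 1 := by rw [hOO, mul_one, hAA']
    have hOA' := mul_eq_one_comm.1 hOA
    -- The left side equals s⁻¹hAᵀ = K(OAᵀ), so its polar factor is OAᵀ, and the additional factor A
    -- restores O.
    have e6 : r * (A * h⁻¹ * A.transpose) =
        (O * A.transpose) * ((O * A.transpose).transpose * K * (O * A.transpose)) := by
      have t1 : r = s⁻¹ * (Q * A.transpose) := by rw [← hsr, cs]
      calc r * (A * h⁻¹ * A.transpose) = s⁻¹ * (Q * h⁻¹) * A.transpose := by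
            rw [t1]
            simp only [mul_assoc, cA]
        _ = s⁻¹ * h * A.transpose := by
            rw [← ehh]
            simp only [mul_assoc, ch']
        _ = K * (O * A.transpose) := by
            rw [hO]
            simp only [mul_assoc, ck']
        _ = (O * A.transpose) * (O * A.transpose).transpose * K * (O * A.transpose) := by
            rw [hOA', one_mul, mul_assoc]
        _ = _ := by simp only [mul_assoc]
    rw [e1, e2, e3, e4, e6, polarO_eq hOA hp, mul_assoc, hAA, mul_one]
  · have hT : (G - 1).PosSemidef := posSemidef_sub_one_of_riccati hG hD hB2 eric
    have htr := trace_sub_one_le_of_riccati hG hD eric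
    have hT1 : FermiPatch.hs (G - 1) ≤ ((s * s)⁻¹ * B).trace := (hs_le_trace hT).trans htr
    have hGi := posSemidef_one_sub_inv hG hT
    have hGinv : G⁻¹ = K⁻¹ * K⁻¹ := by rw [← eKK, Matrix.mul_inv_rev]
    have hGinv2 : G⁻¹ = (s * h⁻¹) * (s * h⁻¹).transpose := by
      rw [Matrix.transpose_mul, hhit, hst, eG, Matrix.mul_inv_rev, Matrix.mul_inv_rev,
        Matrix.nonsing_inv_nonsing_inv s ((Matrix.isUnit_iff_isUnit_det s).1 hs.isUnit), ← ehh,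
        Matrix.mul_inv_rev]
      simp only [mul_assoc]
    -- the distance of `K` to the identity
    have hK1 : FermiPatch.hs (K - 1) ≤ FermiPatch.hs (G - 1) := by
      have := hs_le_hs_add_mul_mul hK.posSemidef (Matrix.PosSemidef.one (n := ι) (R := ℝ)) (K - 1)
      have e : K - 1 + K * (K - 1) * 1 = G - 1 := by
        rw [← eKK]
        noncomm_ring
      rwa [e] at this
    -- the distance of `s⁻¹ h` to the identity
    have hF : FermiPatch.hs (s⁻¹ * (h - s)) ≤ FermiPatch.hs (G - 1) := by
      have h2 := hs_le_hs_add_mul_mul hs.posSemidef hh.inv.posSemidef (s⁻¹ * (h - s))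
      -- Both sides are s⁻¹h - s h⁻¹, because G = s⁻¹h²s⁻¹. The factor s h⁻¹ is a contraction since
      -- (s h⁻¹)(s h⁻¹)ᵀ = G⁻¹ ≤ 1.
      have e : s⁻¹ * (h - s) + s * (s⁻¹ * (h - s)) * h⁻¹ = (G - 1) * (s * h⁻¹) := by
        have t1 : (s⁻¹ * (h - s) + s * (s⁻¹ * (h - s)) * h⁻¹) * h = ((G - 1) * (s * h⁻¹)) * h := by
          rw [cs']
          have l : (s⁻¹ * (h - s) + (h - s) * h⁻¹) * h = s⁻¹ * (h * h) - (s⁻¹ * s) * h +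
              (h - s) * (h⁻¹ * h) := by noncomm_ring
          have r' : ((G - 1) * (s * h⁻¹)) * h = (s⁻¹ * (h * h) * (s⁻¹ * s) - s) * (h⁻¹ * h) := by
            rw [eG, ← ehh]
            noncomm_ring
          rw [l, r', h1', ss', mul_one, mul_one, one_mul, mul_one]
          abel
        have := congrArg (· * h⁻¹) t1
        simp only [mul_assoc, h1, mul_one] at this
        simpa only [mul_assoc] using this
      rw [e] at h2
      refine h2.trans (hs_mul_le_of_contraction ?_ _)
      rwa [← hGinv2]
    -- Oᵀ = h s⁻¹K⁻¹ is compared with K K⁻¹ = 1, which splits the error into the two deviations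
    -- bounded above, times the contraction K⁻¹.
    have e : (O - 1).transpose = ((s⁻¹ * (h - s)).transpose - (K - 1)) * K⁻¹ := by
      rw [Matrix.transpose_sub, Matrix.transpose_one, hOt, Matrix.transpose_mul, hsit,
        Matrix.transpose_sub, hht, hst]
      have : (h - s) * s⁻¹ - (K - 1) = h * s⁻¹ - K := by
        rw [sub_mul, ss]
        abel
      rw [this, sub_mul, kk]
    rw [← hs_transpose, e]
    have h3 : (1 - K⁻¹ * (K⁻¹).transpose).PosSemidef := by rwa [hKit, ← hGinv]
    refine (hs_mul_le_of_contraction h3 _).trans ((hs_sub_le _ _).trans ?_)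
    rw [hs_transpose]
    linarith

end PolarFactor

end Matrices

/-! ### Logarithms of unitary matrices -/

theorem IsLogBranch.re_eq_zero {lg : ℂ → ℂ} (hlg : IsLogBranch lg) {z : ℂ} (hz : ‖z‖ = 1) :
    (lg z).re = 0 := by
  obtain ⟨a, -, -, h⟩ := hlg
  have h1 := congrArg norm (h z hz).1
  rw [Complex.norm_exp, hz] at h1
  exact Real.exp_eq_one_iff _ |>.1 h1

/-- With lg z = it one has |z - 1| = 2|sin(t/2)|, and t/2 ranges over a compact interval inside (-π,
π), where sinc has no zero. The constant is the inverse of the minimum of |sinc| there. -/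
theorem IsLogBranch.exists_norm_le {lg : ℂ → ℂ} (hlg : IsLogBranch lg) :
    ∃ C : ℝ, 0 < C ∧ ∀ z : ℂ, ‖z‖ = 1 → ‖lg z‖ ≤ C * ‖z - 1‖ := by
  have hre := fun z hz => hlg.re_eq_zero (z := z) hz
  obtain ⟨a, ha0, ha1, h⟩ := hlg
  have hne : (Set.Icc (a / 2 - Real.pi) (a / 2)).Nonempty :=
    Set.nonempty_Icc.2 (by linarith [Real.pi_pos])
  obtain ⟨u, hu, hmin⟩ := isCompact_Icc.exists_isMinOn hne
    (Real.continuous_sinc.abs.continuousOn (s := Set.Icc (a / 2 - Real.pi) (a / 2)))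
  have hsin : ∀ v ∈ Set.Icc (a / 2 - Real.pi) (a / 2), v ≠ 0 → Real.sin v ≠ 0 := by
    intro v hv hv0
    refine Real.sin_ne_zero_iff.2 fun n hn => ?_
    have h1 : (-1 : ℝ) < n := by
      by_contra hc
      have := Real.pi_pos
      nlinarith [hv.1, not_lt.1 hc]
    have h2 : (n : ℝ) < 1 := by
      by_contra hc
      have := Real.pi_pos
      nlinarith [hv.2, not_lt.1 hc]
    have h3 : n = 0 := by
      have h1' : (-1 : ℤ) < n := by exact_mod_cast h1
      have h2' : n < (1 : ℤ) := by exact_mod_cast h2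
      omega
    rw [h3] at hn
    simp at hn
    exact hv0 hn.symm
  have hpos : 0 < |Real.sinc u| := by
    rw [abs_pos]
    by_cases h0 : u = 0
    · simp [h0]
    · rw [Real.sinc_of_ne_zero h0]
      exact div_ne_zero (hsin u hu h0) h0
  refine ⟨|Real.sinc u|⁻¹, inv_pos.2 hpos, fun z hz => ?_⟩
  obtain ⟨h1, h2, h3⟩ := h z hz
  set t := (lg z).im with ht
  have hl : lg z = Complex.I * (t : ℂ) := by
    apply Complex.ext
    · simp [hre z hz]
    · simp [ht]
  have hv : t / 2 ∈ Set.Icc (a / 2 - Real.pi) (a / 2) := ⟨by linarith, by linarith⟩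
  have h4 : |Real.sinc u| ≤ |Real.sinc (t / 2)| := hmin hv
  have h5 : |t / 2| * |Real.sinc (t / 2)| = |Real.sin (t / 2)| := by
    by_cases h0 : t / 2 = 0
    · simp [h0]
    · rw [Real.sinc_of_ne_zero h0, ← abs_mul, mul_div_cancel₀ _ h0]
  have h7 : ‖z - 1‖ = 2 * |Real.sin (t / 2)| := by
    rw [← h1, hl, Complex.norm_exp_I_mul_ofReal_sub_one, Real.norm_eq_abs, abs_mul, abs_two]
  rw [h7, hl, norm_mul, Complex.norm_I, one_mul, Complex.norm_real, Real.norm_eq_abs,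
    inv_mul_eq_div, le_div_iff₀ hpos, ← h5]
  have h6 : |t| = 2 * |t / 2| := by
    rw [abs_div, abs_two]
    ring
  rw [h6, mul_assoc]
  have := mul_le_mul_of_nonneg_left h4 (abs_nonneg (t / 2))
  linarith

section Complex

variable {n : Type} [Fintype n] [DecidableEq n]

theorem hs_mul_le (A B : Matrix n n ℂ) : hs (A * B) ≤ ‖A‖ * hs B := by
  refine (sq_le_sq₀ (hs_nonneg _) (mul_nonneg (norm_nonneg _) (hs_nonneg _))).1 ?_
  rw [mul_pow, hs_sq, hs_sq, Finset.sum_comm, Finset.sum_comm (f := fun i j => ‖B i j‖ ^ 2),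
    Finset.mul_sum]
  refine Finset.sum_le_sum fun j _ => ?_
  have h := A.l2_opNorm_mulVec (WithLp.toLp 2 (fun i => B i j))
  have h2 := pow_le_pow_left₀ (norm_nonneg _) h 2
  rw [mul_pow, EuclideanSpace.norm_sq_eq, EuclideanSpace.norm_sq_eq] at h2
  exact h2

theorem unitary_spectrum_norm {U : Matrix n n ℂ} (hU : U ∈ unitary (Matrix n n ℂ)) {z : ℂ}
    (hz : z ∈ spectrum ℂ U) : ‖z‖ = 1 := by
  have := spectrum.subset_circle_of_unitary hU hz
  simpa using this

theorem star_cfc_log {lg : ℂ → ℂ} (hlg : IsLogBranch lg) {U : Matrix n n ℂ}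
    (hU : U ∈ unitary (Matrix n n ℂ)) : star (cfc lg U) = - cfc lg U := by
  rw [← cfc_star, ← cfc_neg]
  refine cfc_congr fun z hz => ?_
  have h := hlg.re_eq_zero (unitary_spectrum_norm hU hz)
  apply Complex.ext <;> simp [h]

/-- Factor log U = g(U)(U - 1) with g(z) = lg z/(z - 1). The bound on `lg` gives ‖g(U)‖ ≤ C, and the
Hilbert–Schmidt norm is an ideal norm. -/
theorem hs_cfc_log_le {lg : ℂ → ℂ} {C : ℝ} (hC0 : 0 ≤ C)
    (hC : ∀ z : ℂ, ‖z‖ = 1 → ‖lg z‖ ≤ C * ‖z - 1‖) {U : Matrix n n ℂ}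
    (hU : U ∈ unitary (Matrix n n ℂ)) : hs (cfc lg U) ≤ C * hs (U - 1) := by
  have hn : IsStarNormal U := ⟨by
    rw [commute_iff_eq, (Unitary.mem_iff.1 hU).1, (Unitary.mem_iff.1 hU).2]⟩
  -- The spectrum is finite, so the functional calculus needs no continuity of the branch, even if
  -- an eigenvalue lies on the cut.
  have hcont : ∀ f : ℂ → ℂ, ContinuousOn f (spectrum ℂ U) := fun f =>
    (Matrix.finite_spectrum U).continuousOn f
  -- At z = 1 the quotient has the default value 0, which is consistent because `hC` forces lg 1 =
  -- 0.
  have hz1 : ∀ z : ℂ, ‖z‖ = 1 → lg z = (lg z / (z - 1)) * (z - 1) := by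
    intro z hz
    by_cases h1 : z - 1 = 0
    · have := hC z hz
      rw [h1, norm_zero, mul_zero, norm_le_zero_iff] at this
      rw [this, h1, mul_zero]
    · rw [div_mul_cancel₀ _ h1]
  have h1 : cfc lg U = cfc (fun z => lg z / (z - 1)) U * (U - 1) := by
    have e : U - 1 = cfc (fun z : ℂ => z - 1) U := by
      rw [cfc_sub (R := ℂ) (fun z => z) (fun _ => 1) U, cfc_id' ℂ U, cfc_const_one ℂ U]
    conv_rhs => rw [e]
    rw [← cfc_mul _ _ U (hcont _) (hcont _)]
    exact cfc_congr fun z hz => hz1 z (unitary_spectrum_norm hU hz)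
  rw [h1]
  refine (hs_mul_le _ _).trans (mul_le_mul_of_nonneg_right ?_ (hs_nonneg _))
  refine norm_cfc_le hC0 fun z hz => ?_
  have h2 := hC z (unitary_spectrum_norm hU hz)
  rw [norm_div]
  exact div_le_of_le_mul₀ (norm_nonneg _) hC0 h2

end Complex

/-! ### Rotation of block-diagonal matrices -/

section Blocks

set_option linter.unusedSectionVars false

variable {ι : Type} [Fintype ι] [DecidableEq ι]

/-- The matrix `U diag(x, y) Uᵀ` with `U = 2^{-1/2} [[1, 1], [1, -1]]`. -/
def rot (x y : Matrix ι ι ℝ) : Matrix (ι ⊕ ι) (ι ⊕ ι) ℝ :=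
  Matrix.fromBlocks ((2 : ℝ)⁻¹ • (x + y)) ((2 : ℝ)⁻¹ • (x - y)) ((2 : ℝ)⁻¹ • (x - y))
    ((2 : ℝ)⁻¹ • (x + y))

theorem rot_mul_rot (x y z w : Matrix ι ι ℝ) : rot x y * rot z w = rot (x * z) (y * w) := by
  rw [rot, rot, rot, Matrix.fromBlocks_multiply]
  have h2 : (2 : ℝ)⁻¹ * 2⁻¹ = 2⁻¹ * 2⁻¹ := rfl
  congr 1 <;>
  · simp only [smul_mul_smul_comm, ← smul_add]
    rw [mul_smul]
    congr 1
    rw [inv_smul_eq_iff₀ two_ne_zero, two_smul]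
    noncomm_ring

theorem rot_one : rot (1 : Matrix ι ι ℝ) 1 = 1 := by
  rw [rot, ← two_smul ℝ (1 : Matrix ι ι ℝ), smul_smul, sub_self, smul_zero,
    inv_mul_cancel₀ two_ne_zero, one_smul, Matrix.fromBlocks_one]

theorem rot_self (x : Matrix ι ι ℝ) : rot x x = Matrix.fromBlocks x 0 0 x := by
  rw [rot, ← two_smul ℝ x, smul_smul, sub_self, smul_zero, inv_mul_cancel₀ two_ne_zero, one_smul]

theorem rot_transpose (x y : Matrix ι ι ℝ) :
    (rot x y).transpose = rot x.transpose y.transpose := by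
  simp [rot, Matrix.fromBlocks_transpose]

theorem rot_posSemidef {x y : Matrix ι ι ℝ} (hx : x.PosSemidef) (hy : y.PosSemidef) :
    (rot x y).PosSemidef := by
  have h := Matrix.posSemidef_conjTranspose_mul_self (rot (msqrt x) (msqrt y))
  rwa [Matrix.conjTranspose_eq_transpose_of_trivial, rot_transpose,
    PosSemidef.transpose_eq (msqrt_posSemidef hx), PosSemidef.transpose_eq (msqrt_posSemidef hy),
    rot_mul_rot, msqrt_mul_msqrt hx, msqrt_mul_msqrt hy] at h

theorem msqrt_rot {x y : Matrix ι ι ℝ} (hx : x.PosSemidef) (hy : y.PosSemidef) :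
    msqrt (rot x y) = rot (msqrt x) (msqrt y) := by
  refine msqrt_eq (rot_posSemidef (msqrt_posSemidef hx) (msqrt_posSemidef hy)) ?_
  rw [rot_mul_rot, msqrt_mul_msqrt hx, msqrt_mul_msqrt hy]

theorem inv_rot {x y : Matrix ι ι ℝ} (hx : x.PosDef) (hy : y.PosDef) :
    (rot x y)⁻¹ = rot x⁻¹ y⁻¹ := by
  refine Matrix.inv_eq_left_inv ?_
  rw [rot_mul_rot, PosDef.inv_mul hx, PosDef.inv_mul hy, rot_one]

theorem polarO_rot {x y : Matrix ι ι ℝ} (hx : IsUnit x) (hy : IsUnit y) :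
    polarO (rot x y) = rot (polarO x) (polarO y) := by
  have h1 : (x.transpose * x).PosDef := by
    have := PosDef.conj (Matrix.PosDef.one (n := ι) (R := ℝ)) hx
    rwa [mul_one] at this
  have h2 : (y.transpose * y).PosDef := by
    have := PosDef.conj (Matrix.PosDef.one (n := ι) (R := ℝ)) hy
    rwa [mul_one] at this
  rw [polarO, polarO, polarO, rot_transpose, rot_mul_rot, msqrt_rot h1.posSemidef h2.posSemidef,
    inv_rot (msqrt_posDef h1) (msqrt_posDef h2), rot_mul_rot]

end Blocks

/-! ### The kernel `L(k)` -/

theorem vec_neg (p : Mom) : vec (-p) = -vec p := by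
  ext i
  simp [vec]

theorem vec_add (p q : Mom) : vec (p + q) = vec p + vec q := by
  ext i
  simp [vec]

theorem vec_sub (p q : Mom) : vec (p - q) = vec p - vec q := by
  ext i
  simp [vec]

theorem vec_zsmul (j : ℤ) (p : Mom) : vec (j • p) = (j : ℝ) • vec p := by
  ext i
  simp [vec]

theorem vec_injective : Function.Injective vec := fun p q h => by
  funext i
  have := congrArg (fun x : E3 => x i) h
  simpa [vec] using this

theorem vec_zero : vec 0 = 0 := by
  ext i
  simp [vec]

theorem norm_vec_pos {k : Mom} (hk : k ≠ 0) : 0 < ‖vec k‖ :=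
  norm_pos_iff.2 fun h => hk (vec_injective (h.trans vec_zero.symm))

theorem numN_pos {kF : ℝ} (h : 0 < kF) : 0 < numN kF :=
  Finset.card_pos.2 ⟨0, mem_latticeBall.2 (by rw [vec_zero, norm_zero]; exact h.le)⟩

theorem numN_rpow_pos {kF : ℝ} (h : 0 < kF) (x : ℝ) : 0 < (numN kF : ℝ) ^ x :=
  Real.rpow_pos_of_pos (by exact_mod_cast numN_pos h) x

namespace PatchDecomposition

variable {kF R c₀ : ℝ} {M : ℕ} (P : PatchDecomposition kF R c₀ M)

theorem kdot_mirror (k : Mom) (α : Fin M) : P.kdot k (P.mirror α) = - P.kdot k α := by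
  rw [kdot, kdot, P.center_mirror, inner_neg_right]

theorem kdot_neg (k : Mom) (α : Fin M) : P.kdot (-k) α = - P.kdot k α := by
  rw [kdot, kdot, vec_neg, inner_neg_left]

theorem mem_Iplus {δ : ℝ} {k : Mom} {α : Fin M} :
    α ∈ P.Iplus δ k ↔ (numN kF : ℝ) ^ (-δ) ≤ P.kdot k α := by
  simp [Iplus]

theorem mem_Iminus {δ : ℝ} {k : Mom} {α : Fin M} :
    α ∈ P.Iminus δ k ↔ P.kdot k α ≤ -(numN kF : ℝ) ^ (-δ) := by
  simp [Iminus]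

theorem mirror_mem_Iminus {δ : ℝ} {k : Mom} {α : Fin M} (h : α ∈ P.Iplus δ k) :
    P.mirror α ∈ P.Iminus δ k := by
  rw [mem_Iminus, kdot_mirror, neg_le_neg_iff]
  exact P.mem_Iplus.1 h

theorem notMem_Iplus_of_mem_Iminus (hkF : 0 < kF) {δ : ℝ} {k : Mom} {α : Fin M}
    (h : α ∈ P.Iminus δ k) : α ∉ P.Iplus δ k := fun h' => by
  have h1 := P.mem_Iplus.1 h'
  have h2 := P.mem_Iminus.1 h
  have h3 := numN_rpow_pos hkF (-δ)
  linarith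

theorem inPatch_mirror (α : Fin M) (p : Mom) : P.InPatch (P.mirror α) (-p) ↔ P.InPatch α p := by
  simp only [InPatch, thicken, Set.mem_ofPred_eq, vec_neg, norm_neg, P.patch_mirror, smul_neg,
    neg_neg]

theorem mem_pairs {α : Fin M} {k p : Mom} : p ∈ P.pairs α k ↔
    (kF < ‖vec p‖ ∧ P.InPatch α p) ∧ (‖vec (p - k)‖ ≤ kF ∧ P.InPatch α (p - k)) := by
  classical
  rw [pairs, Finset.mem_filter, and_iff_right_iff_imp]
  rintro ⟨⟨-, h⟩, -⟩
  exact mem_latticeBall.2 h.2.1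

theorem nrm_mirror (α : Fin M) (k : Mom) : P.nrm (P.mirror α) (-k) = P.nrm α k := by
  rw [nrm, nrm]
  congr 2
  refine Finset.card_bij (fun p _ => -p) ?_ ?_ ?_
  · intro p hp
    rw [mem_pairs] at hp ⊢
    have e : -p - k = -(p - -k) := by abel
    rw [e, vec_neg, vec_neg, norm_neg, norm_neg, ← P.inPatch_mirror, neg_neg,
      ← P.inPatch_mirror _ (-(p - -k)), neg_neg]
    exact hp
  · intro p _ q _ h
    exact neg_injective h
  · intro p hp
    refine ⟨-p, ?_, neg_neg p⟩
    rw [mem_pairs] at hp ⊢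
    have e : -p - -k = -(p - k) := by abel
    rw [e, vec_neg, vec_neg, norm_neg, norm_neg, P.inPatch_mirror, P.inPatch_mirror]
    exact hp

theorem cnrm_coe {δ : ℝ} {k : Mom} (α : {α // α ∈ P.Iplus δ k}) : P.cnrm δ α.1 k = P.nrm α.1 k :=
  if_pos α.2

theorem cnrm_lab (hkF : 0 < kF) {δ : ℝ} {k : Mom} (α : {α // α ∈ P.Iplus δ k}) :
    P.cnrm δ (P.lab (Sum.inl α)) k = P.nrm α.1 k ∧ P.cnrm δ (P.lab (Sum.inr α)) k = P.nrm α.1 k := by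
  have h := P.mirror_mem_Iminus α.2
  constructor
  · exact if_pos α.2
  · change P.cnrm δ (P.mirror α.1) k = _
    rw [cnrm, if_neg (P.notMem_Iplus_of_mem_Iminus hkF h), if_pos h, nrm_mirror]

theorem khat_pos (hkF : 0 < kF) {δ : ℝ} {k : Mom} (hk : k ≠ 0) {α : Fin M} (h : α ∈ P.Iplus δ k) :
    0 < P.khat k α := by
  have h1 := P.mem_Iplus.1 h
  have h3 := numN_rpow_pos hkF (-δ)
  exact div_pos (abs_pos.2 (by linarith)) (norm_vec_pos hk)

theorem khat_mirror (k : Mom) (α : Fin M) : P.khat k (P.mirror α) = P.khat k α := by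
  rw [khat, khat, kdot_mirror, abs_neg]

theorem matD_eq (δ : ℝ) (k : Mom) : P.matD δ k = Matrix.fromBlocks (P.matd δ k) 0 0 (P.matd δ k) := by
  rw [matD, matd, Matrix.fromBlocks_diagonal]
  congr 1
  funext s
  rcases s with α | α
  · rfl
  · exact P.khat_mirror k α.1

theorem matW_eq (hkF : 0 < kF) (Vhat : Mom → ℝ) (δ : ℝ) (k : Mom) :
    P.matW Vhat δ k = Matrix.fromBlocks (P.matb Vhat δ k) 0 0 (P.matb Vhat δ k) := by
  ext s t
  rcases s with α | α <;> rcases t with β | β <;>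
    simp [matW, matb, (P.cnrm_lab hkF _).1, (P.cnrm_lab hkF _).2, cnrm_coe]

theorem matWt_eq (hkF : 0 < kF) (Vhat : Mom → ℝ) (δ : ℝ) (k : Mom) :
    P.matWt Vhat δ k = Matrix.fromBlocks 0 (P.matb Vhat δ k) (P.matb Vhat δ k) 0 := by
  ext s t
  rcases s with α | α <;> rcases t with β | β <;>
    simp [matWt, matb, (P.cnrm_lab hkF _).1, (P.cnrm_lab hkF _).2, cnrm_coe]

theorem rot_eq_matU (δ : ℝ) (k : Mom)
    (x y : Matrix {α // α ∈ P.Iplus δ k} {α // α ∈ P.Iplus δ k} ℝ) :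
    P.matU δ k * Matrix.fromBlocks x 0 0 y * (P.matU δ k).transpose = rot x y := by
  have h2 : (√2 : ℝ)⁻¹ * (√2)⁻¹ = 2⁻¹ := by
    rw [← mul_inv, Real.mul_self_sqrt zero_le_two]
  rw [matU, Matrix.transpose_smul, Matrix.fromBlocks_transpose, smul_mul_assoc, mul_smul_comm,
    smul_mul_assoc, smul_smul, h2, Matrix.fromBlocks_multiply, Matrix.fromBlocks_multiply,
    Matrix.fromBlocks_smul, rot]
  simp [sub_eq_add_neg]

theorem wpre_nonneg (hkF : 0 < kF) {Vhat : Mom → ℝ} {k : Mom} (hV : 0 ≤ Vhat k) :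
    0 ≤ P.wpre Vhat k := by
  have h : 0 ≤ hbar kF := (numN_rpow_pos hkF _).le
  refine div_nonneg hV ?_
  rw [kappa]
  positivity

theorem matd_posDef (hkF : 0 < kF) (δ : ℝ) {k : Mom} (hk : k ≠ 0) : (P.matd δ k).PosDef :=
  Matrix.PosDef.diagonal fun α => P.khat_pos hkF hk α.2

theorem matb_posSemidef (hkF : 0 < kF) {Vhat : Mom → ℝ} (δ : ℝ) {k : Mom} (hV : 0 ≤ Vhat k) :
    (P.matb Vhat δ k).PosSemidef := by
  have h := (Matrix.posSemidef_vecMulVec_self_star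
    (fun α : {α // α ∈ P.Iplus δ k} => P.cnrm δ α.1 k)).smul (P.wpre_nonneg hkF hV)
  convert h using 1
  ext α β
  simp [matb, Matrix.vecMulVec_apply, mul_assoc]

theorem trace_matd_inv_mul_matb (hkF : 0 < kF) (Vhat : Mom → ℝ) (δ : ℝ) {k : Mom} (hk : k ≠ 0) :
    ((P.matd δ k)⁻¹ * P.matb Vhat δ k).trace =
      P.wpre Vhat k * ∑ α ∈ P.Iplus δ k, P.nrm α k ^ 2 / P.khat k α := by
  have h1 : (P.matd δ k)⁻¹ = Matrix.diagonal (fun α => (P.khat k α.1)⁻¹) := by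
    refine Matrix.inv_eq_left_inv ?_
    rw [matd, Matrix.diagonal_mul_diagonal, ← Matrix.diagonal_one]
    congr 1
    funext α
    exact inv_mul_cancel₀ (P.khat_pos hkF hk α.2).ne'
  rw [h1, Matrix.trace, Finset.mul_sum, ← Finset.sum_coe_sort (P.Iplus δ k)]
  refine Finset.sum_congr rfl fun α _ => ?_
  rw [Matrix.diag_apply, Matrix.diagonal_mul, matb, Matrix.of_apply]
  have : P.cnrm δ α.1 k = P.nrm α.1 k := if_pos α.2
  rw [this, div_eq_inv_mul]
  ring

theorem hs_fromBlocks_self {ι : Type} [Fintype ι] [DecidableEq ι] (x : Matrix ι ι ℝ) :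
    hs (Matrix.fromBlocks x 0 0 x) ≤ 2 * hs x := by
  refine (sq_le_sq₀ (hs_nonneg _) (mul_nonneg zero_le_two (hs_nonneg _))).1 ?_
  rw [mul_pow, hs_sq, hs_sq]
  simp only [Fintype.sum_sum_type, Matrix.fromBlocks_apply₁₁, Matrix.fromBlocks_apply₁₂,
    Matrix.fromBlocks_apply₂₁, Matrix.fromBlocks_apply₂₂, Matrix.zero_apply, norm_zero]
  have : 0 ≤ ∑ i, ∑ j, ‖x i j‖ ^ 2 := Finset.sum_nonneg fun _ _ => Finset.sum_nonneg fun _ _ => sq_nonneg _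
  simp
  simp only [Real.norm_eq_abs, sq_abs] at this
  linarith

/-- `O(k) Õ(k)` is block diagonal, orthogonal, and close to the identity. -/
theorem matO_mul_matOt (hkF : 0 < kF) {Vhat : Mom → ℝ} (δ : ℝ) {k : Mom} (hk : k ≠ 0)
    (hV : 0 ≤ Vhat k) : ∃ O : Matrix {α // α ∈ P.Iplus δ k} {α // α ∈ P.Iplus δ k} ℝ,
      O.transpose * O = 1 ∧
      P.matO Vhat δ k * P.matOt Vhat δ k = Matrix.fromBlocks O 0 0 O ∧
      hs (O - 1) ≤ 2 * (P.wpre Vhat k * ∑ α ∈ P.Iplus δ k, P.nrm α k ^ 2 / P.khat k α) := by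
  have hd := P.matd_posDef hkF δ hk
  have hb := P.matb_posSemidef hkF δ hV
  have htr := P.trace_matd_inv_mul_matb hkF Vhat δ hk
  -- U decouples symmetric and antisymmetric combinations of antipodal patches: W and W̃ cancel in
  -- one sector and add up to 2b in the other. Changing the sign of W̃ exchanges the sectors.
  have e1 : P.matD δ k + P.matW Vhat δ k - P.matWt Vhat δ k =
      rot (P.matd δ k) (P.matd δ k + (2 : ℝ) • P.matb Vhat δ k) := by
    rw [P.matD_eq, P.matW_eq hkF, P.matWt_eq hkF, rot, Matrix.fromBlocks_add, sub_eq_add_neg,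
      Matrix.fromBlocks_neg, Matrix.fromBlocks_add]
    congr 1 <;> module
  have e2 : P.matD δ k + P.matW Vhat δ k + P.matWt Vhat δ k =
      rot (P.matd δ k + (2 : ℝ) • P.matb Vhat δ k) (P.matd δ k) := by
    rw [P.matD_eq, P.matW_eq hkF, P.matWt_eq hkF, rot, Matrix.fromBlocks_add, Matrix.fromBlocks_add]
    congr 1 <;> module
  rw [matO, matE, e1, e2, matOt, rot_eq_matU, matA]
  clear e1 e2
  rw [← htr]
  clear htr
  generalize P.matd δ k = d at *
  generalize P.matb Vhat δ k = b at *
  have hs := msqrt_posDef hd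
  obtain ⟨s, rfl, hs'⟩ : ∃ s, s * s = d ∧ s = msqrt d := ⟨_, msqrt_mul_msqrt hd.posSemidef, rfl⟩
  rw [← hs'] at hs ⊢
  have hb2 : ((2 : ℝ) • b).PosSemidef := hb.smul (by norm_num)
  have hr2 : (s * s + (2 : ℝ) • b).PosDef := hd.add_posSemidef hb2
  obtain ⟨O, hO, h1, h2, h3⟩ := polar_factors hs hb
  refine ⟨O, hO, ?_, h3⟩
  have hrp := msqrt_posDef hr2
  have p1 : (s * (s * s + (2 : ℝ) • b) * s).PosDef := by
    have := PosDef.conj hr2 hs.isUnit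
    rwa [PosDef.transpose_eq hs] at this
  have p2 : (msqrt (s * s + (2 : ℝ) • b) * (s * s) * msqrt (s * s + (2 : ℝ) • b)).PosDef := by
    have := PosDef.conj hd hrp.isUnit
    rwa [PosDef.transpose_eq hrp] at this
  have q1 := msqrt_posDef p1
  have q2 := msqrt_posDef p2
  -- The two sectors of O(k) carry different polar factors. The block A of Õ(k) corrects the second
  -- one so that both become O, and equal sectors mean that the rotation by U disappears.
  rw [msqrt_rot hd.posSemidef hr2.posSemidef, ← hs', rot_mul_rot, rot_mul_rot,
    msqrt_rot p1.posSemidef p2.posSemidef, msqrt_rot q1.posSemidef q2.posSemidef,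
    inv_rot (msqrt_posDef q1) (msqrt_posDef q2), rot_mul_rot,
    polarO_rot (hs.isUnit.mul (msqrt_posDef q1).inv.isUnit)
      (hrp.isUnit.mul (msqrt_posDef q2).inv.isUnit), rot_mul_rot, mul_one, h1, h2, rot_self]

theorem matL_unitary (hkF : 0 < kF) {Vhat : Mom → ℝ} (δ : ℝ) {k : Mom} (hk : k ≠ 0)
    (hV : 0 ≤ Vhat k) :
    (P.matO Vhat δ k * P.matOt Vhat δ k).map (fun x : ℝ => (x : ℂ)) ∈
      unitary (Matrix (P.Idx δ k) (P.Idx δ k) ℂ) := by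
  obtain ⟨O, hO, e, -⟩ := P.matO_mul_matOt hkF δ hk hV
  rw [e]
  have h1 : (Matrix.fromBlocks O 0 0 O).transpose * Matrix.fromBlocks O 0 0 O = 1 := by
    rw [Matrix.fromBlocks_transpose, Matrix.fromBlocks_multiply]
    simp [hO]
  set X := Matrix.fromBlocks O 0 0 O with hX
  have hst : star (X.map (fun x : ℝ => (x : ℂ))) = X.transpose.map (fun x : ℝ => (x : ℂ)) := by
    ext i j
    simp [Matrix.star_apply]
  have hmul : ∀ Y Z : Matrix (P.Idx δ k) (P.Idx δ k) ℝ, Y.map (fun x : ℝ => (x : ℂ)) *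
      Z.map (fun x : ℝ => (x : ℂ)) = (Y * Z).map (fun x : ℝ => (x : ℂ)) := fun Y Z =>
    (Matrix.map_mul (f := Complex.ofRealHom)).symm
  have h2 : star (X.map (fun x : ℝ => (x : ℂ))) * X.map (fun x : ℝ => (x : ℂ)) = 1 := by
    rw [hst, hmul, h1]
    exact Matrix.map_one _ Complex.ofReal_zero Complex.ofReal_one
  exact Unitary.mem_iff.2 ⟨h2, mul_eq_one_comm.1 h2⟩

theorem star_matL (hkF : 0 < kF) {lg : ℂ → ℂ} (hlg : IsLogBranch lg) {Vhat : Mom → ℝ} (δ : ℝ)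
    {k : Mom} (hk : k ≠ 0) (hV : 0 ≤ Vhat k) (s t : P.Idx δ k) :
    (starRingEnd ℂ) (P.matL lg Vhat δ k s t) = - P.matL lg Vhat δ k t s := by
  have h := star_cfc_log hlg (P.matL_unitary hkF δ hk hV)
  have h2 := congrFun (congrFun h t) s
  rw [Matrix.star_apply] at h2
  exact h2

/-- The Lipschitz bound for the logarithm is applied to O ⊕ O. The 4 is the 2 of the polar factor
bound times a crude 2 for the two equal blocks. -/
theorem hs_matL_le (hkF : 0 < kF) {lg : ℂ → ℂ} {C : ℝ} (hC0 : 0 ≤ C)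
    (hC : ∀ z : ℂ, ‖z‖ = 1 → ‖lg z‖ ≤ C * ‖z - 1‖) {Vhat : Mom → ℝ} (δ : ℝ)
    {k : Mom} (hk : k ≠ 0) (hV : 0 ≤ Vhat k) :
    hs (P.matL lg Vhat δ k) ≤
      C * (4 * (P.wpre Vhat k * ∑ α ∈ P.Iplus δ k, P.nrm α k ^ 2 / P.khat k α)) := by
  refine (hs_cfc_log_le hC0 hC (P.matL_unitary hkF δ hk hV)).trans ?_
  refine mul_le_mul_of_nonneg_left ?_ hC0
  obtain ⟨O, -, e, h3⟩ := P.matO_mul_matOt hkF δ hk hV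
  rw [e]
  have h4 : hs ((Matrix.fromBlocks O 0 0 O).map (fun x : ℝ => (x : ℂ)) - 1) =
      hs (Matrix.fromBlocks (O - 1) 0 0 (O - 1)) := by
    refine (sq_eq_sq₀ (hs_nonneg _) (hs_nonneg _)).1 ?_
    rw [hs_sq, hs_sq]
    have e5 : (Matrix.fromBlocks O 0 0 O).map (fun x : ℝ => (x : ℂ)) - 1 =
        (Matrix.fromBlocks (O - 1) 0 0 (O - 1)).map (fun x : ℝ => (x : ℂ)) := by
      have e6 : Matrix.fromBlocks (O - 1) 0 0 (O - 1) = Matrix.fromBlocks O 0 0 O - 1 := by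
        rw [← Matrix.fromBlocks_one, sub_eq_add_neg (Matrix.fromBlocks O 0 0 O),
          Matrix.fromBlocks_neg, Matrix.fromBlocks_add]
        simp [sub_eq_add_neg]
      rw [e6]
      have := Matrix.map_one (n := P.Idx δ k) (fun x : ℝ => (x : ℂ)) Complex.ofReal_zero Complex.ofReal_one
      rw [← this]
      ext i j
      by_cases h : i = j <;> simp [h]
    rw [e5]
    simp
  rw [h4]
  refine (hs_fromBlocks_self _).trans ?_
  linarith

end PatchDecomposition

/-! ### Geometry of the lattice -/

theorem exists_unit_orthogonal (a b : E3) : ∃ u : E3, ‖u‖ = 1 ∧ inner ℝ u a = 0 ∧ inner ℝ u b = 0 := by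
  have h1 : Module.finrank ℝ (Submodule.span ℝ ({a, b} : Set E3)) ≤ 2 := by
    have := finrank_span_finset_le_card (R := ℝ) ({a, b} : Finset E3)
    have h2 := Finset.card_le_two (a := a) (b := b)
    simp only [Finset.coe_insert, Finset.coe_singleton] at this
    exact this.trans h2
  have h2 := (Submodule.span ℝ ({a, b} : Set E3)).finrank_add_finrank_orthogonal
  rw [finrank_euclideanSpace_fin] at h2
  have h3 : (Submodule.span ℝ ({a, b} : Set E3))ᗮ ≠ ⊥ := fun h => by
    rw [h, finrank_bot] at h2
    omega
  obtain ⟨x, hx, hx0⟩ := Submodule.exists_mem_ne_zero_of_ne_bot h3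
  have hxa : inner ℝ x a = 0 :=
    Submodule.inner_left_of_mem_orthogonal (Submodule.subset_span (by simp)) hx
  have hxb : inner ℝ x b = 0 :=
    Submodule.inner_left_of_mem_orthogonal (Submodule.subset_span (by simp)) hx
  refine ⟨‖x‖⁻¹ • x, norm_smul_inv_norm hx0, ?_, ?_⟩
  · rw [real_inner_smul_left, hxa, mul_zero]
  · rw [real_inner_smul_left, hxb, mul_zero]

/-- Orthonormal frames adapted to a direction `a` and a plane spanned by `a` and `w`. -/
theorem exists_frame {a : E3} (ha : a ≠ 0) (w : E3) : ∃ u v : E3, ‖u‖ = 1 ∧ ‖v‖ = 1 ∧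
    inner ℝ u a = 0 ∧ inner ℝ v a = 0 ∧ inner ℝ u v = 0 ∧ inner ℝ u w = 0 ∧
    ∀ x y : E3, inner ℝ x y = (inner ℝ a x / ‖a‖) * (inner ℝ a y / ‖a‖) +
      inner ℝ u x * inner ℝ u y + inner ℝ v x * inner ℝ v y := by
  obtain ⟨u, hu, hua, huw⟩ := exists_unit_orthogonal a w
  obtain ⟨v, hv, hva, hvu⟩ := exists_unit_orthogonal a u
  have huv : inner ℝ u v = 0 := by rw [real_inner_comm]; exact hvu
  refine ⟨u, v, hu, hv, hua, hva, huv, huw, ?_⟩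
  have hau : inner ℝ a u = 0 := by rw [real_inner_comm]; exact hua
  have hav : inner ℝ a v = 0 := by rw [real_inner_comm]; exact hva
  set e : Fin 3 → E3 := ![‖a‖⁻¹ • a, u, v] with he
  have hon : Orthonormal ℝ e := by
    have hn : ‖‖a‖⁻¹ • a‖ = 1 := norm_smul_inv_norm ha
    refine ⟨fun i => ?_, fun i j hij => ?_⟩
    · fin_cases i
      · exact hn
      · exact hu
      · exact hv
    · fin_cases i <;> fin_cases j <;> first
      | exact absurd rfl hij
      | simp [he, real_inner_smul_left, real_inner_smul_right, hua, hva, hau, hav, huv, hvu]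
  have hcard : Fintype.card (Fin 3) = Module.finrank ℝ E3 := by simp
  let b := (basisOfOrthonormalOfCardEqFinrank hon hcard).toOrthonormalBasis (by
    rw [coe_basisOfOrthonormalOfCardEqFinrank]
    exact hon)
  have hb : ∀ i, b i = e i := fun i => by
    simp [b]
  intro x y
  have h := b.sum_inner_mul_inner x y
  rw [Fin.sum_univ_three, hb, hb, hb] at h
  rw [← h]
  simp only [he, Matrix.cons_val_zero, Matrix.cons_val_one, Matrix.cons_val, real_inner_smul_left,
    real_inner_smul_right]
  rw [real_inner_comm a x, real_inner_comm u x, real_inner_comm v x]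
  ring

theorem norm_vec_sq (p : Mom) : ‖vec p‖ ^ 2 = ((∑ i, p i ^ 2 : ℤ) : ℝ) := by
  rw [EuclideanSpace.norm_sq_eq]
  simp [vec]

theorem eq_of_norm_vec_sub_lt_one {p q : Mom} (h : ‖vec (p - q)‖ ^ 2 < 1) : p = q := by
  rw [norm_vec_sq] at h
  have h1 : (∑ i, (p - q) i ^ 2 : ℤ) < 1 := by exact_mod_cast h
  have h2 : (∑ i, (p - q) i ^ 2 : ℤ) = 0 :=
    le_antisymm (by omega) (Finset.sum_nonneg fun i _ => sq_nonneg _)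
  rw [Finset.sum_eq_zero_iff_of_nonneg fun i _ => sq_nonneg _] at h2
  funext i
  have := h2 i (Finset.mem_univ i)
  have h3 : (p - q) i = 0 := pow_eq_zero_iff two_ne_zero |>.1 this
  exact sub_eq_zero.1 h3

theorem one_le_norm_vec {k : Mom} (hk : k ≠ 0) : 1 ≤ ‖vec k‖ := by
  by_contra h
  push Not at h
  refine hk (eq_of_norm_vec_sub_lt_one ?_)
  rw [sub_zero]
  exact pow_lt_one₀ (norm_nonneg _) h two_ne_zero

/-- Every point has a lattice point nearby. -/
theorem exists_lattice_near (x : E3) : ∃ q : Mom, ‖vec q - x‖ < 1 := by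
  refine ⟨fun i => round (x i), ?_⟩
  have h : ‖vec (fun i => round (x i)) - x‖ ^ 2 ≤ 3 / 4 := by
    rw [EuclideanSpace.norm_sq_eq, Fin.sum_univ_three]
    have h1 : ∀ i, ‖(vec (fun i => round (x i)) - x) i‖ ^ 2 ≤ 1 / 4 := fun i => by
      have h2 := abs_sub_round (x i)
      have h3 : (vec (fun i => round (x i)) - x) i = -(x i - round (x i)) := by
        simp [vec]
      rw [h3, norm_neg, Real.norm_eq_abs]
      have := abs_nonneg (x i - round (x i))
      nlinarith
    linarith [h1 0, h1 1, h1 2]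
  nlinarith [norm_nonneg (vec (fun i => round (x i)) - x)]

/-- r(x/‖x‖ - w) is the sum of x - rw and the radial correction (r - ‖x‖)x/‖x‖, each of length at
most ‖x - rw‖. It places points near kF ω̂_α in the inner cap. -/
theorem norm_normalize_sub_le {r : ℝ} (hr : 0 < r) {w x : E3} (hw : ‖w‖ = 1) (hx : x ≠ 0) :
    ‖‖x‖⁻¹ • x - w‖ ≤ 2 * ‖x - r • w‖ / r := by
  rw [le_div_iff₀ hr]
  have hn : ‖x‖ ≠ 0 := norm_ne_zero_iff.2 hx
  have e : r • (‖x‖⁻¹ • x - w) = (x - r • w) + (r - ‖x‖) • (‖x‖⁻¹ • x) := by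
    rw [sub_smul, smul_smul ‖x‖, mul_inv_cancel₀ hn, one_smul, smul_sub]
    abel
  have h1 : ‖r • (‖x‖⁻¹ • x - w)‖ = ‖‖x‖⁻¹ • x - w‖ * r := by
    rw [norm_smul, Real.norm_of_nonneg hr.le, mul_comm]
  rw [← h1, e]
  refine (norm_add_le _ _).trans ?_
  have h2 : ‖‖x‖⁻¹ • x‖ = 1 := norm_smul_inv_norm hx
  rw [norm_smul, h2, mul_one, Real.norm_eq_abs]
  have h3 : |r - ‖x‖| ≤ ‖x - r • w‖ := by
    have := abs_norm_sub_norm_le (r • w) x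
    rw [norm_smul, hw, mul_one, Real.norm_of_nonneg hr.le, norm_sub_rev] at this
    exact this
  linarith

/-- A discrete intermediate value theorem. For f the length along a lattice line in direction k,
consecutive sites with a change of side form a particle-hole pair. -/
theorem exists_sign_change {f : ℤ → ℝ} {c : ℝ} {J : ℤ} (hJ : 0 ≤ J) (h0 : f (-J) ≤ c)
    (h1 : c < f J) : ∃ j, -J ≤ j - 1 ∧ j ≤ J ∧ f (j - 1) ≤ c ∧ c < f j := by
  by_contra hcon
  push Not at hcon
  have key : ∀ n : ℕ, -J + n ≤ J → f (-J + n) ≤ c := by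
    intro n
    induction n with
    | zero => intro _; simpa using h0
    | succ n ih =>
      intro hn
      push_cast at hn ⊢
      refine hcon (-J + (n + 1)) (by omega) hn ?_
      have := ih (by omega)
      convert this using 2
      ring
  have := key (2 * J).toNat (by rw [Int.toNat_of_nonneg (by omega)]; omega)
  rw [Int.toNat_of_nonneg (by omega)] at this
  have e : -J + 2 * J = J := by ring
  rw [e] at this
  linarith

/-! ### Counting particle-hole pairs in a patch -/

namespace PatchDecomposition

variable {kF R c₀ : ℝ} {M : ℕ} (P : PatchDecomposition kF R c₀ M)

/-- The patch `α` is large compared to `|k| ≤ R` and has small curvature compared to the angle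
between `k` and the patch, with a large parameter `A`. -/
structure Wide (A : ℝ) (k : Mom) (α : Fin M) : Prop where
  kF_pos : 0 < kF
  one_le_c : 1 ≤ c₀
  M_pos : 0 < M
  k_ne : k ≠ 0
  norm_k_le : ‖vec k‖ ≤ R
  kdot_pos : 0 < P.kdot k α
  R_le : A * R * ‖vec k‖ ≤ kF / √(M : ℝ) * P.kdot k α
  curv : A * (kF / √(M : ℝ)) * ‖vec k‖ ≤ kF * P.kdot k α

variable {P} {A : ℝ} {k : Mom} {α : Fin M}

theorem Wide.facts (h : P.Wide A k α) (hA : 1 ≤ A) :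
    1 ≤ ‖vec k‖ ∧ 0 < kF / √(M : ℝ) ∧ 0 < P.kdot k α / ‖vec k‖ ∧ P.kdot k α / ‖vec k‖ ≤ 1 ∧
      A * R ≤ kF / √(M : ℝ) * (P.kdot k α / ‖vec k‖) ∧
      A * (kF / √(M : ℝ)) ≤ kF * (P.kdot k α / ‖vec k‖) ∧
      A * R ≤ kF / √(M : ℝ) ∧ A * (kF / √(M : ℝ)) ≤ kF ∧ A * R ≤ kF := by
  have hL := one_le_norm_vec h.k_ne
  have hL0 : 0 < ‖vec k‖ := by linarith
  have hm : 0 < √(M : ℝ) := Real.sqrt_pos.2 (by exact_mod_cast h.M_pos)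
  have hρ : 0 < kF / √(M : ℝ) := div_pos h.kF_pos hm
  have hd : 0 < P.kdot k α / ‖vec k‖ := div_pos h.kdot_pos hL0
  have hd1 : P.kdot k α / ‖vec k‖ ≤ 1 := by
    rw [div_le_one hL0, kdot]
    have := real_inner_le_norm (vec k) (P.center α)
    rwa [P.norm_center, mul_one] at this
  have e1 : A * R ≤ kF / √(M : ℝ) * (P.kdot k α / ‖vec k‖) := by
    rw [← mul_div_assoc, le_div_iff₀ hL0]
    exact h.R_le
  have e2 : A * (kF / √(M : ℝ)) ≤ kF * (P.kdot k α / ‖vec k‖) := by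
    rw [← mul_div_assoc kF (P.kdot k α), le_div_iff₀ hL0]
    exact h.curv
  have e3 : A * R ≤ kF / √(M : ℝ) := e1.trans (mul_le_of_le_one_right hρ.le hd1)
  have e4 : A * (kF / √(M : ℝ)) ≤ kF := e2.trans (mul_le_of_le_one_right h.kF_pos.le hd1)
  refine ⟨hL, hρ, hd, hd1, e1, e2, e3, e4, ?_⟩
  nlinarith

theorem Wide.inPatch (h : P.Wide A k α) (hA : 1 < A) {z : Mom}
    (hz : ‖vec z - kF • P.center α‖ ≤ kF / √(M : ℝ) / (2 * c₀)) (h1 : kF - R ≤ ‖vec z‖)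
    (h2 : ‖vec z‖ ≤ kF + R) : P.InPatch α z := by
  obtain ⟨hL, hρ, hd, hd1, e1, e2, e3, e4, e5⟩ := h.facts hA.le
  have hR : 1 ≤ R := hL.trans h.norm_k_le
  have hc := h.one_le_c
  have hm : 0 < √(M : ℝ) := Real.sqrt_pos.2 (by exact_mod_cast h.M_pos)
  have hk := h.kF_pos
  have hz0 : vec z ≠ 0 := norm_pos_iff.1 (by nlinarith)
  refine ⟨h1, h2, P.inner_cap α _ (norm_smul_inv_norm hz0) ?_⟩
  refine (norm_normalize_sub_le hk (P.norm_center α) hz0).trans ?_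
  rw [div_le_iff₀ hk]
  have e : 1 / (c₀ * √(M : ℝ)) * kF = 2 * (kF / √(M : ℝ) / (2 * c₀)) := by
    field_simp
  rw [e]
  linarith

/-- The left side is the squared tangential extent that bends the sphere away from its tangent
plane; the right side is the linear gain from a displacement of size ρd/(12c) along the normal. -/
theorem sq_div_le_of_curvature {ρ c r d A : ℝ} (hρ : 0 ≤ ρ) (hc : 1 ≤ c) (hr : 0 ≤ r) (hd : 0 ≤ d)
    (hA : 2 ≤ A) (h : A * ρ ≤ r * d) : (ρ / (2 * c)) ^ 2 ≤ 2 * r * (ρ * d / (12 * c)) := by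
  have h4 : 2 * ρ ≤ r * d := (mul_le_mul_of_nonneg_right hA hρ).trans h
  have h5 : (ρ / (2 * c)) ^ 2 = ρ * ρ / (4 * c ^ 2) := by ring
  have h6 : 2 * r * (ρ * d / (12 * c)) = ρ * (r * d) / (6 * c) := by ring
  rw [h5, h6, div_le_div_iff₀ (by positivity) (by positivity)]
  calc ρ * ρ * (6 * c) = ρ * (2 * ρ) * (3 * c) := by ring
    _ ≤ ρ * (r * d) * (4 * c ^ 2) := by
        have h8 : 3 * c ≤ 4 * c ^ 2 := by nlinarith
        gcongr

/-- Start at a lattice point near kF ω̂_α + a u + b v and walk in steps of k: within the patch this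
lattice line passes from inside to outside the Fermi ball. Steps along k leave the coordinates u and
v unchanged, so these remain within rounding error of the prescribed values and distinguish the
pairs. -/
theorem Wide.exists_pair (h : P.Wide A k α) (hA : 100 * c₀ ≤ A) {u v : E3} (hu : ‖u‖ = 1)
    (hv : ‖v‖ = 1) (huk : inner ℝ u (vec k) = 0) (hvk : inner ℝ v (vec k) = 0)
    (huv : inner ℝ u v = 0) {a b : ℝ} (ha : 0 ≤ a) (hb : 0 ≤ b)
    (hab : a + b + 1 ≤ kF / √(M : ℝ) * (P.kdot k α / ‖vec k‖) / (12 * c₀)) :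
    ∃ p ∈ P.pairs α k, |inner ℝ u (vec p) - (kF * inner ℝ u (P.center α) + a)| < 1 ∧
      |inner ℝ v (vec p) - (kF * inner ℝ v (P.center α) + b)| < 1 := by
  have hc := h.one_le_c
  have hc0 : 0 < c₀ := by linarith
  obtain ⟨hL, hρ, hd, hd1, e1, e2, e3, e4, e5⟩ := h.facts (by linarith)
  have hk := h.kF_pos
  have hR : 1 ≤ R := hL.trans h.norm_k_le
  have hkd := h.kdot_pos
  set ρ := kF / √(M : ℝ) with hρdef
  set ω := P.center α with hω
  set d := P.kdot k α / ‖vec k‖ with hddef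
  set Y := ρ * d / (12 * c₀) with hY
  have hkd' : P.kdot k α = d * ‖vec k‖ := by
    rw [hddef, div_mul_cancel₀]
    linarith
  have hvu : inner ℝ v u = 0 := by rw [real_inner_comm]; exact huv
  obtain ⟨q, hq⟩ := exists_lattice_near (kF • ω + (a • u + b • v))
  set e := vec q - (kF • ω + (a • u + b • v)) with he
  set y := vec q - kF • ω with hy
  have hye : y = a • u + b • v + e := by rw [he, hy]; abel
  have hyn : ‖y‖ ≤ Y := by
    rw [hye]
    refine (norm_add_le _ _).trans ?_
    have := norm_add_le (a • u) (b • v)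
    rw [norm_smul, norm_smul, hu, hv, Real.norm_of_nonneg ha, Real.norm_of_nonneg hb] at this
    linarith
  have hY0 : 0 < Y := by positivity
  have hωn : ‖ω‖ = 1 := P.norm_center α
  have hvq : ∀ s : ℤ, vec (q + s • k) = kF • ω + (y + (s : ℝ) • vec k) := fun s => by
    rw [vec_add, vec_zsmul, hy]
    abel
  have hωk : inner ℝ ω (vec k) = P.kdot k α := by rw [kdot, real_inner_comm]
  have hnsq : ∀ s : ℤ, ‖vec (q + s • k)‖ ^ 2 = kF ^ 2 + 2 * kF * inner ℝ ω y +
      2 * kF * s * P.kdot k α + ‖y + (s : ℝ) • vec k‖ ^ 2 := fun s => by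
    rw [hvq, norm_add_sq_real, norm_smul, hωn, Real.norm_of_nonneg hk.le, real_inner_smul_left,
      inner_add_right, real_inner_smul_right, hωk]
    ring
  have hωy : |inner ℝ ω y| ≤ Y := by
    have := abs_real_inner_le_norm ω y
    rw [hωn, one_mul] at this
    linarith
  -- J steps change the normal component by at least 2Y. The starting point has normal offset at
  -- most Y, so a margin Y remains; on the inner side this margin pays for the curvature.
  set J : ℤ := ⌈2 * Y / P.kdot k α⌉ with hJ
  have hJ1 : 2 * Y ≤ J * P.kdot k α := by
    rw [← div_le_iff₀ hkd]
    exact Int.le_ceil _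
  have hJ2 : (J : ℝ) * ‖vec k‖ ≤ 2 * Y / d + R := by
    have h1 : (J : ℝ) ≤ 2 * Y / P.kdot k α + 1 := (Int.ceil_lt_add_one _).le
    have h2 : (J : ℝ) * ‖vec k‖ ≤ (2 * Y / P.kdot k α + 1) * ‖vec k‖ := by gcongr
    have h3 : (2 * Y / P.kdot k α + 1) * ‖vec k‖ = 2 * Y / d + ‖vec k‖ := by
      rw [hkd']
      have : ‖vec k‖ ≠ 0 := by linarith
      field_simp
    linarith [h.norm_k_le]
  have hJ0 : 0 ≤ J := Int.ceil_nonneg (by positivity)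
  have hYd : Y / d = ρ / (12 * c₀) := by rw [hY]; field_simp
  have hYY : Y ≤ ρ / (12 * c₀) := by
    rw [← hYd, le_div_iff₀ hd]
    exact mul_le_of_le_one_right hY0.le hd1
  have hRρ : R ≤ ρ / (4 * c₀) := by
    rw [le_div_iff₀ (by positivity)]
    nlinarith
  -- The budget for staying in the inner cap is 1/12 for the offset, 2/12 for the walk and 3/12 for
  -- rounding J up, in units of ρ/c₀.
  have htot : Y + J * ‖vec k‖ ≤ ρ / (2 * c₀) := by
    have h1 : 2 * Y / d = 2 * (ρ / (12 * c₀)) := by rw [← hYd]; ring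
    have h2 : ρ / (2 * c₀) = ρ / (12 * c₀) + 2 * (ρ / (12 * c₀)) + ρ / (4 * c₀) := by
      field_simp
      norm_num
    linarith
  have hnear : ∀ s : ℤ, -J ≤ s → s ≤ J → ‖y + (s : ℝ) • vec k‖ ≤ ρ / (2 * c₀) := by
    intro s hs1 hs2
    refine (norm_add_le _ _).trans ?_
    rw [norm_smul, Real.norm_eq_abs]
    have h1 : |(s : ℝ)| ≤ J := by
      rw [abs_le]
      constructor
      · exact_mod_cast hs1
      · exact_mod_cast hs2
    have h2 : |(s : ℝ)| * ‖vec k‖ ≤ J * ‖vec k‖ := by gcongr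
    linarith
  have hωy' := abs_le.1 hωy
  have f1 : kF < ‖vec (q + J • k)‖ := by
    refine lt_of_pow_lt_pow_left₀ 2 (norm_nonneg _) ?_
    rw [hnsq]
    have h1 : 0 ≤ ‖y + (J : ℝ) • vec k‖ ^ 2 := sq_nonneg _
    have h2 : 0 < kF * (inner ℝ ω y + J * P.kdot k α) := mul_pos hk (by linarith)
    linarith
  have f0 : ‖vec (q + (-J) • k)‖ ≤ kF := by
    refine le_of_sq_le_sq ?_ hk.le
    rw [hnsq]
    have h1 := hnear (-J) le_rfl (by omega)
    have h2 : ‖y + ((-J : ℤ) : ℝ) • vec k‖ ^ 2 ≤ (ρ / (2 * c₀)) ^ 2 :=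
      pow_le_pow_left₀ (norm_nonneg _) h1 2
    have h3 : (ρ / (2 * c₀)) ^ 2 ≤ 2 * kF * Y :=
      sq_div_le_of_curvature hρ.le hc hk.le hd.le (by linarith) e2
    have h4 : kF * (inner ℝ ω y - J * P.kdot k α) ≤ kF * (-Y) :=
      mul_le_mul_of_nonneg_left (by linarith) hk.le
    have h5 : 2 * kF * ((-J : ℤ) : ℝ) * P.kdot k α = - (2 * kF * (J * P.kdot k α)) := by
      push_cast
      ring
    rw [h5]
    linarith
  obtain ⟨j, hj1, hj2, hj3, hj4⟩ := exists_sign_change (f := fun s => ‖vec (q + s • k)‖) hJ0 f0 f1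
  have hpk : q + j • k - k = q + (j - 1) • k := by
    rw [sub_smul, one_smul]
    abel
  have hn1 : ‖vec (q + j • k)‖ ≤ ‖vec (q + (j - 1) • k)‖ + ‖vec k‖ := by
    have := norm_add_le (vec (q + (j - 1) • k)) (vec k)
    rw [← vec_add] at this
    have e : q + (j - 1) • k + k = q + j • k := by
      rw [sub_smul, one_smul]
      abel
    rwa [e] at this
  have hkR := h.norm_k_le
  have hin : ∀ s : ℤ, -J ≤ s → s ≤ J → kF - R ≤ ‖vec (q + s • k)‖ → ‖vec (q + s • k)‖ ≤ kF + R →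
      P.InPatch α (q + s • k) := by
    intro s hs1 hs2 hs3 hs4
    refine h.inPatch (by linarith) ?_ hs3 hs4
    have : vec (q + s • k) - kF • P.center α = y + (s : ℝ) • vec k := by
      rw [hvq]
      abel
    rw [this]
    exact hnear s hs1 hs2
  have herr : ∀ w x : E3, ‖w‖ = 1 → inner ℝ w (vec k) = 0 →
      |inner ℝ w (vec (q + j • k)) - inner ℝ w (kF • ω + (a • u + b • v))| < 1 := by
    intro w x hw hwk
    have : inner ℝ w (vec (q + j • k)) - inner ℝ w (kF • ω + (a • u + b • v)) = inner ℝ w e := by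
      rw [vec_add, vec_zsmul, inner_add_right, real_inner_smul_right, hwk, he, inner_sub_right]
      ring
    rw [this]
    have := abs_real_inner_le_norm w e
    rw [hw, one_mul] at this
    exact this.trans_lt hq
  refine ⟨q + j • k, P.mem_pairs.2 ⟨⟨hj4, hin j (by omega) hj2 (by linarith) (by linarith)⟩, ?_⟩, ?_, ?_⟩
  · rw [hpk]
    exact ⟨hj3, hin (j - 1) hj1 (by omega) (by linarith) (by linarith)⟩
  · have := herr u 0 hu huk
    rw [inner_add_right, inner_add_right, real_inner_smul_right, real_inner_smul_right,
      real_inner_smul_right, huv, mul_zero, add_zero, real_inner_self_eq_norm_sq, hu, one_pow,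
      mul_one] at this
    exact this
  · have := herr v 0 hv hvk
    rw [inner_add_right, inner_add_right, real_inner_smul_right, real_inner_smul_right,
      real_inner_smul_right, hvu, mul_zero, zero_add, real_inner_self_eq_norm_sq, hv, one_pow,
      mul_one] at this
    exact this

/-- Lower bound for the number of pairs. -/
theorem Wide.le_nrm (h : P.Wide A k α) (hA : 100 * c₀ ≤ A) :
    kF / √(M : ℝ) * (P.kdot k α / ‖vec k‖) / (96 * c₀) ≤ P.nrm α k := by
  have hc := h.one_le_c
  have hc0 : 0 < c₀ := by linarith
  obtain ⟨hL, hρ, hd, hd1, e1, e2, e3, e4, e5⟩ := h.facts (by linarith)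
  have hR : 1 ≤ R := hL.trans h.norm_k_le
  have hk0 : vec k ≠ 0 := norm_pos_iff.1 (by linarith)
  obtain ⟨u, v, hu, hv, huk, hvk, huv, -, -⟩ := exists_frame hk0 (P.center α)
  set X := kF / √(M : ℝ) * (P.kdot k α / ‖vec k‖) with hX
  have hX24 : 24 * c₀ ≤ X := by nlinarith
  have hX0 : 0 ≤ X / (96 * c₀) := by positivity
  set n := ⌊X / (96 * c₀)⌋₊ with hn
  have hn1 : (n : ℝ) ≤ X / (96 * c₀) := Nat.floor_le hX0
  have hn2 : X / (96 * c₀) < n + 1 := Nat.lt_floor_add_one _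
  -- Offsets are taken in 2ℤ, since two coordinates known up to an error below 1 then determine the
  -- integer. Both offsets are at most 2n, hence 4n + 1.
  have hbound : 4 * (n : ℝ) + 1 ≤ X / (12 * c₀) := by
    have h1 : X / (12 * c₀) = 4 * (X / (96 * c₀)) + X / (24 * c₀) := by
      field_simp
      ring
    have h2 : 1 ≤ X / (24 * c₀) := by rwa [le_div_iff₀ (by positivity), one_mul]
    linarith
  have hex : ∀ x : Fin (n + 1) × Fin (n + 1), ∃ p ∈ P.pairs α k,
      |inner ℝ u (vec p) - (kF * inner ℝ u (P.center α) + 2 * (x.1 : ℕ))| < 1 ∧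
      |inner ℝ v (vec p) - (kF * inner ℝ v (P.center α) + 2 * (x.2 : ℕ))| < 1 := by
    intro x
    have h1 : ((x.1 : ℕ) : ℝ) ≤ n := by exact_mod_cast Nat.lt_succ_iff.1 x.1.2
    have h2 : ((x.2 : ℕ) : ℝ) ≤ n := by exact_mod_cast Nat.lt_succ_iff.1 x.2.2
    exact h.exists_pair hA hu hv huk hvk huv (by positivity) (by positivity)
      (le_trans (by linarith) hbound)
  choose f hf1 hf2 hf3 using hex
  have hinj : Function.Injective f := by
    have hsep : ∀ (t c : ℝ) (i j : ℕ), |t - (c + 2 * i)| < 1 → |t - (c + 2 * j)| < 1 → i = j := by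
      intro t c i j hi hj
      rw [abs_lt] at hi hj
      have h1 : (i : ℝ) < j + 1 := by linarith
      have h2 : (j : ℝ) < i + 1 := by linarith
      have h1' : i < j + 1 := by exact_mod_cast h1
      have h2' : j < i + 1 := by exact_mod_cast h2
      omega
    intro x y hxy
    have a1 := hf2 y
    have a2 := hf3 y
    rw [← hxy] at a1 a2
    exact Prod.ext (Fin.ext (hsep _ _ _ _ (hf2 x) a1)) (Fin.ext (hsep _ _ _ _ (hf3 x) a2))
  have hcard : (n + 1) * (n + 1) ≤ (P.pairs α k).card := by
    have := Finset.card_le_card_of_injOn f (s := Finset.univ) (t := P.pairs α k)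
      (fun x _ => hf1 x) hinj.injOn
    simpa using this
  refine hn2.le.trans ?_
  rw [nrm]
  refine Real.le_sqrt_of_sq_le ?_
  have : (((n + 1) * (n + 1) : ℕ) : ℝ) ≤ ((P.pairs α k).card : ℝ) := by exact_mod_cast hcard
  push_cast at this
  linarith

end PatchDecomposition

/-! ### Linearized dispersion and the gap of a particle-hole pair -/

namespace PatchDecomposition

variable {kF R c₀ : ℝ} {M : ℕ} {P : PatchDecomposition kF R c₀ M}
variable {A : ℝ} {k : Mom} {α : Fin M}

theorem Wide.norm_sub_center_le (h : P.Wide A k α) (hA : 1 ≤ A) {p : Mom} (hp : P.InPatch α p) :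
    ‖vec p - kF • P.center α‖ ≤ 3 * c₀ * (kF / √(M : ℝ)) := by
  have hc := h.one_le_c
  obtain ⟨hL, hρ, hd, hd1, e1, e2, e3, e4, e5⟩ := h.facts hA
  have hR : 1 ≤ R := hL.trans h.norm_k_le
  have hk := h.kF_pos
  have hm : 0 < √(M : ℝ) := Real.sqrt_pos.2 (by exact_mod_cast h.M_pos)
  obtain ⟨h1, h2, h3⟩ := hp
  have h4 := P.outer_cap α _ h3
  have hp0 : ‖vec p‖ ≠ 0 := fun h0 => by
    have := P.patch_subset α _ h3
    rw [h0, inv_zero, zero_smul, norm_zero] at this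
    exact zero_ne_one this
  have e : vec p - kF • P.center α =
      ‖vec p‖ • (‖vec p‖⁻¹ • vec p - P.center α) + (‖vec p‖ - kF) • P.center α := by
    rw [smul_sub, smul_smul, mul_inv_cancel₀ hp0, one_smul, sub_smul]
    abel
  have h5 : |‖vec p‖ - kF| ≤ R := abs_le.2 ⟨by linarith, by linarith⟩
  rw [e]
  refine (norm_add_le _ _).trans ?_
  rw [norm_smul, norm_smul, norm_norm, P.norm_center, mul_one, Real.norm_eq_abs]
  have h6 : R ≤ kF := by nlinarith
  have h7 : R ≤ kF / √(M : ℝ) := by nlinarith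
  have h8 : ‖vec p‖ * ‖‖vec p‖⁻¹ • vec p - P.center α‖ ≤ (2 * kF) * (c₀ / √(M : ℝ)) :=
    mul_le_mul (by linarith) h4 (norm_nonneg _) (by linarith)
  have h9 : (2 * kF) * (c₀ / √(M : ℝ)) = 2 * c₀ * (kF / √(M : ℝ)) := by ring
  have h10 : kF / √(M : ℝ) ≤ c₀ * (kF / √(M : ℝ)) := le_mul_of_one_le_left hρ.le hc
  linarith

theorem inner_vec_eq (P : PatchDecomposition kF R c₀ M) (k p : Mom) (α : Fin M) :
    inner ℝ (vec p) (vec k) = kF * P.kdot k α + inner ℝ (vec k) (vec p - kF • P.center α) := by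
  rw [inner_sub_right, real_inner_smul_right, real_inner_comm (vec k) (vec p), kdot]
  ring

/-- Linearization of the dispersion relation in a patch. -/
theorem Wide.linearization (h : P.Wide A k α) (hA : 1 ≤ A) {p : Mom} (hp : P.InPatch α p) :
    |‖vec p‖ ^ 2 - ‖vec (p - k)‖ ^ 2 - 2 * kF * P.kdot k α| ≤
      7 * c₀ * (kF / √(M : ℝ)) * ‖vec k‖ := by
  have hc := h.one_le_c
  obtain ⟨hL, hρ, hd, hd1, e1, e2, e3, e4, e5⟩ := h.facts hA
  have hR : 1 ≤ R := hL.trans h.norm_k_le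
  have h1 := h.norm_sub_center_le hA hp
  have e : ‖vec p‖ ^ 2 - ‖vec (p - k)‖ ^ 2 - 2 * kF * P.kdot k α =
      2 * inner ℝ (vec k) (vec p - kF • P.center α) - ‖vec k‖ ^ 2 := by
    rw [vec_sub, norm_sub_sq_real, P.inner_vec_eq k p α]
    ring
  rw [e]
  have h2 := abs_real_inner_le_norm (vec k) (vec p - kF • P.center α)
  have h3 : ‖vec k‖ * ‖vec p - kF • P.center α‖ ≤ ‖vec k‖ * (3 * c₀ * (kF / √(M : ℝ))) := by gcongr
  have h7 : R ≤ kF / √(M : ℝ) := by nlinarith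
  have h10 : kF / √(M : ℝ) ≤ c₀ * (kF / √(M : ℝ)) := le_mul_of_one_le_left hρ.le hc
  have h4 : ‖vec k‖ ^ 2 ≤ ‖vec k‖ * (c₀ * (kF / √(M : ℝ))) := by
    rw [sq]
    have := h.norm_k_le
    gcongr
    linarith
  have h5 : |2 * inner ℝ (vec k) (vec p - kF • P.center α) - ‖vec k‖ ^ 2| ≤
      2 * |inner ℝ (vec k) (vec p - kF • P.center α)| + ‖vec k‖ ^ 2 := by
    refine (abs_sub _ _).trans ?_
    rw [abs_mul, abs_two, abs_of_nonneg (sq_nonneg ‖vec k‖)]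
  linarith

/-- One of the momenta of a pair is away from the Fermi surface. -/
theorem Wide.gap (h : P.Wide A k α) (hA : 1 ≤ A) {θ : ℝ} (hθ : 8 * c₀ < A * (2 - 4 * θ))
    (hθ0 : 0 ≤ θ) (hθ1 : θ ≤ 1 / 2) {p : Mom} (hp : p ∈ P.pairs α k) :
    2 * θ * P.kdot k α < ‖vec p‖ - ‖vec (p - k)‖ := by
  have hc := h.one_le_c
  obtain ⟨hL, hρ, hd, hd1, e1, e2, e3, e4, e5⟩ := h.facts hA
  have hR : 1 ≤ R := hL.trans h.norm_k_le
  have hk := h.kF_pos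
  have hL0 : 0 < ‖vec k‖ := by linarith
  obtain ⟨⟨p1, p2⟩, ⟨p3, p4⟩⟩ := P.mem_pairs.1 hp
  have hlin := (abs_le.1 (h.linearization hA p2)).1
  have hsum : ‖vec p‖ + ‖vec (p - k)‖ ≤ 2 * kF + R := by linarith [p2.2.1]
  have hsum0 : 0 < ‖vec p‖ + ‖vec (p - k)‖ := by
    have := norm_nonneg (vec (p - k))
    linarith
  set ρ := kF / √(M : ℝ) with hρdef
  set d := P.kdot k α / ‖vec k‖ with hddef
  have hkd : P.kdot k α = d * ‖vec k‖ := by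
    rw [hddef, div_mul_cancel₀ _ hL0.ne']
  have h7 : R ≤ ρ := by nlinarith
  have h10 : ρ ≤ c₀ * ρ := le_mul_of_one_le_left hρ.le hc
  -- The difference of squares is about 2kF k·ω̂, while the sum of the norms is at most 2kF + R. The
  -- slack 2 - 4θ > 0 absorbs the linearization error and R, both of order c₀ρ.
  have hmain : 2 * θ * d * (2 * kF + R) < 2 * kF * d - 7 * c₀ * ρ := by
    have h1 : 2 * θ * d * R ≤ R := by
      have : 2 * θ * d ≤ 1 := by nlinarith
      nlinarith
    have h2 : 8 * c₀ * ρ < (A * (2 - 4 * θ)) * ρ := mul_lt_mul_of_pos_right hθ hρ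
    have h3 : (2 - 4 * θ) * (A * ρ) ≤ (2 - 4 * θ) * (kF * d) :=
      mul_le_mul_of_nonneg_left e2 (by linarith)
    nlinarith
  have hprod : (‖vec p‖ - ‖vec (p - k)‖) * (‖vec p‖ + ‖vec (p - k)‖) =
      ‖vec p‖ ^ 2 - ‖vec (p - k)‖ ^ 2 := by ring
  by_contra hcon
  push Not at hcon
  have h5 : ‖vec p‖ ^ 2 - ‖vec (p - k)‖ ^ 2 ≤ 2 * θ * P.kdot k α * (2 * kF + R) := by
    rw [← hprod]
    have h6 : 0 ≤ 2 * θ * P.kdot k α := by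
      have := h.kdot_pos
      positivity
    calc _ ≤ 2 * θ * P.kdot k α * (‖vec p‖ + ‖vec (p - k)‖) :=
          mul_le_mul_of_nonneg_right hcon hsum0.le
      _ ≤ _ := mul_le_mul_of_nonneg_left hsum h6
  rw [hkd] at h5 hlin
  have h8 := mul_lt_mul_of_pos_right hmain hL0
  nlinarith

/-- Convexity of the ball: a line that has left it cannot be inside again later. Hence each line in
direction k carries at most one pair. -/
theorem eq_zero_of_crossings {p k : Mom} {r : ℝ} {t : ℤ} (ht : 0 ≤ t) (h1 : r < ‖vec p‖)
    (h2 : ‖vec (p - k)‖ ≤ r) (h3 : ‖vec (p + t • k - k)‖ ≤ r) : t = 0 := by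
  by_contra h0
  have ht1 : (1 : ℝ) ≤ t := by
    have : 1 ≤ t := by omega
    exact_mod_cast this
  have hr : 0 ≤ r := (norm_nonneg _).trans h2
  have e2 : ‖vec (p - k)‖ ^ 2 = ‖vec p‖ ^ 2 - 2 * inner ℝ (vec p) (vec k) + ‖vec k‖ ^ 2 := by
    rw [vec_sub, norm_sub_sq_real]
  have e3 : ‖vec (p + t • k - k)‖ ^ 2 =
      ‖vec p‖ ^ 2 + 2 * (t - 1) * inner ℝ (vec p) (vec k) + (t - 1) ^ 2 * ‖vec k‖ ^ 2 := by
    have : vec (p + t • k - k) = vec p + ((t : ℝ) - 1) • vec k := by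
      rw [vec_sub, vec_add, vec_zsmul, sub_smul, one_smul]
      abel
    rw [this, norm_add_sq_real, real_inner_smul_right, norm_smul, mul_pow, Real.norm_eq_abs, sq_abs]
    ring
  have s1 : r ^ 2 < ‖vec p‖ ^ 2 := pow_lt_pow_left₀ h1 hr two_ne_zero
  have s2 := pow_le_pow_left₀ (norm_nonneg _) h2 2
  have s3 := pow_le_pow_left₀ (norm_nonneg _) h3 2
  rw [e2] at s2
  rw [e3] at s3
  have hk : 0 ≤ ‖vec k‖ ^ 2 := sq_nonneg _
  have ht0 : 0 ≤ (t : ℝ) - 1 := by linarith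
  have a1 := mul_le_mul_of_nonneg_left s2 ht0
  have a2 : 0 ≤ ((t : ℝ) - 1) * t * ‖vec k‖ ^ 2 := by positivity
  nlinarith

theorem floor_two_mul_eq {x y : ℝ} (h : ⌊2 * x⌋ = ⌊2 * y⌋) : |x - y| < 1 / 2 := by
  have h1 := Int.abs_sub_lt_one_of_floor_eq_floor h
  rw [← mul_sub, abs_mul, abs_two] at h1
  linarith

theorem card_Icc_floor_le {a : ℝ} (ha : 1 ≤ a) :
    ((Finset.Icc ⌊-(2 * a)⌋ ⌊2 * a⌋).card : ℝ) ≤ 7 * a := by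
  rw [Int.card_Icc]
  have h1 : (⌊2 * a⌋ : ℝ) ≤ 2 * a := Int.floor_le _
  have h2 : -(2 * a) - 1 < (⌊-(2 * a)⌋ : ℝ) := Int.sub_one_lt_floor _
  have h3 : 0 ≤ ⌊2 * a⌋ + 1 - ⌊-(2 * a)⌋ := by
    have : (0 : ℝ) ≤ ((⌊2 * a⌋ + 1 - ⌊-(2 * a)⌋ : ℤ) : ℝ) := by
      push_cast
      have h4 : 2 * a - 1 < (⌊2 * a⌋ : ℝ) := Int.sub_one_lt_floor _
      have h5 : (⌊-(2 * a)⌋ : ℝ) ≤ -(2 * a) := Int.floor_le _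
      linarith
    exact_mod_cast this
  have h4 : (((⌊2 * a⌋ + 1 - ⌊-(2 * a)⌋).toNat : ℤ) : ℝ) = ((⌊2 * a⌋ + 1 - ⌊-(2 * a)⌋ : ℤ) : ℝ) := by
    rw [Int.toNat_of_nonneg h3]
  have h5 : (((⌊2 * a⌋ + 1 - ⌊-(2 * a)⌋).toNat : ℕ) : ℝ) =
      (((⌊2 * a⌋ + 1 - ⌊-(2 * a)⌋).toNat : ℤ) : ℝ) := (Int.cast_natCast _).symm
  rw [h5, h4]
  push_cast
  linarith

theorem floor_two_mul_mem {x a : ℝ} (h : |x| ≤ a) : ⌊2 * x⌋ ∈ Finset.Icc ⌊-(2 * a)⌋ ⌊2 * a⌋ := by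
  rw [abs_le] at h
  exact Finset.mem_Icc.2 ⟨Int.floor_le_floor (by linarith), Int.floor_le_floor (by linarith)⟩

end PatchDecomposition

/-! ### Upper bound on the number of pairs in a patch -/

namespace PatchDecomposition

variable {kF R c₀ : ℝ} {M : ℕ} {P : PatchDecomposition kF R c₀ M}
variable {A : ℝ} {k : Mom} {α : Fin M}

/-- The part of a patch that is relevant for pairs is thin in the direction orthogonal to `k` within
the plane of `k` and the patch center. -/
theorem Wide.abs_inner_center_le (h : P.Wide A k α) (hA : 100 * c₀ ≤ A) {p : Mom}
    (hp : p ∈ P.pairs α k) :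
    |inner ℝ (P.center α) (vec p - kF • P.center α)| ≤
      c₀ * (kF / √(M : ℝ)) * (P.kdot k α / ‖vec k‖) := by
  have hc := h.one_le_c
  obtain ⟨hL, hρ, hd, hd1, e1, e2, e3, e4, e5⟩ := h.facts (by linarith)
  have hR : 1 ≤ R := hL.trans h.norm_k_le
  have hk := h.kF_pos
  obtain ⟨⟨p1, p2⟩, ⟨p3, p4⟩⟩ := P.mem_pairs.1 hp
  have hy := h.norm_sub_center_le (by linarith) p2
  set ρ := kF / √(M : ℝ) with hρdef
  set d := P.kdot k α / ‖vec k‖ with hddef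
  set y := vec p - kF • P.center α with hydef
  have hpy : vec p = kF • P.center α + y := by rw [hydef]; abel
  -- As ‖p‖ lies between kF and kF + R, this determines the normal component of y up to errors of
  -- order R and ‖y‖²/kF, both small compared to ρd.
  have hsq : ‖vec p‖ ^ 2 = kF ^ 2 + 2 * kF * inner ℝ (P.center α) y + ‖y‖ ^ 2 := by
    rw [hpy, norm_add_sq_real, norm_smul, P.norm_center, Real.norm_of_nonneg hk.le,
      real_inner_smul_left]
    ring
  have h1 : kF ^ 2 ≤ ‖vec p‖ ^ 2 := pow_le_pow_left₀ hk.le p1.le 2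
  have h2 : ‖vec p‖ ^ 2 ≤ (kF + R) ^ 2 := pow_le_pow_left₀ (norm_nonneg _) p2.2.1 2
  have h3 : ‖y‖ ^ 2 ≤ (3 * c₀ * ρ) ^ 2 := pow_le_pow_left₀ (norm_nonneg _) hy 2
  have h4 : ρ ^ 2 * (100 * c₀) ≤ ρ * (kF * d) := by
    have : 100 * c₀ * ρ ≤ kF * d := (mul_le_mul_of_nonneg_right hA hρ.le).trans e2
    nlinarith
  have h5 : (3 * c₀ * ρ) ^ 2 ≤ kF * (c₀ * ρ * d) := by
    have : (3 * c₀ * ρ) ^ 2 = 9 * c₀ * (c₀ * ρ ^ 2) := by ring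
    nlinarith [mul_pos hρ (mul_pos hk hd)]
  have h6 : 100 * R ≤ c₀ * ρ * d := by
    have : 100 * c₀ * R ≤ ρ * d := (mul_le_mul_of_nonneg_right hA (by linarith)).trans e1
    have h7 : 0 ≤ ρ * d := by positivity
    nlinarith
  have h7 : R ≤ kF := by nlinarith
  have h8 : kF * (100 * R) ≤ kF * (c₀ * ρ * d) := mul_le_mul_of_nonneg_left h6 hk.le
  have h9 : R ^ 2 ≤ kF * R := by nlinarith
  have hy0 := sq_nonneg ‖y‖
  rw [abs_le]
  constructor <;> refine le_of_mul_le_mul_left ?_ hk <;> nlinarith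

/-- Since u is orthogonal to the center, the center is d k̂ + (v·ω̂)v. If d ≥ 1/2 the patch diameter
suffices. Otherwise |v·ω̂| ≥ 1/2, and the known bound on the normal component can be solved for the
v component; both remaining terms are of order ρd. -/
theorem Wide.abs_inner_frame_le (h : P.Wide A k α) (hA : 100 * c₀ ≤ A) {u v : E3}
    (hu : inner ℝ u (P.center α) = 0)
    (hframe : ∀ x y : E3, inner ℝ x y = (inner ℝ (vec k) x / ‖vec k‖) *
      (inner ℝ (vec k) y / ‖vec k‖) + inner ℝ u x * inner ℝ u y + inner ℝ v x * inner ℝ v y)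
    (hv : ‖v‖ = 1) {p : Mom} (hp : p ∈ P.pairs α k) :
    |inner ℝ v (vec p - kF • P.center α)| ≤
      8 * c₀ * (kF / √(M : ℝ)) * (P.kdot k α / ‖vec k‖) := by
  have hc := h.one_le_c
  obtain ⟨hL, hρ, hd, hd1, e1, e2, e3, e4, e5⟩ := h.facts (by linarith)
  have h1 := h.abs_inner_center_le hA hp
  have hy := h.norm_sub_center_le (by linarith) (P.mem_pairs.1 hp).1.2
  have e1 := hframe (P.center α) (P.center α)
  have e2 := hframe (P.center α) (vec p - kF • P.center α)
  rw [hu, real_inner_self_eq_norm_sq, P.norm_center, one_pow] at e1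
  rw [hu, zero_mul, add_zero] at e2
  change _ = P.kdot k α / ‖vec k‖ * _ + _ at e2
  change _ = P.kdot k α / ‖vec k‖ * (P.kdot k α / ‖vec k‖) + _ + _ at e1
  set ρ := kF / √(M : ℝ) with hρdef
  set d := P.kdot k α / ‖vec k‖ with hddef
  set y := vec p - kF • P.center α with hydef
  have h2 := abs_real_inner_le_norm v y
  rw [hv, one_mul] at h2
  have h3 : |inner ℝ (vec k) y / ‖vec k‖| ≤ 3 * c₀ * ρ := by
    rw [abs_div, abs_of_nonneg (norm_nonneg _), div_le_iff₀ (by linarith)]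
    have := abs_real_inner_le_norm (vec k) y
    nlinarith [norm_nonneg (vec k)]
  have hcρ : 0 < c₀ * ρ := by positivity
  by_cases hd2 : 1 / 2 ≤ d
  · have : 3 * c₀ * ρ ≤ 8 * c₀ * ρ * d := by nlinarith
    linarith
  · push Not at hd2
    have h4 : (1 / 2 : ℝ) ≤ |inner ℝ v (P.center α)| := by
      by_contra hcon
      push Not at hcon
      have h5 := sq_abs (inner ℝ v (P.center α))
      have h6 := abs_nonneg (inner ℝ v (P.center α))
      nlinarith
    have h5 : |inner ℝ v (P.center α)| * |inner ℝ v y| ≤ 4 * c₀ * ρ * d := by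
      rw [← abs_mul]
      have : inner ℝ v (P.center α) * inner ℝ v y =
          inner ℝ (P.center α) y - d * (inner ℝ (vec k) y / ‖vec k‖) := by linarith
      rw [this]
      refine (abs_sub _ _).trans ?_
      rw [abs_mul, abs_of_pos hd]
      have := mul_le_mul_of_nonneg_left h3 hd.le
      linarith
    have h6 := mul_le_mul_of_nonneg_right h4 (abs_nonneg (inner ℝ v y))
    linarith

/-- Upper bound for the number of pairs. -/
theorem Wide.nrm_sq_le (h : P.Wide A k α) (hA : 100 * c₀ ≤ A) :
    P.nrm α k ^ 2 ≤ 8232 * c₀ ^ 2 * (kF / √(M : ℝ)) ^ 2 * P.kdot k α := by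
  have hc := h.one_le_c
  obtain ⟨hL, hρ, hd, hd1, e1, e2, e3, e4, e5⟩ := h.facts (by linarith)
  have hR : 1 ≤ R := hL.trans h.norm_k_le
  have hL0 : 0 < ‖vec k‖ := by linarith
  have hk0 : vec k ≠ 0 := norm_pos_iff.1 hL0
  obtain ⟨u, v, hu, hv, huk, hvk, huv, huw, hframe⟩ := exists_frame hk0 (P.center α)
  set ω := P.center α with hω
  set a := 3 * c₀ * (kF / √(M : ℝ)) with ha
  set b := 8 * c₀ * (kF / √(M : ℝ)) * (P.kdot k α / ‖vec k‖) with hb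
  have hρ1 : 1 ≤ kF / √(M : ℝ) := by nlinarith
  have ha1 : 1 ≤ a := by nlinarith
  have hb1 : 1 ≤ b := by
    have : 1 ≤ kF / √(M : ℝ) * (P.kdot k α / ‖vec k‖) := by nlinarith
    nlinarith
  -- reduction modulo `k`
  let j : Mom → ℤ := fun p => ⌊inner ℝ (vec k) (vec p) / ‖vec k‖ ^ 2⌋
  let z : Mom → ℝ := fun p => inner ℝ (vec k) (vec (p - j p • k)) / ‖vec k‖
  have hkk : inner ℝ (vec k) (vec k) = ‖vec k‖ ^ 2 := real_inner_self_eq_norm_sq _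
  have hz : ∀ p, |z p| ≤ ‖vec k‖ := by
    intro p
    have h1 : (j p : ℝ) ≤ inner ℝ (vec k) (vec p) / ‖vec k‖ ^ 2 := Int.floor_le _
    have h2 : inner ℝ (vec k) (vec p) / ‖vec k‖ ^ 2 < j p + 1 := Int.lt_floor_add_one _
    rw [le_div_iff₀ (by positivity)] at h1
    rw [div_lt_iff₀ (by positivity)] at h2
    have h3 : z p = (inner ℝ (vec k) (vec p) - j p * ‖vec k‖ ^ 2) / ‖vec k‖ := by
      simp only [z, vec_sub, vec_zsmul, inner_sub_right, real_inner_smul_right, hkk]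
    rw [h3, abs_of_nonneg (div_nonneg (by linarith) hL0.le), div_le_iff₀ hL0]
    nlinarith
  -- Cells of side 1/2 in an orthonormal frame: two lattice points in one cell have squared distance
  -- below 3/4, so they coincide.
  let F : Mom → ℤ × ℤ × ℤ := fun p => (⌊2 * inner ℝ u (vec p - kF • ω)⌋,
    ⌊2 * inner ℝ v (vec p - kF • ω)⌋, ⌊2 * z p⌋)
  have hmaps : ∀ p ∈ P.pairs α k, F p ∈ Finset.Icc ⌊-(2 * a)⌋ ⌊2 * a⌋ ×ˢ
      Finset.Icc ⌊-(2 * b)⌋ ⌊2 * b⌋ ×ˢ Finset.Icc ⌊-(2 * ‖vec k‖)⌋ ⌊2 * ‖vec k‖⌋ := by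
    intro p hp
    refine Finset.mem_product.2 ⟨floor_two_mul_mem ?_, Finset.mem_product.2
      ⟨floor_two_mul_mem ?_, floor_two_mul_mem (hz p)⟩⟩
    · have := abs_real_inner_le_norm u (vec p - kF • ω)
      rw [hu, one_mul] at this
      exact this.trans (h.norm_sub_center_le (by linarith) (P.mem_pairs.1 hp).1.2)
    · exact h.abs_inner_frame_le hA huw hframe hv hp
  have hinj : Set.InjOn F (P.pairs α k : Set Mom) := by
    intro p hp p' hp' hF
    have g1 := floor_two_mul_eq (congrArg Prod.fst hF)
    have g2 := floor_two_mul_eq (congrArg (fun x => x.2.1) hF)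
    have g3 := floor_two_mul_eq (congrArg (fun x => x.2.2) hF)
    rw [← inner_sub_right, sub_sub_sub_cancel_right] at g1 g2
    have hq : p - j p • k = p' - j p' • k := by
      apply eq_of_norm_vec_sub_lt_one
      have ew : ∀ w : E3, inner ℝ w (vec k) = 0 →
          inner ℝ w (vec (p - j p • k - (p' - j p' • k))) = inner ℝ w (vec p - vec p') := by
        intro w hw
        simp only [vec_sub, vec_zsmul, inner_sub_right, real_inner_smul_right, hw]
        ring
      rw [← real_inner_self_eq_norm_sq, hframe, ew u huk, ew v hvk, vec_sub, inner_sub_right, sub_div]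
      have q1 := sq_lt_sq' (abs_lt.1 g1).1 (abs_lt.1 g1).2
      have q2 := sq_lt_sq' (abs_lt.1 g2).1 (abs_lt.1 g2).2
      have q3 := sq_lt_sq' (abs_lt.1 g3).1 (abs_lt.1 g3).2
      simp only [z] at q3
      nlinarith
    -- Equal cells identify the pairs only modulo k, so p and p' lie on one line in direction k,
    -- where only one outward crossing is possible.
    have hpp : p' = p + (j p' - j p) • k := by
      calc p' = p' - j p' • k + j p' • k := by abel
        _ = p - j p • k + j p' • k := by rw [hq]
        _ = _ := by
          rw [sub_smul]
          abel
    have hpp2 : p = p' + (j p - j p') • k := by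
      calc p = p - j p • k + j p • k := by abel
        _ = p' - j p' • k + j p • k := by rw [hq]
        _ = _ := by
          rw [sub_smul]
          abel
    obtain ⟨⟨a1, -⟩, ⟨a2, -⟩⟩ := P.mem_pairs.1 hp
    obtain ⟨⟨b1, -⟩, ⟨b2, -⟩⟩ := P.mem_pairs.1 hp'
    rcases le_total 0 (j p' - j p) with h0 | h0
    · have b3 : ‖vec (p + (j p' - j p) • k - k)‖ ≤ kF := by rwa [← hpp]
      have := eq_zero_of_crossings h0 a1 a2 b3
      rw [this, zero_smul, add_zero] at hpp
      exact hpp.symm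
    · have h0' : 0 ≤ j p - j p' := by omega
      have a3 : ‖vec (p' + (j p - j p') • k - k)‖ ≤ kF := by rwa [← hpp2]
      have := eq_zero_of_crossings h0' b1 b2 a3
      rwa [this, zero_smul, add_zero] at hpp2
  have hcard := Finset.card_le_card_of_injOn F hmaps hinj
  rw [Finset.card_product, Finset.card_product] at hcard
  have hcard' : ((P.pairs α k).card : ℝ) ≤ (7 * a) * ((7 * b) * (7 * ‖vec k‖)) := by
    refine (Nat.cast_le.2 hcard).trans ?_
    rw [Nat.cast_mul, Nat.cast_mul]
    exact mul_le_mul (card_Icc_floor_le ha1)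
      (mul_le_mul (card_Icc_floor_le hb1) (card_Icc_floor_le hL) (Nat.cast_nonneg _) (by linarith))
      (mul_nonneg (Nat.cast_nonneg _) (Nat.cast_nonneg _)) (by linarith)
  rw [nrm, Real.sq_sqrt (Nat.cast_nonneg _)]
  refine hcard'.trans (le_of_eq ?_)
  have hkd : P.kdot k α / ‖vec k‖ * ‖vec k‖ = P.kdot k α := div_mul_cancel₀ _ hL0.ne'
  -- 8232 = 7³ · 3 · 8, from three interval counts and the widths a and b.
  rw [ha, hb]
  linear_combination (8232 * c₀ ^ 2 * (kF / √(M : ℝ)) ^ 2) * hkd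

end PatchDecomposition

/-! ### Scaling regime -/

theorem card_cube (j : ℕ) :
    (Finset.Icc (fun _ : Fin 3 => -(j : ℤ)) (fun _ => (j : ℤ))).card = (2 * j + 1) ^ 3 := by
  rw [Pi.card_Icc]
  simp only [Int.card_Icc, Finset.prod_const, Finset.card_univ, Fintype.card_fin]
  congr 1
  omega

theorem card_latticeBall_le {r : ℝ} (hr : 0 ≤ r) : ((latticeBall r).card : ℝ) ≤ (2 * r + 1) ^ 3 := by
  have h1 : latticeBall r ⊆ Finset.Icc (fun _ => -(⌊r⌋₊ : ℤ)) (fun _ => (⌊r⌋₊ : ℤ)) := by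
    intro p hp
    rw [mem_latticeBall] at hp
    have h2 : ∀ i, |p i| ≤ (⌊r⌋₊ : ℤ) := fun i => by
      have h3 : ‖(vec p) i‖ ≤ ‖vec p‖ := PiLp.norm_apply_le (vec p) i
      have h4 : ‖(vec p) i‖ = ((p i).natAbs : ℝ) := by
        rw [Nat.cast_natAbs, Int.cast_abs]
        rfl
      rw [h4] at h3
      have h5 : (p i).natAbs ≤ ⌊r⌋₊ := Nat.le_floor (h3.trans hp)
      rw [← Int.natCast_natAbs]
      exact_mod_cast h5
    rw [Finset.mem_Icc]
    exact ⟨fun i => (abs_le.1 (h2 i)).1, fun i => (abs_le.1 (h2 i)).2⟩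
  have h2 := Finset.card_le_card h1
  rw [card_cube] at h2
  refine (Nat.cast_le.2 h2).trans ?_
  push_cast
  have := Nat.floor_le hr
  gcongr

theorem le_card_latticeBall {r : ℝ} (hr : 0 ≤ r) : (r / 2) ^ 3 ≤ ((latticeBall r).card : ℝ) := by
  have hr2 : 0 ≤ r / 2 := by linarith
  have h1 : Finset.Icc (fun _ => -(⌊r / 2⌋₊ : ℤ)) (fun _ => (⌊r / 2⌋₊ : ℤ)) ⊆ latticeBall r := by
    intro p hp
    rw [Finset.mem_Icc] at hp
    rw [mem_latticeBall]
    refine le_of_sq_le_sq ?_ hr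
    have h2 : ∀ i, ‖(vec p) i‖ ^ 2 ≤ (r / 2) ^ 2 := fun i => by
      refine pow_le_pow_left₀ (norm_nonneg _) ?_ 2
      have h3 : |p i| ≤ (⌊r / 2⌋₊ : ℤ) := abs_le.2 ⟨hp.1 i, hp.2 i⟩
      have h4 : ‖(vec p) i‖ = ((|p i| : ℤ) : ℝ) := by
        rw [Int.cast_abs]
        rfl
      rw [h4]
      have h5 : ((|p i| : ℤ) : ℝ) ≤ ((⌊r / 2⌋₊ : ℤ) : ℝ) := by exact_mod_cast h3
      rw [Int.cast_natCast] at h5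
      exact h5.trans (Nat.floor_le hr2)
    rw [EuclideanSpace.norm_sq_eq, Fin.sum_univ_three]
    nlinarith [h2 0, h2 1, h2 2]
  have h2 := Finset.card_le_card h1
  rw [card_cube] at h2
  refine le_trans ?_ (Nat.cast_le.2 h2)
  push_cast
  have := Nat.lt_floor_add_one (r / 2)
  have h0 : (0 : ℝ) ≤ ⌊r / 2⌋₊ := Nat.cast_nonneg _
  gcongr
  linarith

/-- The scaling regime with a large parameter `A`, expressed by `N^δ`, `N^{1/3}` and `√M`. -/
structure Regime (kF R δ A : ℝ) (M : ℕ) : Prop where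
  kF_pos : 0 < kF
  M_pos : 0 < M
  one_le_R : 1 ≤ R
  one_le_D : 1 ≤ (numN kF : ℝ) ^ δ
  le_sqrt : A * ((numN kF : ℝ) ^ δ * R) ≤ √(M : ℝ)
  le_kF : A * (√(M : ℝ) * (numN kF : ℝ) ^ δ * R ^ 2) ≤ kF
  third_le : (numN kF : ℝ) ^ (1 / 3 : ℝ) ≤ 3 * kF
  kF_le : kF ≤ 2 * (numN kF : ℝ) ^ (1 / 3 : ℝ)

/-- The hypotheses are bounds on M, while the proof uses their square roots. With ε = η² these read
N^δ R ≤ η√M and √M N^δ R² ≤ ηN^{1/3}, and η = 1/(3A) leaves a factor 3 to exchange N^{1/3} for kF.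
-/
theorem exists_regime {δ A : ℝ} (hδ : 0 < δ) (hA : 1 ≤ A) : ∃ ε : ℝ, 0 < ε ∧ ∀ (kF R : ℝ) (M : ℕ),
    0 < kF → 1 ≤ ε * R → (numN kF : ℝ) ^ (2 * δ) * R ^ 2 ≤ ε * (M : ℝ) →
    (M : ℝ) ≤ ε * ((numN kF : ℝ) ^ (2 / 3 - 2 * δ) * R ^ (-4 : ℝ)) → Regime kF R δ A M := by
  have hA0 : 0 < A := by linarith
  refine ⟨(1 / (3 * A)) ^ 2, by positivity, fun kF R M hk h1 h2 h3 => ?_⟩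
  set η := 1 / (3 * A) with hη
  have hη0 : 0 < η := by positivity
  have hAη : 3 * A * η = 1 := by rw [hη]; field_simp
  have hη1 : η ≤ 1 / 3 := by nlinarith
  have hN1 : (1 : ℝ) ≤ numN kF := by exact_mod_cast numN_pos hk
  have hN0 : (0 : ℝ) < numN kF := by linarith
  have hD1 : 1 ≤ (numN kF : ℝ) ^ δ := Real.one_le_rpow hN1 hδ.le
  set N : ℝ := ((numN kF : ℕ) : ℝ) with hN
  set D := N ^ δ with hD
  set n := N ^ (1 / 3 : ℝ) with hn
  have hn0 : 0 < n := Real.rpow_pos_of_pos hN0 _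
  have hR : 1 ≤ R := by
    have : η ^ 2 ≤ 1 := by nlinarith
    by_contra hcon
    push Not at hcon
    have hR0 : 0 < R := by
      by_contra h0
      nlinarith [sq_nonneg η]
    nlinarith
  have hD2 : N ^ (2 * δ) = D ^ 2 := by
    rw [hD, mul_comm, Real.rpow_mul hN0.le, ← Real.rpow_natCast]
    norm_num
  have hn2 : N ^ (2 / 3 - 2 * δ) = n ^ 2 / D ^ 2 := by
    rw [Real.rpow_sub hN0, hD2]
    congr 1
    rw [hn, ← Real.rpow_natCast, ← Real.rpow_mul hN0.le]
    norm_num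
  have hR4 : R ^ (-4 : ℝ) = (R ^ 4)⁻¹ := by
    rw [Real.rpow_neg (by linarith)]
    norm_cast
  rw [hD2] at h2
  rw [hn2, hR4] at h3
  have hM0 : (0 : ℝ) < M := by
    have : 0 < D ^ 2 * R ^ 2 := by positivity
    by_contra h0
    nlinarith [sq_nonneg η]
  have hm0 : 0 < √(M : ℝ) := Real.sqrt_pos.2 hM0
  have hmm : √(M : ℝ) ^ 2 = M := Real.sq_sqrt hM0.le
  set m := √(M : ℝ) with hm
  have g1 : D * R ≤ η * m := by
    refine le_of_sq_le_sq ?_ (by positivity)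
    rw [mul_pow, mul_pow, hmm]
    exact h2
  have g2 : m * D * R ^ 2 ≤ η * n := by
    refine le_of_sq_le_sq ?_ (by positivity)
    have hD0 : 0 < D ^ 2 := by positivity
    have hR0 : 0 < R ^ 4 := by positivity
    calc (m * D * R ^ 2) ^ 2 = M * (D ^ 2 * R ^ 4) := by rw [← hmm]; ring
      _ ≤ (η ^ 2 * (n ^ 2 / D ^ 2 * (R ^ 4)⁻¹)) * (D ^ 2 * R ^ 4) := by gcongr
      _ = (η * n) ^ 2 := by field_simp
  have hn3 : n ^ 3 = N := by
    rw [hn, ← Real.rpow_natCast, ← Real.rpow_mul hN0.le]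
    norm_num
  have c1 : n ≤ 2 * kF + 1 := by
    refine le_of_pow_le_pow_left₀ three_ne_zero (by positivity) ?_
    rw [hn3]
    exact card_latticeBall_le hk.le
  have c2 : kF / 2 ≤ n := by
    refine le_of_pow_le_pow_left₀ three_ne_zero hn0.le ?_
    rw [hn3]
    exact le_card_latticeBall hk.le
  -- The scale separation forces N to be large, which absorbs the additive 1 in N^{1/3} ≤ 2kF + 1.
  have hn4 : 3 ≤ n := by
    have a1 : 1 ≤ D * R := one_le_mul_of_one_le_of_one_le hD1 hR
    have b1 : η * m ≤ 1 / 3 * m := mul_le_mul_of_nonneg_right hη1 hm0.le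
    have b2 : η * n ≤ 1 / 3 * n := mul_le_mul_of_nonneg_right hη1 hn0.le
    have a3 : m ≤ m * (D * R ^ 2) :=
      le_mul_of_one_le_right hm0.le (one_le_mul_of_one_le_of_one_le hD1 (one_le_pow₀ hR))
    linarith
  have c3 : n ≤ 3 * kF := by linarith
  have hAη' : A * η = 1 / 3 := by linarith
  refine ⟨hk, by exact_mod_cast hM0, hR, hD1, ?_, ?_, c3, by linarith⟩
  · calc A * (D * R) ≤ A * (η * m) := mul_le_mul_of_nonneg_left g1 hA0.le
      _ = (A * η) * m := by ring
      _ ≤ m := by rw [hAη']; linarith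
  · calc A * (m * D * R ^ 2) ≤ A * (η * n) := mul_le_mul_of_nonneg_left g2 hA0.le
      _ = (A * η) * n := by ring
      _ ≤ kF := by rw [hAη']; linarith

theorem hbar_eq (kF : ℝ) : hbar kF = ((numN kF : ℝ) ^ (1 / 3 : ℝ))⁻¹ := by
  rw [hbar, Real.rpow_neg (Nat.cast_nonneg _)]

theorem mem_gammaNor {R : ℝ} {k : Mom} : k ∈ gammaNor R ↔ ‖vec k‖ < R ∧
    (0 < k 2 ∨ (k 2 = 0 ∧ 0 < k 1) ∨ (k 2 = 0 ∧ k 1 = 0 ∧ 0 < k 0)) := by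
  classical
  rw [gammaNor, Finset.mem_filter, and_iff_right_iff_imp, mem_latticeBall]
  exact fun h => h.1.le

theorem ne_zero_of_mem_gammaNor {R : ℝ} {k : Mom} (h : k ∈ gammaNor R) : k ≠ 0 := by
  rintro rfl
  have := (mem_gammaNor.1 h).2
  simp at this

theorem ne_neg_of_mem_gammaNor {R : ℝ} {k l : Mom} (hk : k ∈ gammaNor R) (hl : l ∈ gammaNor R) :
    k ≠ -l := by
  rintro rfl
  have h1 := (mem_gammaNor.1 hk).2
  have h2 := (mem_gammaNor.1 hl).2
  simp only [Pi.neg_apply] at h1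
  omega

theorem card_gammaNor_le {R : ℝ} (hR : 1 ≤ R) : ((gammaNor R).card : ℝ) ≤ 27 * R ^ 3 := by
  classical
  have h1 : gammaNor R ⊆ latticeBall R := by
    unfold gammaNor
    exact Finset.filter_subset _ _
  have h2 : ((gammaNor R).card : ℝ) ≤ ((latticeBall R).card : ℝ) := by
    exact_mod_cast Finset.card_le_card h1
  refine h2.trans ((card_latticeBall_le (by linarith)).trans ?_)
  have : (2 * R + 1) ^ 3 ≤ (3 * R) ^ 3 := by gcongr; linarith
  calc _ ≤ _ := this
    _ = _ := by ring

namespace PatchDecomposition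

variable {kF R c₀ : ℝ} {M : ℕ} (P : PatchDecomposition kF R c₀ M)

/-- The cutoff says N^δ k·ω̂_α ≥ 1; inserting this factor turns the two scale separations of the
regime into the two inequalities relative to the angle. -/
theorem wide_of_regime {δ A : ℝ} (h : Regime kF R δ A M) (hA : 1 ≤ A) (hc : 1 ≤ c₀) {k : Mom}
    {α : Fin M} (hk : k ≠ 0) (hkR : ‖vec k‖ ≤ R) (hα : (numN kF : ℝ) ^ (-δ) ≤ P.kdot k α) :
    P.Wide A k α := by
  have hkF := h.kF_pos
  have hm : 0 < √(M : ℝ) := Real.sqrt_pos.2 (by exact_mod_cast h.M_pos)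
  have hD := h.one_le_D
  have hR := h.one_le_R
  have h1 := h.le_sqrt
  have h2 := h.le_kF
  rw [Real.rpow_neg (Nat.cast_nonneg _)] at hα
  set D := (numN kF : ℝ) ^ δ with hDdef
  have hD0 : 0 < D := by linarith
  have hkd : 0 < P.kdot k α := (inv_pos.2 hD0).trans_le hα
  have hα' : 1 ≤ D * P.kdot k α := by
    rwa [inv_le_iff_one_le_mul₀' hD0] at hα
  have hL := norm_nonneg (vec k)
  refine ⟨hkF, hc, h.M_pos, hk, hkR, hkd, ?_, ?_⟩
  · rw [div_mul_eq_mul_div, le_div_iff₀ hm]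
    calc A * R * ‖vec k‖ * √(M : ℝ) ≤ A * R * R * √(M : ℝ) := by gcongr
      _ ≤ A * R * R * √(M : ℝ) * (D * P.kdot k α) := le_mul_of_one_le_right (by positivity) hα'
      _ = A * (√(M : ℝ) * D * R ^ 2) * P.kdot k α := by ring
      _ ≤ _ := by gcongr
  · rw [mul_div_assoc', div_mul_eq_mul_div, div_le_iff₀ hm]
    calc A * kF * ‖vec k‖ ≤ A * kF * R := by gcongr
      _ ≤ A * kF * R * (D * P.kdot k α) := le_mul_of_one_le_right (by positivity) hα'
      _ = kF * P.kdot k α * (A * (D * R)) := by ring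
      _ ≤ _ := by gcongr

/-- The kernel is summable with weight, uniformly in the scaling regime. -/
theorem hs_matL_le_of_regime {δ A : ℝ} (h : Regime kF R δ A M) (hA : 100 * c₀ ≤ A) (hc : 1 ≤ c₀)
    {lg : ℂ → ℂ} {C : ℝ} (hC0 : 0 ≤ C)
    (hC : ∀ z : ℂ, ‖z‖ = 1 → ‖lg z‖ ≤ C * ‖z - 1‖) {Vhat : Mom → ℝ}
    {k : Mom} (hk : k ∈ gammaNor R) (hV : 0 ≤ Vhat k) :
    hs (P.matL lg Vhat δ k) ≤ C * (4 * (8232 * c₀ ^ 2 * Vhat k)) := by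
  have hk0 := ne_zero_of_mem_gammaNor hk
  have hkR := (mem_gammaNor.1 hk).1.le
  refine (P.hs_matL_le h.kF_pos hC0 hC δ hk0 hV).trans ?_
  refine mul_le_mul_of_nonneg_left (mul_le_mul_of_nonneg_left ?_ (by norm_num)) hC0
  have hkF := h.kF_pos
  have hL : 0 < ‖vec k‖ := norm_vec_pos hk0
  have hM0 : (0 : ℝ) < M := by exact_mod_cast h.M_pos
  have hm : 0 < √(M : ℝ) := Real.sqrt_pos.2 hM0
  have hterm : ∀ α ∈ P.Iplus δ k, P.nrm α k ^ 2 / P.khat k α ≤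
      8232 * c₀ ^ 2 * (kF / √(M : ℝ)) ^ 2 * ‖vec k‖ := by
    intro α hα
    have hw := P.wide_of_regime h (by linarith) hc hk0 hkR (P.mem_Iplus.1 hα)
    have := hw.nrm_sq_le hA
    have hkd := hw.kdot_pos
    rw [khat, abs_of_pos hkd, div_div_eq_mul_div, div_le_iff₀ hkd]
    calc _ ≤ (8232 * c₀ ^ 2 * (kF / √(M : ℝ)) ^ 2 * P.kdot k α) * ‖vec k‖ := by gcongr
      _ = _ := by ring
  -- The factor k·ω̂_α in the upper bound on n² cancels the denominator, so patches near the equator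
  -- do no harm, and the factor M^{-1} per patch is compensated by the number of patches.
  have hsum : ∑ α ∈ P.Iplus δ k, P.nrm α k ^ 2 / P.khat k α ≤ 8232 * c₀ ^ 2 * kF ^ 2 * ‖vec k‖ := by
    refine (Finset.sum_le_sum hterm).trans ?_
    rw [Finset.sum_const, nsmul_eq_mul]
    have hcard : ((P.Iplus δ k).card : ℝ) ≤ M := by
      have := Finset.card_le_univ (P.Iplus δ k)
      rw [Fintype.card_fin] at this
      exact_mod_cast this
    calc _ ≤ (M : ℝ) * (8232 * c₀ ^ 2 * (kF / √(M : ℝ)) ^ 2 * ‖vec k‖) := by gcongr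
      _ = _ := by
        rw [div_pow, Real.sq_sqrt hM0.le]
        field_simp
  have hw := P.wpre_nonneg hkF hV
  refine (mul_le_mul_of_nonneg_left hsum hw).trans ?_
  have hN0 : (0 : ℝ) < numN kF := by exact_mod_cast numN_pos hkF
  have hn0 : 0 < (numN kF : ℝ) ^ (1 / 3 : ℝ) := Real.rpow_pos_of_pos hN0 _
  have hn3 : ((numN kF : ℝ) ^ (1 / 3 : ℝ)) ^ 3 = numN kF := by
    rw [← Real.rpow_natCast, ← Real.rpow_mul hN0.le]
    norm_num
  have hle := h.kF_le
  rw [wpre, kappa, hbar_eq]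
  generalize (numN kF : ℝ) ^ (1 / 3 : ℝ) = n at *
  rw [← hn3]
  have e : Vhat k / (2 * n⁻¹ * (kF * n⁻¹) * n ^ 3 * ‖vec k‖) * (8232 * c₀ ^ 2 * kF ^ 2 * ‖vec k‖) =
      4116 * c₀ ^ 2 * Vhat k * (kF / n) := by
    field_simp
    ring
  rw [e]
  have h2 : kF / n ≤ 2 := by rwa [div_le_iff₀ hn0]
  calc 4116 * c₀ ^ 2 * Vhat k * (kF / n) ≤ 4116 * c₀ ^ 2 * Vhat k * 2 := by gcongr
    _ = _ := by ring

end PatchDecomposition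

/-! ### Pair operators -/

theorem pair_mul_pair (a b c d : Mom) :
    ann a * ann b * (ann c * ann d) = ann c * ann d * (ann a * ann b) := by
  have h1 := ann_anticomm b c
  have h2 := ann_anticomm a c
  have h3 := ann_anticomm b d
  have h4 := ann_anticomm a d
  calc ann a * ann b * (ann c * ann d) = ann a * (ann b * ann c) * ann d := by noncomm_ring
    _ = - ((ann a * ann c) * (ann b * ann d)) := by rw [h1]; noncomm_ring
    _ = - (ann c * (ann a * ann d) * ann b) := by rw [h2, h3]; noncomm_ring
    _ = _ := by rw [h4]; noncomm_ring

/-- Wick reordering in an abstract ring: the central elements u and v stand for the contractions of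
b with c and of a with d. -/
theorem mul_mul_mul_of_anticomm {S : Type*} [Ring S] {a b c d u v : S} (hu : ∀ x, u * x = x * u)
    (hv : ∀ x, v * x = x * v) (h1 : b * c = u - c * b) (h2 : b * d = - (d * b))
    (h3 : a * c = - (c * a)) (h4 : a * d = v - d * a) :
    a * b * (c * d) = c * d * (a * b) + (u * v - u * (d * a) - v * (c * b)) := by
  calc a * b * (c * d) = a * (b * c) * d := by noncomm_ring
    _ = (a * u) * d - (a * c) * (b * d) := by rw [h1]; noncomm_ring
    _ = u * (a * d) - c * (a * d) * b := by rw [← hu, h2, h3]; noncomm_ring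
    _ = u * v - u * (d * a) - (c * v) * b + c * d * (a * b) := by rw [h4]; noncomm_ring
    _ = _ := by rw [← hv c]; noncomm_ring

open Classical in
theorem pair_mul_star_pair {h p h' q : Mom} (h1 : p ≠ h') (h2 : h ≠ q) :
    ann h * ann p * star (ann h' * ann q) = star (ann h' * ann q) * (ann h * ann p) +
      ((if p = q then 1 else 0) * (if h = h' then 1 else 0) -
        (if p = q then 1 else 0) * (cre h' * ann h) - (if h = h' then 1 else 0) * (cre q * ann p)) := by
  have central : ∀ (P : Prop) [Decidable P] (x : Fock →L[ℂ] Fock),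
      (if P then 1 else 0) * x = x * (if P then 1 else 0) := fun P _ x => by
    split_ifs <;> simp
  have car : ∀ x y : Mom, ann x * cre y = (if x = y then 1 else 0) - cre y * ann x := fun x y => by
    split_ifs with e
    · rw [e, ann_cre_self]
    · rw [ann_cre_of_ne e, zero_sub]
  rw [star_mul, star_ann, star_ann]
  exact mul_mul_mul_of_anticomm (central _) (central _) (car p q) (ann_cre_of_ne h1)
    (ann_cre_of_ne h2) (car h h')

/-- Bilinear forms with matrix coefficients are controlled by the Hilbert–Schmidt norm. -/
theorem norm_sum_mul_inner_le {σ : Type} [Fintype σ] [DecidableEq σ] (L : Matrix σ σ ℂ)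
    (x y : σ → Fock) : ‖∑ s, ∑ t, L s t * inner ℂ (x s) (y t)‖ ≤
      hs L * √(∑ s, ‖x s‖ ^ 2) * √(∑ s, ‖y s‖ ^ 2) := by
  have h1 : ‖∑ s, ∑ t, L s t * inner ℂ (x s) (y t)‖ ≤
      ∑ z : σ × σ, ‖L z.1 z.2‖ * (‖x z.1‖ * ‖y z.2‖) := by
    rw [Fintype.sum_prod_type]
    refine (norm_sum_le _ _).trans (Finset.sum_le_sum fun s _ => ?_)
    refine (norm_sum_le _ _).trans (Finset.sum_le_sum fun t _ => ?_)
    rw [norm_mul]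
    exact mul_le_mul_of_nonneg_left (norm_inner_le_norm _ _) (norm_nonneg _)
  refine h1.trans ((Real.sum_mul_le_sqrt_mul_sqrt _ _ _).trans (le_of_eq ?_))
  have h2 : √(∑ z : σ × σ, ‖L z.1 z.2‖ ^ 2) = hs L := by
    have h : ∑ z : σ × σ, ‖L z.1 z.2‖ ^ 2 = hs L ^ 2 := by rw [hs_sq, Fintype.sum_prod_type]
    rw [h, Real.sqrt_sq (hs_nonneg _)]
  have h3 : ∑ z : σ × σ, (‖x z.1‖ * ‖y z.2‖) ^ 2 = (∑ s, ‖x s‖ ^ 2) * ∑ s, ‖y s‖ ^ 2 := by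
    rw [Fintype.sum_prod_type, Finset.sum_mul_sum]
    exact Finset.sum_congr rfl fun s _ => Finset.sum_congr rfl fun t _ => mul_pow _ _ _
  rw [h2, h3, Real.sqrt_mul (Finset.sum_nonneg fun _ _ => sq_nonneg _), mul_assoc]

namespace PatchDecomposition

variable {kF R c₀ : ℝ} {M : ℕ} (P : PatchDecomposition kF R c₀ M)

/-- Pair annihilation operator with weights. -/
def wbop (α : Fin M) (k : Mom) (f : Mom → ℝ) : Fock →L[ℂ] Fock :=
  (((P.nrm α k)⁻¹ : ℝ) : ℂ) • ∑ p ∈ P.pairs α k, ((f p : ℝ) : ℂ) • (ann (p - k) * ann p)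

theorem wbop_one (α : Fin M) (k : Mom) : P.wbop α k (fun _ => 1) = P.bop α k := by
  simp [wbop, bop]

theorem wbop_sub_const (α : Fin M) (k : Mom) (f : Mom → ℝ) (c : ℝ) :
    P.wbop α k (fun p => f p - c) = P.wbop α k f - (c : ℂ) • P.bop α k := by
  simp only [wbop, bop, Complex.ofReal_sub, sub_smul, Finset.sum_sub_distrib, smul_sub,
    ← Finset.smul_sum]
  rw [smul_comm (c : ℂ)]

theorem pairs_subset {α : Fin M} {k p : Mom} (hR : 0 ≤ R) (hp : p ∈ P.pairs α k) :
    p ∈ latticeBall (kF + R) ∧ p - k ∈ latticeBall (kF + R) := by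
  obtain ⟨⟨-, h1⟩, ⟨h2, -⟩⟩ := P.mem_pairs.1 hp
  exact ⟨mem_latticeBall.2 h1.2.1, mem_latticeBall.2 (by linarith)⟩

theorem inPatch_unique (hR : 0 ≤ R) {α β : Fin M} {p : Mom} (h1 : P.InPatch α p)
    (h2 : P.InPatch β p) : α = β := by
  by_contra h
  have := P.corridor α β h _ h1 _ h2
  rw [sub_self, norm_zero] at this
  linarith

theorem numOp_mul_bop (hR : 0 ≤ R) (w : Mom → ℝ) (α : Fin M) (k : Mom) :
    numOp (latticeBall (kF + R)) w * P.bop α k =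
      P.bop α k * numOp (latticeBall (kF + R)) w - P.wbop α k (fun p => w p + w (p - k)) := by
  rw [bop, wbop, mul_smul_comm, smul_mul_assoc, ← smul_sub, Finset.mul_sum, Finset.sum_mul,
    ← Finset.sum_sub_distrib]
  congr 1
  refine Finset.sum_congr rfl fun p hp => ?_
  obtain ⟨h1, h2⟩ := P.pairs_subset hR hp
  rw [numOp_mul_ann_ann w h2 h1, add_comm (w p)]

/-- Cauchy–Schwarz over the pairs: their number cancels the normalization n⁻². -/
theorem norm_wbop_sq_le (α : Fin M) (k : Mom) {f : Mom → ℝ} {F : ℝ}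
    (hf : ∀ p ∈ P.pairs α k, |f p| ≤ F) (φ : Fock) :
    ‖P.wbop α k f φ‖ ^ 2 ≤ F ^ 2 * ∑ p ∈ P.pairs α k, ‖ann (p - k) (ann p φ)‖ ^ 2 := by
  have hn : 0 ≤ (P.nrm α k)⁻¹ := inv_nonneg.2 (Real.sqrt_nonneg _)
  have h1 : ‖P.wbop α k f φ‖ ≤ (P.nrm α k)⁻¹ * ∑ p ∈ P.pairs α k, F * ‖ann (p - k) (ann p φ)‖ := by
    rw [wbop, smul_apply, norm_smul, Complex.norm_real, Real.norm_eq_abs,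
      abs_of_nonneg hn, sum_apply]
    refine mul_le_mul_of_nonneg_left ?_ hn
    refine (norm_sum_le _ _).trans (Finset.sum_le_sum fun p hp => ?_)
    rw [smul_apply, norm_smul, Complex.norm_real, Real.norm_eq_abs]
    exact mul_le_mul_of_nonneg_right (hf p hp) (norm_nonneg _)
  have h2 := pow_le_pow_left₀ (norm_nonneg _) h1 2
  refine h2.trans ?_
  have hS : 0 ≤ ∑ p ∈ P.pairs α k, ‖ann (p - k) (ann p φ)‖ ^ 2 :=
    Finset.sum_nonneg fun _ _ => sq_nonneg _
  rw [← Finset.mul_sum, mul_pow, mul_pow, mul_left_comm]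
  refine mul_le_mul_of_nonneg_left ?_ (sq_nonneg F)
  have h3 := sq_sum_le_card_mul_sum_sq (s := P.pairs α k) (f := fun p => ‖ann (p - k) (ann p φ)‖)
  have h4 : (P.nrm α k)⁻¹ ^ 2 = ((P.pairs α k).card : ℝ)⁻¹ := by
    rw [inv_pow, nrm, Real.sq_sqrt (Nat.cast_nonneg _)]
  rw [h4]
  refine (mul_le_mul_of_nonneg_left h3 (by positivity)).trans ?_
  rw [← mul_assoc]
  -- An empty set of pairs is covered as well, because 0⁻¹ * 0 = 0.
  exact mul_le_of_le_one_left hS inv_mul_le_one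

theorem norm_ann_ann_sq_le (G : Finset Mom) {p h : Mom} (hG : p ∈ G ∨ h ∈ G) (φ : Fock) :
    ‖ann h (ann p φ)‖ ^ 2 ≤ (if p ∈ G then ‖ann p φ‖ ^ 2 else 0) +
      (if h ∈ G then ‖ann h φ‖ ^ 2 else 0) := by
  have h1 : ‖ann h (ann p φ)‖ ≤ ‖ann p φ‖ := norm_ann_apply_le h _
  have h2 : ‖ann h (ann p φ)‖ ≤ ‖ann h φ‖ := by
    have e : ann h (ann p φ) = - ann p (ann h φ) := congrArg (fun A : Fock →L[ℂ] Fock => A φ)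
      (ann_anticomm h p)
    rw [e, norm_neg]
    exact norm_ann_apply_le p _
  have h1' := pow_le_pow_left₀ (norm_nonneg _) h1 2
  have h2' := pow_le_pow_left₀ (norm_nonneg _) h2 2
  rcases hG with hG | hG
  · rw [if_pos hG]
    refine h1'.trans (le_add_of_nonneg_right ?_)
    split_ifs <;> positivity
  · rw [if_pos hG]
    refine h2'.trans (le_add_of_nonneg_left ?_)
    split_ifs <;> positivity

-- In each pair the annihilator of a momentum outside G is dropped. Particles lie outside and holes
-- inside the Fermi ball, so no momentum of G is counted twice.
open Classical in
theorem sum_pairs_le (G : Finset Mom) (α : Fin M) (k : Mom)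
    (hG : ∀ p ∈ P.pairs α k, p ∈ G ∨ p - k ∈ G) (φ : Fock) :
    ∑ p ∈ P.pairs α k, ‖ann (p - k) (ann p φ)‖ ^ 2 ≤
      ∑ q ∈ G.filter (P.InPatch α), ‖ann q φ‖ ^ 2 := by
  refine (Finset.sum_le_sum fun p hp => norm_ann_ann_sq_le G (hG p hp) φ).trans ?_
  rw [Finset.sum_add_distrib, ← Finset.sum_filter]
  have e : ∑ p ∈ P.pairs α k, (if p - k ∈ G then ‖ann (p - k) φ‖ ^ 2 else 0) =
      ∑ h ∈ ((P.pairs α k).image (fun p => p - k)).filter (· ∈ G), ‖ann h φ‖ ^ 2 := by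
    rw [Finset.sum_filter, Finset.sum_image]
    intro p _ q _ h
    exact sub_left_injective h
  rw [e, ← Finset.sum_union]
  · refine Finset.sum_le_sum_of_subset_of_nonneg ?_ fun _ _ _ => sq_nonneg _
    intro q hq
    rw [Finset.mem_union, Finset.mem_filter, Finset.mem_filter, Finset.mem_image] at hq
    rw [Finset.mem_filter]
    rcases hq with ⟨h1, h2⟩ | ⟨⟨p, h1, rfl⟩, h2⟩
    · exact ⟨h2, (P.mem_pairs.1 h1).1.2⟩
    · exact ⟨h2, (P.mem_pairs.1 h1).2.2⟩
  · rw [Finset.disjoint_left]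
    intro q hq hq'
    rw [Finset.mem_filter] at hq hq'
    obtain ⟨p, hp, rfl⟩ := Finset.mem_image.1 hq'.1
    have h1 := (P.mem_pairs.1 hq.1).1.1
    have h2 := (P.mem_pairs.1 hp).2.1
    linarith

/-- Families of weighted pair operators on different patches are bounded by the number of momenta
in any set that contains a member of every pair. -/
theorem sum_norm_wbop_sq_le (hR : 0 ≤ R) {σ : Type} [Fintype σ] {lab : σ → Fin M}
    (hlab : Function.Injective lab) (kk : σ → Mom) (f : σ → Mom → ℝ) {F : ℝ}
    (hf : ∀ s, ∀ p ∈ P.pairs (lab s) (kk s), |f s p| ≤ F) (G : Finset Mom)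
    (hG : ∀ s, ∀ p ∈ P.pairs (lab s) (kk s), p ∈ G ∨ p - kk s ∈ G) (φ : Fock) :
    ∑ s, ‖P.wbop (lab s) (kk s) (f s) φ‖ ^ 2 ≤ F ^ 2 * ∑ q ∈ G, ‖ann q φ‖ ^ 2 := by
  classical
  have h1 : ∀ s, ‖P.wbop (lab s) (kk s) (f s) φ‖ ^ 2 ≤
      F ^ 2 * ∑ q ∈ G.filter (P.InPatch (lab s)), ‖ann q φ‖ ^ 2 := fun s =>
    (P.norm_wbop_sq_le _ _ (hf s) φ).trans
      (mul_le_mul_of_nonneg_left (P.sum_pairs_le G _ _ (hG s) φ) (sq_nonneg F))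
  refine (Finset.sum_le_sum fun s _ => h1 s).trans ?_
  rw [← Finset.mul_sum]
  refine mul_le_mul_of_nonneg_left ?_ (sq_nonneg F)
  rw [← Finset.sum_biUnion]
  · refine Finset.sum_le_sum_of_subset_of_nonneg ?_ fun _ _ _ => sq_nonneg _
    intro q hq
    obtain ⟨s, -, hs⟩ := Finset.mem_biUnion.1 hq
    exact (Finset.mem_filter.1 hs).1
  · intro s _ t _ hst
    refine Finset.disjoint_left.2 fun q hq hq' => hst (hlab ?_)
    exact P.inPatch_unique hR (Finset.mem_filter.1 hq).2 (Finset.mem_filter.1 hq').2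

/-! ### Approximate bosonic commutation relations -/

theorem bop_mul_bop (α β : Fin M) (k l : Mom) : P.bop α k * P.bop β l = P.bop β l * P.bop α k := by
  rw [bop, bop, smul_mul_smul_comm, smul_mul_smul_comm, mul_comm (((P.nrm α k)⁻¹ : ℝ) : ℂ),
    Finset.sum_mul_sum, Finset.sum_mul_sum, Finset.sum_comm]
  simp_rw [pair_mul_pair]

open Classical in
/-- The deviation of `b_α(k)` and `b_α(l)^*` from bosonic commutation relations. -/
def errOp (α : Fin M) (k l : Mom) : Fock →L[ℂ] Fock :=
  -((((P.nrm α k)⁻¹ * (P.nrm α l)⁻¹ : ℝ) : ℂ) •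
    (∑ p ∈ (P.pairs α k).filter (· ∈ P.pairs α l), cre (p - l) * ann (p - k) +
      ∑ p ∈ (P.pairs α k).filter (fun p => p - k + l ∈ P.pairs α l), cre (p - k + l) * ann p))

theorem star_bop (α : Fin M) (k : Mom) : star (P.bop α k) =
    (((P.nrm α k)⁻¹ : ℝ) : ℂ) • ∑ p ∈ P.pairs α k, star (ann (p - k) * ann p) := by
  rw [bop, star_smul, star_sum]
  congr 1
  exact Complex.conj_ofReal _

/-- Particles and holes are separated by the Fermi sphere, so particle-hole contractions never
occur. -/
theorem pairs_ne {α β : Fin M} {k l p q : Mom} (hp : p ∈ P.pairs α k) (hq : q ∈ P.pairs β l) :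
    p ≠ q - l ∧ p - k ≠ q := by
  have h1 := P.mem_pairs.1 hp
  have h2 := P.mem_pairs.1 hq
  constructor
  · rintro rfl
    linarith [h1.1.1, h2.2.1]
  · rintro rfl
    linarith [h1.2.1, h2.1.1]

theorem bop_mul_star_bop_of_ne (hR : 0 ≤ R) {α β : Fin M} (h : α ≠ β) (k l : Mom) :
    P.bop α k * star (P.bop β l) = star (P.bop β l) * P.bop α k := by
  classical
  rw [star_bop, bop, smul_mul_smul_comm, smul_mul_smul_comm, mul_comm (((P.nrm α k)⁻¹ : ℝ) : ℂ),
    Finset.sum_mul_sum, Finset.sum_mul_sum, Finset.sum_comm]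
  congr 1
  refine Finset.sum_congr rfl fun q hq => Finset.sum_congr rfl fun p hp => ?_
  obtain ⟨h1, h2⟩ := P.pairs_ne hp hq
  have h3 : p ≠ q := by
    rintro rfl
    exact h (P.inPatch_unique hR (P.mem_pairs.1 hp).1.2 (P.mem_pairs.1 hq).1.2)
  have h4 : p - k ≠ q - l := fun e => by
    have h5 := (P.mem_pairs.1 hp).2.2
    rw [e] at h5
    exact h (P.inPatch_unique hR h5 (P.mem_pairs.1 hq).2.2)
  rw [pair_mul_star_pair h1 h2, if_neg h3, if_neg h4]
  simp

open Classical in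
theorem pairs_mul_star_pairs {α : Fin M} {k l : Mom} :
    (∑ p ∈ P.pairs α k, ann (p - k) * ann p) *
      (∑ q ∈ P.pairs α l, star (ann (q - l) * ann q)) =
      (∑ q ∈ P.pairs α l, star (ann (q - l) * ann q)) * (∑ p ∈ P.pairs α k, ann (p - k) * ann p) +
        ((if k = l then ((P.pairs α k).card : ℂ) • (1 : Fock →L[ℂ] Fock) else 0) -
        (∑ p ∈ (P.pairs α k).filter (· ∈ P.pairs α l), cre (p - l) * ann (p - k) +
          ∑ p ∈ (P.pairs α k).filter (fun p => p - k + l ∈ P.pairs α l),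
            cre (p - k + l) * ann p)) := by
  have h0 : ∀ p ∈ P.pairs α k, ∀ q ∈ P.pairs α l,
      ann (p - k) * ann p * star (ann (q - l) * ann q) =
      star (ann (q - l) * ann q) * (ann (p - k) * ann p) +
        ((if p = q then (if k = l then 1 else 0) else 0) -
          (if p = q then cre (p - l) * ann (p - k) else 0) -
          (if p - k + l = q then cre (p - k + l) * ann p else 0)) := by
    intro p hp q hq
    obtain ⟨h1, h2⟩ := P.pairs_ne hp hq
    rw [pair_mul_star_pair h1 h2]
    have e : (p - k = q - l) ↔ (p - k + l = q) := by
      rw [eq_sub_iff_add_eq]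
    have e1 : ((if p = q then 1 else 0) * (if p - k = q - l then 1 else 0) : Fock →L[ℂ] Fock) =
        if p = q then (if k = l then 1 else 0) else 0 := by
      by_cases hpq : p = q
      · subst hpq
        have e2 : (p - k = p - l) ↔ k = l := sub_right_injective.eq_iff
        simp only [if_true, one_mul, e2]
      · simp only [if_neg hpq, zero_mul]
    have e2 : ((if p = q then 1 else 0) * (cre (q - l) * ann (p - k)) : Fock →L[ℂ] Fock) =
        if p = q then cre (p - l) * ann (p - k) else 0 := by
      by_cases hpq : p = q
      · rw [if_pos hpq, if_pos hpq, one_mul, hpq]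
      · rw [if_neg hpq, if_neg hpq, zero_mul]
    have e3 : ((if p - k = q - l then 1 else 0) * (cre q * ann p) : Fock →L[ℂ] Fock) =
        if p - k + l = q then cre (p - k + l) * ann p else 0 := by
      by_cases hpq : p - k + l = q
      · rw [if_pos hpq, if_pos (e.2 hpq), one_mul, hpq]
      · rw [if_neg hpq, if_neg (fun h => hpq (e.1 h)), zero_mul]
    rw [e1, e2, e3]
  have e1 : ∑ p ∈ P.pairs α k, ∑ q ∈ P.pairs α l,
      (if p = q then (if k = l then (1 : Fock →L[ℂ] Fock) else 0) else 0) =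
      if k = l then ((P.pairs α k).card : ℂ) • (1 : Fock →L[ℂ] Fock) else 0 := by
    simp_rw [Finset.sum_ite_eq]
    by_cases hkl : k = l
    · subst hkl
      rw [← Finset.sum_filter, Finset.filter_true_of_mem fun _ h => h]
      simp only [if_true]
      rw [Finset.sum_const, ← Nat.cast_smul_eq_nsmul ℂ]
    · simp only [if_neg hkl, ite_self, Finset.sum_const_zero]
  have e2 : ∑ p ∈ P.pairs α k, ∑ q ∈ P.pairs α l,
      (if p = q then cre (p - l) * ann (p - k) else 0) =
      ∑ p ∈ (P.pairs α k).filter (· ∈ P.pairs α l), cre (p - l) * ann (p - k) := by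
    simp_rw [Finset.sum_ite_eq]
    rw [← Finset.sum_filter]
  have e3 : ∑ p ∈ P.pairs α k, ∑ q ∈ P.pairs α l,
      (if p - k + l = q then cre (p - k + l) * ann p else 0) =
      ∑ p ∈ (P.pairs α k).filter (fun p => p - k + l ∈ P.pairs α l),
            cre (p - k + l) * ann p := by
    simp_rw [Finset.sum_ite_eq]
    rw [← Finset.sum_filter]
  rw [Finset.sum_mul_sum, Finset.sum_mul_sum,
    Finset.sum_comm (s := P.pairs α l) (t := P.pairs α k),
    Finset.sum_congr rfl fun p hp => Finset.sum_congr rfl (h0 p hp), ← e1, ← e2, ← e3, ← sub_sub]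
  simp only [Finset.sum_add_distrib, Finset.sum_sub_distrib]

open Classical in
theorem bop_mul_star_bop {α : Fin M} {k l : Mom} (hk : P.nrm α k ≠ 0) :
    P.bop α k * star (P.bop α l) =
      star (P.bop α l) * P.bop α k + ((if k = l then 1 else 0) + P.errOp α k l) := by
  have e : (((P.nrm α k)⁻¹ : ℝ) : ℂ) • (((P.nrm α l)⁻¹ : ℝ) : ℂ) •
      (if k = l then ((P.pairs α k).card : ℂ) • (1 : Fock →L[ℂ] Fock) else 0) =
      if k = l then 1 else 0 := by
    by_cases hkl : k = l
    · subst hkl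
      rw [if_pos rfl, if_pos rfl, smul_smul, smul_smul]
      have h1 : P.nrm α k * P.nrm α k = (P.pairs α k).card := Real.mul_self_sqrt (Nat.cast_nonneg _)
      have h2 : (((P.pairs α k).card : ℝ) : ℂ) = ((P.pairs α k).card : ℂ) :=
        Complex.ofReal_natCast _
      have h3 : (P.nrm α k)⁻¹ * (P.nrm α k)⁻¹ * (P.nrm α k * P.nrm α k) = 1 := by field_simp
      rw [← h2, ← h1, ← Complex.ofReal_mul, ← Complex.ofReal_mul, h3, Complex.ofReal_one, one_smul]
    · rw [if_neg hkl, if_neg hkl, smul_zero, smul_zero]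
  rw [star_bop, bop, smul_mul_smul_comm, pairs_mul_star_pairs, smul_mul_smul_comm, errOp, ← e,
    mul_comm (((P.nrm α l)⁻¹ : ℝ) : ℂ), Complex.ofReal_mul, smul_smul, smul_add, smul_sub,
    ← sub_eq_add_neg]

/-- Each of the two sums is a one-body operator that moves modes by a translation, so
`norm_sum_cre_ann_le` bounds it by the number operator irrespective of the number of terms. -/
theorem norm_errOp_apply_le (hR : 0 ≤ R) (α : Fin M) (k l : Mom) (x : Fock) :
    ‖P.errOp α k l x‖ ≤
      2 * ((P.nrm α k)⁻¹ * (P.nrm α l)⁻¹) * ‖numΛ (latticeBall (kF + R)) x‖ := by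
  classical
  have hn : 0 ≤ (P.nrm α k)⁻¹ * (P.nrm α l)⁻¹ :=
    mul_nonneg (inv_nonneg.2 (Real.sqrt_nonneg _)) (inv_nonneg.2 (Real.sqrt_nonneg _))
  rw [errOp, neg_apply, norm_neg, smul_apply, norm_smul, Complex.norm_real, Real.norm_eq_abs,
    abs_of_nonneg hn, add_apply, sum_apply, sum_apply, mul_comm 2, mul_assoc _ (2 : ℝ)]
  refine mul_le_mul_of_nonneg_left ?_ hn
  rw [two_mul]
  refine (norm_add_le _ _).trans (add_le_add ?_ ?_)
  · refine norm_sum_cre_ann_le _ (fun p => p - l) (fun p => p - k) _ (sub_left_injective.injOn)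
      (sub_left_injective.injOn) ?_ ?_ x
    · intro p hp
      exact (P.pairs_subset hR (Finset.mem_filter.1 hp).2).2
    · intro p hp
      exact (P.pairs_subset hR (Finset.mem_filter.1 hp).1).2
  · refine norm_sum_cre_ann_le _ (fun p => p - k + l) (fun p => p) _ ?_ (Set.injOn_id _) ?_ ?_ x
    · intro p _ q _ h
      simpa using h
    · intro p hp
      exact (P.pairs_subset hR (Finset.mem_filter.1 hp).2).1
    · intro p hp
      exact (P.pairs_subset hR (Finset.mem_filter.1 hp).1).1

end PatchDecomposition

/-! ### Exponentials of skew-adjoint quadratic expressions -/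

/-- `∑_{s,t} L_{st} c_s^* c_t`. -/
def quadOp {σ : Type} [Fintype σ] (L : Matrix σ σ ℂ) (c : σ → Fock →L[ℂ] Fock) : Fock →L[ℂ] Fock :=
  ∑ s, ∑ t, L s t • (star (c s) * c t)

theorem star_quadOp {σ : Type} [Fintype σ] {L : Matrix σ σ ℂ}
    (hL : ∀ s t, (starRingEnd ℂ) (L s t) = - L t s) (c : σ → Fock →L[ℂ] Fock) :
    star (quadOp L c) = - quadOp L c := by
  rw [quadOp, star_sum, ← Finset.sum_neg_distrib]
  simp_rw [star_sum, ← Finset.sum_neg_distrib]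
  rw [Finset.sum_comm]
  refine Finset.sum_congr rfl fun s _ => Finset.sum_congr rfl fun t _ => ?_
  have h : star (L t s) = - L s t := hL t s
  rw [star_smul, star_mul, star_star, h, neg_smul]

theorem comm_quadOp {σ : Type} [Fintype σ] (L : Matrix σ σ ℂ) {c r : σ → Fock →L[ℂ] Fock}
    {X : Fock →L[ℂ] Fock} (hX : star X = X) (h : ∀ s, X * c s = c s * X - r s) :
    X * quadOp L c - quadOp L c * X =
      ∑ s, ∑ t, L s t • (star (r s) * c t - star (c s) * r t) := by
  have h' : ∀ s, X * star (c s) = star (c s) * X + star (r s) := fun s => by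
    have := congrArg star (h s)
    rw [star_mul, star_sub, star_mul, hX] at this
    rw [this, sub_add_cancel]
  rw [quadOp, Finset.mul_sum, Finset.sum_mul, ← Finset.sum_sub_distrib]
  refine Finset.sum_congr rfl fun s _ => ?_
  rw [Finset.mul_sum, Finset.sum_mul, ← Finset.sum_sub_distrib]
  refine Finset.sum_congr rfl fun t _ => ?_
  have e : X * (star (c s) * c t) - star (c s) * c t * X =
      star (r s) * c t - star (c s) * r t := by
    rw [← mul_assoc, h', add_mul, mul_assoc, h, mul_sub, mul_assoc]
    abel
  rw [mul_smul_comm, smul_mul_assoc, ← smul_sub, e]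

theorem norm_inner_comm_quadOp_le {σ : Type} [Fintype σ] [DecidableEq σ] (L : Matrix σ σ ℂ)
    {c r : σ → Fock →L[ℂ] Fock} {X : Fock →L[ℂ] Fock} (hX : star X = X)
    (h : ∀ s, X * c s = c s * X - r s) (φ : Fock) :
    ‖inner ℂ φ ((X * quadOp L c - quadOp L c * X) φ)‖ ≤
      2 * (hs L * √(∑ s, ‖r s φ‖ ^ 2) * √(∑ s, ‖c s φ‖ ^ 2)) := by
  have e : inner ℂ φ ((X * quadOp L c - quadOp L c * X) φ) =
      (∑ s, ∑ t, L s t * inner ℂ (r s φ) (c t φ)) -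
        ∑ s, ∑ t, L s t * inner ℂ (c s φ) (r t φ) := by
    rw [comm_quadOp L hX h, sum_apply, inner_sum, ← Finset.sum_sub_distrib]
    refine Finset.sum_congr rfl fun s _ => ?_
    rw [sum_apply, inner_sum, ← Finset.sum_sub_distrib]
    refine Finset.sum_congr rfl fun t _ => ?_
    have e1 : inner ℂ φ ((star (r s) * c t) φ) = inner ℂ (r s φ) (c t φ) :=
      (inner_adj_left (r s) φ (c t φ)).symm
    have e2 : inner ℂ φ ((star (c s) * r t) φ) = inner ℂ (c s φ) (r t φ) :=
      (inner_adj_left (c s) φ (r t φ)).symm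
    rw [smul_apply, inner_smul_right, sub_apply, inner_sub_right, e1, e2, mul_sub]
  rw [e, two_mul]
  refine (norm_sub_le _ _).trans (add_le_add (norm_sum_mul_inner_le _ _ _) ?_)
  rw [mul_right_comm]
  exact norm_sum_mul_inner_le _ _ _

/-- Every c_t lowers X by the same amount z and c_s^* raises it again. -/
theorem commute_quadOp_of_shift {σ : Type} [Fintype σ] (L : Matrix σ σ ℂ)
    {c : σ → Fock →L[ℂ] Fock} {X : Fock →L[ℂ] Fock} (hX : star X = X) (z : ℝ)
    (h : ∀ s, X * c s = c s * X - (z : ℂ) • c s) : Commute X (quadOp L c) := by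
  rw [commute_iff_eq, ← sub_eq_zero, comm_quadOp L hX (r := fun s => (z : ℂ) • c s) h]
  refine Finset.sum_eq_zero fun s _ => Finset.sum_eq_zero fun t _ => ?_
  have : star ((z : ℂ) • c s) = (z : ℂ) • star (c s) := by
    rw [star_smul]
    congr 1
    exact Complex.conj_ofReal z
  rw [this, smul_mul_assoc, mul_smul_comm, sub_self, smul_zero]

theorem commute_quadOp {σ : Type} [Fintype σ] (L : Matrix σ σ ℂ) {c : σ → Fock →L[ℂ] Fock}
    {X : Fock →L[ℂ] Fock} (h : ∀ s, Commute X (c s)) (h' : ∀ s, Commute X (star (c s))) :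
    Commute X (quadOp L c) :=
  Commute.sum_right _ _ _ fun s _ => Commute.sum_right _ _ _ fun t _ =>
    ((h' s).mul_right (h t)).smul_right _

/-- The evolution `exp(tB)ψ`. -/
def flow (B : Fock →L[ℂ] Fock) (ψ : Fock) (t : ℝ) : Fock := NormedSpace.exp (t • B) ψ

theorem flow_zero (B : Fock →L[ℂ] Fock) (ψ : Fock) : flow B ψ 0 = ψ := by
  rw [flow, zero_smul, NormedSpace.exp_zero]
  rfl

theorem flow_one (B : Fock →L[ℂ] Fock) (ψ : Fock) : flow B ψ 1 = NormedSpace.exp B ψ := by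
  rw [flow, one_smul]

theorem hasDerivAt_flow (B : Fock →L[ℂ] Fock) (ψ : Fock) (t : ℝ) :
    HasDerivAt (flow B ψ) (B (flow B ψ t)) t := by
  have h := hasDerivAt_exp_smul_const' (𝕂 := ℝ) B t
  have h2 := ((ContinuousLinearMap.apply ℂ Fock ψ).restrictScalars ℝ).hasFDerivAt.comp_hasDerivAt t h
  exact h2

theorem commute_exp_smul {X B : Fock →L[ℂ] Fock} (h : Commute X B) (t : ℝ) :
    Commute X (NormedSpace.exp (t • B)) := (h.smul_right t).exp_right

theorem map_flow {X B : Fock →L[ℂ] Fock} (h : Commute X B) (ψ : Fock) (t : ℝ) :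
    X (flow B ψ t) = flow B (X ψ) t :=
  congrArg (fun A : Fock →L[ℂ] Fock => A ψ) (commute_exp_smul h t).eq

theorem hasDerivAt_inner_flow {B X : Fock →L[ℂ] Fock} (hB : star B = -B) (ψ : Fock) (t : ℝ) :
    HasDerivAt (fun t => (inner ℂ (flow B ψ t) (X (flow B ψ t))).re)
      (inner ℂ (flow B ψ t) ((X * B - B * X) (flow B ψ t))).re t := by
  have h1 := hasDerivAt_flow B ψ t
  have h2 : HasDerivAt (fun t => X (flow B ψ t)) (X (B (flow B ψ t))) t :=
    (X.restrictScalars ℝ).hasFDerivAt.comp_hasDerivAt t h1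
  have h3 := h1.inner ℂ h2
  have h4 := Complex.reCLM.hasFDerivAt.comp_hasDerivAt t h3
  refine h4.congr_deriv ?_
  have e : inner ℂ (B (flow B ψ t)) (X (flow B ψ t)) =
      - inner ℂ (flow B ψ t) (B (X (flow B ψ t))) := by
    rw [inner_adj_left, hB, neg_apply, inner_neg_right]
  change (inner ℂ _ _ + inner ℂ _ _ : ℂ).re = _
  rw [e, sub_apply, inner_sub_right, sub_eq_add_neg]
  rfl

theorem norm_flow {B : Fock →L[ℂ] Fock} (hB : star B = -B) (ψ : Fock) (t : ℝ) :
    ‖flow B ψ t‖ = ‖ψ‖ := by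
  have h : ∀ s, HasDerivAt (fun t => (inner ℂ (flow B ψ t) ((1 : Fock →L[ℂ] Fock) (flow B ψ t))).re)
      0 s := fun s => by
    have := hasDerivAt_inner_flow (X := 1) hB ψ s
    rw [one_mul, mul_one, sub_self, zero_apply, inner_zero_right] at this
    exact this
  have h2 := is_const_of_deriv_eq_zero (fun s => (h s).differentiableAt) (fun s => (h s).deriv) t 0
  simp only [flow_zero] at h2
  have e : ∀ x : Fock, (inner ℂ x ((1 : Fock →L[ℂ] Fock) x)).re = ‖x‖ ^ 2 := fun x => by
    change (inner ℂ x x).re = _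
    rw [inner_self_eq_norm_sq_to_K]
    norm_cast
  rw [e, e] at h2
  exact (sq_eq_sq₀ (norm_nonneg _) (norm_nonneg _)).1 h2

/-- Grönwall, from a commutator bound by X itself. -/
theorem re_inner_flow_le {B X : Fock →L[ℂ] Fock} (hB : star B = -B) {K : ℝ}
    (hX : ∀ φ, 0 ≤ (inner ℂ φ (X φ)).re)
    (h : ∀ φ, |(inner ℂ φ ((X * B - B * X) φ)).re| ≤ K * (inner ℂ φ (X φ)).re) (ψ : Fock) {t : ℝ}
    (ht : t ∈ Set.Icc (0 : ℝ) 1) :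
    (inner ℂ (flow B ψ t) (X (flow B ψ t))).re ≤ (inner ℂ ψ (X ψ)).re * Real.exp (K * t) := by
  have hd := hasDerivAt_inner_flow (X := X) hB ψ
  have := norm_le_gronwallBound_of_norm_deriv_right_le (K := K) (ε := 0)
    (δ := (inner ℂ ψ (X ψ)).re)
    (f := fun t => (inner ℂ (flow B ψ t) (X (flow B ψ t))).re) (a := 0) (b := 1)
    (fun x _ => (hd x).continuousAt.continuousWithinAt) (fun x _ => (hd x).hasDerivWithinAt)
    (by rw [flow_zero, Real.norm_eq_abs, abs_of_nonneg (hX ψ)])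
    (fun x _ => by
      rw [add_zero, Real.norm_eq_abs, Real.norm_eq_abs, abs_of_nonneg (hX _)]
      exact h _) t ht
  rw [gronwallBound_ε0, sub_zero, Real.norm_eq_abs, abs_of_nonneg (hX _)] at this
  exact this

theorem abs_re_inner_flow_sub_le {B X : Fock →L[ℂ] Fock} (hB : star B = -B) {K : ℝ} (ψ : Fock)
    (h : ∀ t ∈ Set.Icc (0 : ℝ) 1,
      |(inner ℂ (flow B ψ t) ((X * B - B * X) (flow B ψ t))).re| ≤ K) :
    |(inner ℂ (flow B ψ 1) (X (flow B ψ 1))).re - (inner ℂ ψ (X ψ)).re| ≤ K := by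
  have hd := hasDerivAt_inner_flow (X := X) hB ψ
  have := norm_image_sub_le_of_norm_deriv_le_segment_01' (C := K)
    (f := fun t => (inner ℂ (flow B ψ t) (X (flow B ψ t))).re)
    (fun x _ => (hd x).hasDerivWithinAt) (fun x hx => h x ⟨hx.1, hx.2.le⟩)
  rw [flow_zero] at this
  exact this

/-! ### Diagonal forms in terms of annihilation operators -/

theorem enorm_sq_eq_ofReal (φ : Fock) : ‖φ‖ₑ ^ 2 = ENNReal.ofReal (‖φ‖ ^ 2) := by
  rw [ENNReal.ofReal_pow (norm_nonneg _), ofReal_norm]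

theorem enorm_sq_eq_tsum (φ : Fock) : ‖φ‖ₑ ^ 2 = ∑' S, ‖φ S‖ₑ ^ 2 := by
  have h := lp.hasSum_norm (p := 2) (by norm_num) φ
  have e : (2 : ℝ≥0∞).toReal = ((2 : ℕ) : ℝ) := by norm_num
  simp_rw [e, Real.rpow_natCast] at h
  rw [enorm_sq_eq_ofReal, ← h.tsum_eq, ENNReal.ofReal_tsum_of_nonneg (fun _ => by positivity)
    h.summable]
  refine tsum_congr fun S => ?_
  rw [ENNReal.ofReal_pow (norm_nonneg _), ofReal_norm]

theorem norm_cre_ann (p : Mom) (ψ : Fock) : ‖cre p (ann p ψ)‖ = ‖ann p ψ‖ := by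
  have h : (inner ℂ (cre p (ann p ψ)) (cre p (ann p ψ)) : ℂ) = inner ℂ (ann p ψ) (ann p ψ) := by
    rw [inner_adj_left, star_cre]
    have e : ann p (cre p (ann p ψ)) = ann p ψ - cre p (ann p (ann p ψ)) :=
      congrArg (fun A : Fock →L[ℂ] Fock => A (ann p ψ)) (ann_cre_self p)
    have e2 : ann p (ann p ψ) = 0 := congrArg (fun A : Fock →L[ℂ] Fock => A ψ) (ann_mul_self p)
    rw [e, e2, map_zero, sub_zero]
  rw [inner_self_eq_norm_sq_to_K, inner_self_eq_norm_sq_to_K] at h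
  have h' : ‖cre p (ann p ψ)‖ ^ 2 = ‖ann p ψ‖ ^ 2 := by exact_mod_cast h
  exact (sq_eq_sq₀ (norm_nonneg _) (norm_nonneg _)).1 h'

open Classical in
theorem enorm_ann_sq (p : Mom) (ψ : Fock) :
    ‖ann p ψ‖ₑ ^ 2 = ∑' S : Finset Mom, if p ∈ S then ‖ψ S‖ₑ ^ 2 else 0 := by
  have h : ‖ann p ψ‖ₑ = ‖cre p (ann p ψ)‖ₑ := by
    rw [← ofReal_norm, ← ofReal_norm, norm_cre_ann]
  rw [h, enorm_sq_eq_tsum]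
  refine tsum_congr fun S => ?_
  rw [cre_ann_apply]
  split_ifs <;> simp

/-- Tonelli in [0, ∞], valid also outside the form domain. It links forms defined on configurations
with annihilation operators. -/
theorem diagForm_sum {w : Mom → ℝ} (hw : ∀ p, 0 ≤ w p) (ψ : Fock) :
    diagForm (fun S => ∑ p ∈ S, w p) ψ = ∑' p, ENNReal.ofReal (w p) * ‖ann p ψ‖ₑ ^ 2 := by
  classical
  simp_rw [enorm_ann_sq, ← ENNReal.tsum_mul_left]
  rw [ENNReal.tsum_comm, diagForm]
  refine tsum_congr fun S => ?_
  rw [tsum_eq_sum (s := S) fun p hp => by rw [if_neg hp, mul_zero],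
    ENNReal.ofReal_sum_of_nonneg fun p _ => hw p, Finset.sum_mul]
  exact Finset.sum_congr rfl fun p hp => by rw [if_pos hp]

open Classical in
theorem ofReal_sum_norm_ann_sq (G : Finset Mom) (φ : Fock) :
    ENNReal.ofReal (∑ q ∈ G, ‖ann q φ‖ ^ 2) =
      diagForm (fun S => ∑ p ∈ S, if p ∈ G then 1 else 0) φ := by
  rw [diagForm_sum (fun p => by split_ifs <;> norm_num),
    tsum_eq_sum (s := G) fun p hp => by rw [if_neg hp, ENNReal.ofReal_zero, zero_mul],
    ENNReal.ofReal_sum_of_nonneg fun p _ => sq_nonneg _]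
  refine Finset.sum_congr rfl fun p hp => ?_
  rw [if_pos hp, ENNReal.ofReal_one, one_mul, enorm_sq_eq_ofReal]

open Classical in
theorem numΛ_apply (Λ : Finset Mom) (ψ : Fock) (S : Finset Mom) :
    numΛ Λ ψ S = ((Λ.filter (· ∈ S)).card : ℂ) * ψ S := by
  have h : numΛ Λ ψ = ∑ p ∈ Λ, cre p (ann p ψ) := by
    rw [numΛ, numOp, sum_apply]
    refine Finset.sum_congr rfl fun p _ => ?_
    rw [smul_apply, Complex.ofReal_one, one_smul]
    rfl
  rw [h, lp.coeFn_sum, Finset.sum_apply]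
  simp_rw [cre_ann_apply]
  rw [← Finset.sum_filter, Finset.sum_const, nsmul_eq_mul]

theorem rpow_half_sq (x : ℝ≥0∞) : (x ^ (1 / 2 : ℝ)) ^ 2 = x := by
  rw [← ENNReal.rpow_natCast, ← ENNReal.rpow_mul]
  norm_num

open Classical in
theorem sum_boole_le_gapNum {kF δ θ : ℝ} {G : Finset Mom}
    (hG : ∀ p ∈ G, θ * (numN kF : ℝ) ^ (-δ) < |‖vec p‖ - kF|) (S : Finset Mom) :
    (∑ p ∈ S, if p ∈ G then (1 : ℝ) else 0) ≤ gapNum kF δ θ S := by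
  rw [Finset.sum_boole]
  have h : S.filter (· ∈ G) ⊆ S.filter (fun p => θ * (numN kF : ℝ) ^ (-δ) < |‖vec p‖ - kF|) :=
    fun p hp => Finset.mem_filter.2 ⟨(Finset.mem_filter.1 hp).1, hG p (Finset.mem_filter.1 hp).2⟩
  exact Nat.cast_le.2 (Finset.card_le_card h)

theorem sum_norm_ann_sq_le_gapNorm {kF δ θ : ℝ} {G : Finset Mom}
    (hG : ∀ p ∈ G, θ * (numN kF : ℝ) ^ (-δ) < |‖vec p‖ - kF|) (ψ : Fock) :
    ENNReal.ofReal (∑ q ∈ G, ‖ann q ψ‖ ^ 2) ≤ gapNorm kF δ θ ψ ^ 2 := by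
  rw [ofReal_sum_norm_ann_sq, gapNorm, rpow_half_sq]
  exact ENNReal.tsum_le_tsum fun S =>
    mul_le_mul_left (ENNReal.ofReal_le_ofReal (sum_boole_le_gapNum hG S)) _

theorem sum_norm_ann_sq_le_gapNumNorm {kF δ θ : ℝ} {G : Finset Mom}
    (hG : ∀ p ∈ G, θ * (numN kF : ℝ) ^ (-δ) < |‖vec p‖ - kF|) (Λ : Finset Mom) (ψ : Fock) :
    ENNReal.ofReal (∑ q ∈ G, ‖ann q (numΛ Λ ψ)‖ ^ 2) ≤ gapNumNorm kF δ θ ψ ^ 2 := by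
  classical
  rw [ofReal_sum_norm_ann_sq, gapNumNorm, rpow_half_sq]
  refine ENNReal.tsum_le_tsum fun S => ?_
  have h1 := ENNReal.ofReal_le_ofReal (sum_boole_le_gapNum hG S)
  have h2 : ‖numΛ Λ ψ S‖ₑ ^ 2 ≤ ENNReal.ofReal ((S.card : ℝ) ^ 2) * ‖ψ S‖ₑ ^ 2 := by
    have h3 : ‖((Λ.filter (· ∈ S)).card : ℂ)‖ₑ ≤ ENNReal.ofReal (S.card : ℝ) := by
      rw [← ofReal_norm, Complex.norm_natCast]
      refine ENNReal.ofReal_le_ofReal ?_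
      exact_mod_cast Finset.card_le_card fun p hp => (Finset.mem_filter.1 hp).2
    rw [numΛ_apply, enorm_mul, mul_pow, ENNReal.ofReal_pow (Nat.cast_nonneg _)]
    gcongr
  have h0 : 0 ≤ gapNum kF δ θ S := Nat.cast_nonneg _
  rw [ENNReal.ofReal_mul h0, mul_assoc]
  exact mul_le_mul' h1 h2

theorem kinForm_eq (kF : ℝ) (ψ : Fock) :
    kinForm kF ψ = ∑' p, ENNReal.ofReal (disp kF p) * ‖ann p ψ‖ₑ ^ 2 :=
  diagForm_sum (fun _ => abs_nonneg _) ψ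

theorem tsum_eq_sum_add_tsum_ite {ι : Type*} [DecidableEq ι] (s : Finset ι) (f : ι → ℝ≥0∞) :
    ∑' i, f i = ∑ i ∈ s, f i + ∑' i, if i ∈ s then 0 else f i := by
  have h : ∑ i ∈ s, f i = ∑' i, if i ∈ s then f i else 0 := by
    rw [tsum_eq_sum (s := s) fun i hi => if_neg hi]
    exact Finset.sum_congr rfl fun i hi => (if_pos hi).symm
  rw [h, ← ENNReal.tsum_add]
  refine tsum_congr fun i => ?_
  split_ifs <;> simp

theorem disp_nonneg (kF : ℝ) (p : Mom) : 0 ≤ disp kF p := abs_nonneg _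

/-- If two vectors have the same occupation numbers outside a finite set of modes, their kinetic
energies differ by a bounded form. -/
theorem kinForm_sub {kF : ℝ} {Λ : Finset Mom} {φ ψ : Fock}
    (h : ∀ p ∉ Λ, ‖ann p φ‖ = ‖ann p ψ‖) (hψ : kinForm kF ψ < ⊤) :
    kinForm kF φ < ⊤ ∧ (kinForm kF φ).toReal - (kinForm kF ψ).toReal =
      (inner ℂ φ (numOp Λ (disp kF) φ)).re - (inner ℂ ψ (numOp Λ (disp kF) ψ)).re := by
  classical
  -- The tail of the kinetic energy outside Λ is the only part that could be infinite; it agrees for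
  -- φ and ψ and is finite for ψ, so it cancels.
  obtain ⟨T, hT⟩ : ∃ T : Fock → ℝ≥0∞, T = fun x => ∑' p, if p ∈ Λ then 0 else
    ENNReal.ofReal (disp kF p) * ‖ann p x‖ₑ ^ 2 := ⟨_, rfl⟩
  have hnn : ∀ x : Fock, 0 ≤ ∑ p ∈ Λ, disp kF p * ‖ann p x‖ ^ 2 := fun x =>
    Finset.sum_nonneg fun p _ => mul_nonneg (disp_nonneg kF p) (sq_nonneg _)
  have hsplit : ∀ x : Fock, kinForm kF x =
      ENNReal.ofReal (∑ p ∈ Λ, disp kF p * ‖ann p x‖ ^ 2) + T x := fun x => by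
    have e : ∑ p ∈ Λ, ENNReal.ofReal (disp kF p) * ‖ann p x‖ₑ ^ 2 =
        ENNReal.ofReal (∑ p ∈ Λ, disp kF p * ‖ann p x‖ ^ 2) := by
      rw [ENNReal.ofReal_sum_of_nonneg fun p _ => mul_nonneg (disp_nonneg kF p) (sq_nonneg _)]
      refine Finset.sum_congr rfl fun p _ => ?_
      rw [ENNReal.ofReal_mul (disp_nonneg kF p), enorm_sq_eq_ofReal]
    rw [kinForm_eq, ← e, hT, tsum_eq_sum_add_tsum_ite Λ]
  have hTT : T φ = T ψ := by
    rw [hT]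
    refine tsum_congr fun p => ?_
    by_cases hp : p ∈ Λ
    · rw [if_pos hp, if_pos hp]
    · rw [if_neg hp, if_neg hp, enorm_sq_eq_ofReal, enorm_sq_eq_ofReal, h p hp]
  have hfin : T ψ ≠ ⊤ := by
    rw [hsplit] at hψ
    exact (ENNReal.add_lt_top.1 hψ).2.ne
  constructor
  · rw [hsplit, hTT]
    exact ENNReal.add_lt_top.2 ⟨ENNReal.ofReal_lt_top, hfin.lt_top⟩
  · rw [hsplit, hsplit ψ, hTT, ENNReal.toReal_add ENNReal.ofReal_ne_top hfin,
      ENNReal.toReal_add ENNReal.ofReal_ne_top hfin, ENNReal.toReal_ofReal (hnn _),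
      ENNReal.toReal_ofReal (hnn _), re_inner_numOp, re_inner_numOp]
    ring

theorem hbar_pos {kF : ℝ} (h : 0 < kF) : 0 < hbar kF := numN_rpow_pos h _

namespace PatchDecomposition

variable {kF R c₀ : ℝ} {M : ℕ} (P : PatchDecomposition kF R c₀ M)

/-! ### The pair operators `c_α(k)` -/

/-- The index set `ℐ_k`. -/
abbrev II (δ : ℝ) (k : Mom) : Finset (Fin M) := P.Iplus δ k ∪ P.Iminus δ k

open Classical in
/-- The momentum transfer of `c_α(k)`. -/
def keff (δ : ℝ) (k : Mom) (α : Fin M) : Mom := if α ∈ P.Iplus δ k then k else -k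

theorem cop_eq {δ : ℝ} {k : Mom} {α : Fin M} (hα : α ∈ P.II δ k) :
    P.cop δ α k = P.bop α (P.keff δ k α) := by
  by_cases h : α ∈ P.Iplus δ k
  · rw [cop, keff, if_pos h, if_pos h]
  · have h' : α ∈ P.Iminus δ k := (Finset.mem_union.1 hα).resolve_left h
    rw [cop, keff, if_neg h, if_pos h', if_neg h]

theorem cop_eq_zero {δ : ℝ} {k : Mom} {α : Fin M} (hα : α ∉ P.II δ k) : P.cop δ α k = 0 := by
  rw [Finset.mem_union, not_or] at hα
  rw [cop, if_neg hα.1, if_neg hα.2]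

theorem norm_vec_keff (δ : ℝ) (k : Mom) (α : Fin M) : ‖vec (P.keff δ k α)‖ = ‖vec k‖ := by
  rw [keff]
  split_ifs
  · rfl
  · rw [vec_neg, norm_neg]

theorem kdot_keff (hkF : 0 < kF) {δ : ℝ} {k : Mom} {α : Fin M} (hα : α ∈ P.II δ k) :
    P.kdot (P.keff δ k α) α = |P.kdot k α| ∧ (numN kF : ℝ) ^ (-δ) ≤ |P.kdot k α| := by
  have hN := numN_rpow_pos hkF (-δ)
  by_cases h : α ∈ P.Iplus δ k
  · have h1 := P.mem_Iplus.1 h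
    rw [keff, if_pos h, abs_of_pos (hN.trans_le h1)]
    exact ⟨rfl, h1⟩
  · have h1 := P.mem_Iminus.1 ((Finset.mem_union.1 hα).resolve_left h)
    rw [keff, if_neg h, kdot_neg, abs_of_neg (by linarith)]
    exact ⟨rfl, by linarith⟩

/-- The restriction to a half space matters here: k = -l is impossible, so different k never give
the same pair operator on a patch of both index sets. -/
theorem keff_inj {δ : ℝ} {k l : Mom} (hk : k ∈ gammaNor R) (hl : l ∈ gammaNor R) (α : Fin M) :
    P.keff δ k α = P.keff δ l α ↔ k = l := by
  constructor
  · intro h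
    rw [keff, keff] at h
    split_ifs at h
    · exact h
    · exact absurd h (ne_neg_of_mem_gammaNor hk hl)
    · exact absurd h.symm (ne_neg_of_mem_gammaNor hl hk)
    · exact neg_injective h
  · rintro rfl
    rfl

theorem wide_keff {δ A : ℝ} (h : Regime kF R δ A M) (hA : 1 ≤ A) (hc : 1 ≤ c₀) {k : Mom}
    {α : Fin M} (hk : k ∈ gammaNor R) (hα : α ∈ P.II δ k) : P.Wide A (P.keff δ k α) α := by
  have h1 := P.kdot_keff h.kF_pos hα
  refine P.wide_of_regime h hA hc (fun h0 => ?_) ?_ (h1.1 ▸ h1.2)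
  · have h2 := P.norm_vec_keff δ k α
    rw [h0, vec_zero, norm_zero] at h2
    exact (norm_vec_pos (ne_zero_of_mem_gammaNor hk)).ne h2
  · rw [norm_vec_keff]
    exact (mem_gammaNor.1 hk).1.le

theorem lab_mem {δ : ℝ} {k : Mom} (s : P.Idx δ k) : P.lab s ∈ P.II δ k := by
  rw [Finset.mem_union]
  rcases s with α | α
  · exact Or.inl α.2
  · exact Or.inr (P.mirror_mem_Iminus α.2)

theorem lab_injective (hkF : 0 < kF) (δ : ℝ) (k : Mom) :
    Function.Injective (P.lab : P.Idx δ k → Fin M) := by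
  have h : ∀ α β : {α // α ∈ P.Iplus δ k}, α.1 ≠ P.mirror β.1 := fun α β e =>
    P.notMem_Iplus_of_mem_Iminus hkF (P.mirror_mem_Iminus β.2) (e ▸ α.2)
  rintro (α | α) (β | β) e
  · exact congrArg Sum.inl (Subtype.ext e)
  · exact absurd e (h α β)
  · exact absurd e.symm (h β α)
  · have : α.1 = β.1 := by
      rw [← P.mirror_mirror α.1, ← P.mirror_mirror β.1]
      exact congrArg P.mirror e
    exact congrArg Sum.inr (Subtype.ext this)

theorem sum_lab_le (hkF : 0 < kF) {δ : ℝ} {k : Mom} {f : Fin M → ℝ} (hf : ∀ α, 0 ≤ f α) :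
    ∑ s : P.Idx δ k, f (P.lab s) ≤ ∑ α ∈ P.II δ k, f α := by
  classical
  rw [← Finset.sum_image (f := f) (P.lab_injective hkF δ k).injOn]
  refine Finset.sum_le_sum_of_subset_of_nonneg ?_ fun α _ _ => hf α
  intro α hα
  obtain ⟨s, -, rfl⟩ := Finset.mem_image.1 hα
  exact P.lab_mem s

open Classical in
/-- The momenta that are counted by the gapped number operator. -/
def gapSet (kF R δ θ : ℝ) : Finset Mom :=
  (latticeBall (kF + R)).filter (fun p => θ * (numN kF : ℝ) ^ (-δ) < |‖vec p‖ - kF|)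

theorem lt_of_mem_gapSet {δ θ : ℝ} {p : Mom} (hp : p ∈ gapSet kF R δ θ) :
    θ * (numN kF : ℝ) ^ (-δ) < |‖vec p‖ - kF| := by
  unfold gapSet at hp
  exact (Finset.mem_filter.1 hp).2

/-- The norms of particle and hole differ by more than 2θN^{-δ} and lie on opposite sides of kF, so
one of them is further than θN^{-δ} from it. -/
theorem pair_mem_gapSet {δ A θ : ℝ} (h : Regime kF R δ A M) (hA : 1 ≤ A) (hc : 1 ≤ c₀)
    (hθ0 : 0 < θ) (hθ1 : θ < 1 / 2) (hAθ : 8 * c₀ < A * (2 - 4 * θ)) {k : Mom} {α : Fin M}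
    (hk : k ∈ gammaNor R) (hα : α ∈ P.II δ k) {p : Mom} (hp : p ∈ P.pairs α (P.keff δ k α)) :
    p ∈ gapSet kF R δ θ ∨ p - P.keff δ k α ∈ gapSet kF R δ θ := by
  have hg := (P.wide_keff h hA hc hk hα).gap hA hAθ hθ0.le hθ1.le hp
  obtain ⟨h1, h2⟩ := P.kdot_keff h.kF_pos hα
  rw [h1] at hg
  obtain ⟨hp1, hp2⟩ := P.pairs_subset (by linarith [h.one_le_R]) hp
  obtain ⟨⟨h3, -⟩, ⟨h4, -⟩⟩ := P.mem_pairs.1 hp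
  have h5 : θ * (numN kF : ℝ) ^ (-δ) ≤ θ * |P.kdot k α| := mul_le_mul_of_nonneg_left h2 hθ0.le
  by_cases hlt : θ * (numN kF : ℝ) ^ (-δ) < ‖vec p‖ - kF
  · left
    unfold gapSet
    refine Finset.mem_filter.2 ⟨hp1, ?_⟩
    rwa [abs_of_pos (by linarith)]
  · right
    unfold gapSet
    refine Finset.mem_filter.2 ⟨hp2, ?_⟩
    rw [abs_of_nonpos (by linarith)]
    linarith

/-- Weighted pair operators in the patches of `ℐ_k` are bounded by the gapped number operator. -/
theorem sum_norm_wbop_keff_sq_le {δ A θ : ℝ} (h : Regime kF R δ A M) (hA : 1 ≤ A) (hc : 1 ≤ c₀)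
    (hθ0 : 0 < θ) (hθ1 : θ < 1 / 2) (hAθ : 8 * c₀ < A * (2 - 4 * θ)) {k : Mom}
    (hk : k ∈ gammaNor R) (f : Fin M → Mom → ℝ) {F : ℝ}
    (hf : ∀ α ∈ P.II δ k, ∀ p ∈ P.pairs α (P.keff δ k α), |f α p| ≤ F) (φ : Fock) :
    ∑ α ∈ P.II δ k, ‖P.wbop α (P.keff δ k α) (f α) φ‖ ^ 2 ≤
      F ^ 2 * ∑ q ∈ gapSet kF R δ θ, ‖ann q φ‖ ^ 2 := by
  rw [← Finset.sum_coe_sort]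
  exact P.sum_norm_wbop_sq_le (by linarith [h.one_le_R]) (lab := fun α : P.II δ k => α.1)
    Subtype.val_injective (fun α => P.keff δ k α.1) (fun α => f α.1) (fun α => hf α.1 α.2) _
    (fun α p hp => P.pair_mem_gapSet h hA hc hθ0 hθ1 hAθ hk α.2 hp) φ

theorem sum_norm_cop_sq_le {δ A θ : ℝ} (h : Regime kF R δ A M) (hA : 1 ≤ A) (hc : 1 ≤ c₀)
    (hθ0 : 0 < θ) (hθ1 : θ < 1 / 2) (hAθ : 8 * c₀ < A * (2 - 4 * θ)) {k : Mom}
    (hk : k ∈ gammaNor R) (I : Finset (Fin M)) (φ : Fock) :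
    ∑ α ∈ I, ‖P.cop δ α k φ‖ ^ 2 ≤ ∑ q ∈ gapSet kF R δ θ, ‖ann q φ‖ ^ 2 := by
  have h1 := P.sum_norm_wbop_keff_sq_le h hA hc hθ0 hθ1 hAθ hk (fun _ _ => 1) (F := 1)
    (fun _ _ _ _ => by rw [abs_one]) φ
  rw [one_pow, one_mul] at h1
  refine le_trans ?_ h1
  have h2 : ∑ α ∈ P.II δ k, ‖P.wbop α (P.keff δ k α) (fun _ => 1) φ‖ ^ 2 =
      ∑ α ∈ P.II δ k, ‖P.cop δ α k φ‖ ^ 2 :=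
    Finset.sum_congr rfl fun α hα => by rw [wbop_one, P.cop_eq hα]
  rw [h2]
  have h3 : ∑ α ∈ P.II δ k, ‖P.cop δ α k φ‖ ^ 2 = ∑ α, ‖P.cop δ α k φ‖ ^ 2 :=
    Finset.sum_subset (Finset.subset_univ _) fun α _ hα => by
      rw [P.cop_eq_zero hα, zero_apply, norm_zero, zero_pow two_ne_zero]
  rw [h3]
  exact Finset.sum_le_sum_of_subset_of_nonneg (Finset.subset_univ _) fun _ _ _ => sq_nonneg _

/-! ### Commutators of the pair operators with diagonal operators and with `𝔻_B` -/

theorem numOp_mul_cop (hR : 0 ≤ R) (w : Mom → ℝ) {δ : ℝ} {k : Mom} {α : Fin M}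
    (hα : α ∈ P.II δ k) :
    numOp (latticeBall (kF + R)) w * P.cop δ α k =
      P.cop δ α k * numOp (latticeBall (kF + R)) w -
        P.wbop α (P.keff δ k α) (fun p => w p + w (p - P.keff δ k α)) := by
  rw [P.cop_eq hα, numOp_mul_bop P hR]

theorem numΛ_mul_cop (hR : 0 ≤ R) (δ : ℝ) (k : Mom) (α : Fin M) :
    numΛ (latticeBall (kF + R)) * P.cop δ α k =
      P.cop δ α k * numΛ (latticeBall (kF + R)) - ((2 : ℝ) : ℂ) • P.cop δ α k := by
  by_cases hα : α ∈ P.II δ k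
  · rw [P.numOp_mul_cop hR _ hα]
    congr 1
    rw [P.cop_eq hα, wbop, bop, ← Finset.smul_sum, smul_comm]
    norm_num
  · rw [P.cop_eq_zero hα]
    simp

/-- c𝒩φ = (𝒩 + 2)cφ, and 𝒩 ≥ 0 gives ‖(𝒩 + 2)y‖ ≥ ‖𝒩y‖. This moves 𝒩 from the error operators onto
the state. -/
theorem norm_numΛ_cop_le (hR : 0 ≤ R) (δ : ℝ) (k : Mom) (α : Fin M) (φ : Fock) :
    ‖numΛ (latticeBall (kF + R)) (P.cop δ α k φ)‖ ≤
      ‖P.cop δ α k (numΛ (latticeBall (kF + R)) φ)‖ := by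
  have h : P.cop δ α k (numΛ (latticeBall (kF + R)) φ) =
      numΛ (latticeBall (kF + R)) (P.cop δ α k φ) + ((2 : ℝ) : ℂ) • P.cop δ α k φ := by
    have := congrArg (fun A : Fock →L[ℂ] Fock => A φ) (P.numΛ_mul_cop hR δ k α)
    have e : numΛ (latticeBall (kF + R)) (P.cop δ α k φ) =
      P.cop δ α k (numΛ (latticeBall (kF + R)) φ) - ((2 : ℝ) : ℂ) • P.cop δ α k φ := this
    rw [e, sub_add_cancel]
  rw [h]
  generalize P.cop δ α k φ = y
  refine (sq_le_sq₀ (norm_nonneg _) (norm_nonneg _)).1 ?_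
  have h1 := re_inner_numOp (latticeBall (kF + R)) (fun _ => 1) y
  have h2 : 0 ≤ (inner ℂ y (numΛ (latticeBall (kF + R)) y)).re := by
    rw [h1]
    exact Finset.sum_nonneg fun p _ => by positivity
  have h3 := norm_add_sq (𝕜 := ℂ) (numΛ (latticeBall (kF + R)) y) (((2 : ℝ) : ℂ) • y)
  rw [inner_smul_right, inner_adj_left, star_numOp] at h3
  have h4 : RCLike.re (((2 : ℝ) : ℂ) *
      inner ℂ y (numΛ (latticeBall (kF + R)) y)) =
      2 * (inner ℂ y (numΛ (latticeBall (kF + R)) y)).re := by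
    simp
  rw [h4] at h3
  rw [h3]
  nlinarith [sq_nonneg ‖((2 : ℝ) : ℂ) • y‖]

theorem cop_mul_cop (δ : ℝ) (α β : Fin M) (k l : Mom) :
    P.cop δ α k * P.cop δ β l = P.cop δ β l * P.cop δ α k := by
  by_cases hα : α ∈ P.II δ k
  · by_cases hβ : β ∈ P.II δ l
    · rw [P.cop_eq hα, P.cop_eq hβ, bop_mul_bop]
    · rw [P.cop_eq_zero hβ, mul_zero, zero_mul]
  · rw [P.cop_eq_zero hα, mul_zero, zero_mul]

open Classical in
theorem cop_mul_star_cop {δ A : ℝ} (h : Regime kF R δ A M) (hA : 100 * c₀ ≤ A) (hc : 1 ≤ c₀)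
    {k l : Mom} {α β : Fin M} (hk : k ∈ gammaNor R) (hl : l ∈ gammaNor R) (hα : α ∈ P.II δ k)
    (hβ : β ∈ P.II δ l) :
    P.cop δ α k * star (P.cop δ β l) = star (P.cop δ β l) * P.cop δ α k +
      if β = α then (if k = l then 1 else 0) + P.errOp α (P.keff δ k α) (P.keff δ l α) else 0 := by
  rw [P.cop_eq hα, P.cop_eq hβ]
  by_cases hβα : β = α
  · subst hβα
    have hn : P.nrm β (P.keff δ k β) ≠ 0 := by
      have hw := P.wide_keff h (by linarith) hc hk hα
      refine (lt_of_lt_of_le ?_ (hw.le_nrm hA)).ne'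
      have h1 := hw.kF_pos
      have h2 : (0 : ℝ) < M := by exact_mod_cast hw.M_pos
      have h3 := norm_vec_pos hw.k_ne
      have h4 := hw.kdot_pos
      positivity
    rw [if_pos rfl, bop_mul_star_bop P hn]
    simp only [P.keff_inj hk hl]
  · rw [if_neg hβα, add_zero, P.bop_mul_star_bop_of_ne (by linarith [h.one_le_R]) (Ne.symm hβα)]

/-- The error terms in the commutator of `𝔻_B` with `c_α(k)`. -/
def errDB (δ : ℝ) (k : Mom) (α : Fin M) : Fock →L[ℂ] Fock :=
  ((2 * kappa kF * hbar kF : ℝ) : ℂ) • ∑ l ∈ gammaNor R,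
    ((|P.kdot l α| : ℝ) : ℂ) • (P.errOp α (P.keff δ k α) (P.keff δ l α) * P.cop δ α l)

/-- Only patch α contributes. The bosonic delta selects l = k and yields the linearized energy; the
deviations for all l form the error. -/
theorem DB_mul_cop {δ A : ℝ} (h : Regime kF R δ A M) (hA : 100 * c₀ ≤ A) (hc : 1 ≤ c₀)
    {k : Mom} {α : Fin M} (hk : k ∈ gammaNor R) (hα : α ∈ P.II δ k) :
    P.DB δ * P.cop δ α k = P.cop δ α k * P.DB δ -
      (((2 * kappa kF * hbar kF * |P.kdot k α| : ℝ) : ℂ) • P.cop δ α k + P.errDB δ k α) := by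
  classical
  have h1 : ∀ l ∈ gammaNor R, ∀ β ∈ P.II δ l,
      star (P.cop δ β l) * P.cop δ β l * P.cop δ α k =
        P.cop δ α k * (star (P.cop δ β l) * P.cop δ β l) -
          if β = α then ((if k = l then 1 else 0) +
            P.errOp α (P.keff δ k α) (P.keff δ l α)) * P.cop δ α l else 0 := by
    intro l hl β hβ
    rw [mul_assoc, P.cop_mul_cop δ β α, ← mul_assoc, ← mul_assoc,
      P.cop_mul_star_cop h hA hc hk hl hα hβ, add_mul, ite_mul, zero_mul]
    by_cases hβα : β = α
    · subst hβα
      rw [if_pos rfl, add_sub_cancel_right]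
    · rw [if_neg hβα, if_neg hβα, add_zero, sub_zero]
  have h2 : ∀ l ∈ gammaNor R,
      (∑ β ∈ P.II δ l, ((|P.kdot l β| : ℝ) : ℂ) • (star (P.cop δ β l) * P.cop δ β l)) *
          P.cop δ α k =
        P.cop δ α k *
          (∑ β ∈ P.II δ l, ((|P.kdot l β| : ℝ) : ℂ) • (star (P.cop δ β l) * P.cop δ β l)) -
        ((if k = l then ((|P.kdot l α| : ℝ) : ℂ) • P.cop δ α l else 0) + ((|P.kdot l α| : ℝ) : ℂ) •
          (P.errOp α (P.keff δ k α) (P.keff δ l α) * P.cop δ α l)) := by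
    intro l hl
    have h3 : ∑ β ∈ P.II δ l, ((|P.kdot l β| : ℝ) : ℂ) •
        (if β = α then ((if k = l then 1 else 0) +
            P.errOp α (P.keff δ k α) (P.keff δ l α)) * P.cop δ α l else 0) =
        (if k = l then ((|P.kdot l α| : ℝ) : ℂ) • P.cop δ α l else 0) + ((|P.kdot l α| : ℝ) : ℂ) •
          (P.errOp α (P.keff δ k α) (P.keff δ l α) * P.cop δ α l) := by
      simp_rw [smul_ite, smul_zero]
      rw [Finset.sum_ite_eq']
      by_cases hl' : α ∈ P.II δ l
      · rw [if_pos hl', add_mul, smul_add, ite_mul, one_mul, zero_mul, smul_ite, smul_zero]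
      · rw [if_neg hl', P.cop_eq_zero hl']
        simp
    rw [← h3, Finset.sum_mul, Finset.mul_sum, ← Finset.sum_sub_distrib]
    refine Finset.sum_congr rfl fun β hβ => ?_
    rw [smul_mul_assoc, h1 l hl β hβ, smul_sub, mul_smul_comm]
  have h4 : P.DB δ = ((2 * kappa kF * hbar kF : ℝ) : ℂ) • ∑ l ∈ gammaNor R,
      ∑ β ∈ P.II δ l, ((|P.kdot l β| : ℝ) : ℂ) • (star (P.cop δ β l) * P.cop δ β l) := rfl
  have h5 : ∑ l ∈ gammaNor R, (if k = l then ((|P.kdot l α| : ℝ) : ℂ) • P.cop δ α l else 0) =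
      ((|P.kdot k α| : ℝ) : ℂ) • P.cop δ α k := by
    rw [Finset.sum_ite_eq, if_pos hk]
  rw [h4, smul_mul_assoc, Finset.sum_mul, Finset.sum_congr rfl h2, Finset.sum_sub_distrib,
    ← Finset.mul_sum, Finset.sum_add_distrib, h5, smul_sub, smul_add, mul_smul_comm, errDB,
    smul_smul, ← Complex.ofReal_mul]

theorem star_DB (δ : ℝ) : star (P.DB δ) = P.DB δ := by
  have h4 : P.DB δ = ((2 * kappa kF * hbar kF : ℝ) : ℂ) • ∑ l ∈ gammaNor R,
      ∑ β ∈ P.II δ l, ((|P.kdot l β| : ℝ) : ℂ) • (star (P.cop δ β l) * P.cop δ β l) := rfl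
  have h5 : ∀ (x : ℝ) (A : Fock →L[ℂ] Fock), star ((x : ℂ) • A) = (x : ℂ) • star A := fun x A => by
    rw [star_smul]
    congr 1
    exact Complex.conj_ofReal x
  rw [h4, h5, star_sum]
  simp_rw [star_sum, h5, star_mul, star_star]

/-- The bounded part of `ℍ₀ - 𝔻_B`. -/
def diffOp (δ : ℝ) : Fock →L[ℂ] Fock := numOp (latticeBall (kF + R)) (disp kF) - P.DB δ

theorem star_diffOp (δ : ℝ) : star (P.diffOp δ) = P.diffOp δ := by
  rw [diffOp, star_sub, star_numOp, star_DB]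

/-- The commutator of `c_α(k)` with `ℍ₀ - 𝔻_B`. -/
def resid (δ : ℝ) (k : Mom) (α : Fin M) : Fock →L[ℂ] Fock :=
  P.wbop α (P.keff δ k α) (fun p => disp kF p + disp kF (p - P.keff δ k α) -
    2 * kappa kF * hbar kF * |P.kdot k α|) - P.errDB δ k α

theorem diffOp_mul_cop {δ A : ℝ} (h : Regime kF R δ A M) (hA : 100 * c₀ ≤ A) (hc : 1 ≤ c₀)
    {k : Mom} {α : Fin M} (hk : k ∈ gammaNor R) (hα : α ∈ P.II δ k) :
    P.diffOp δ * P.cop δ α k = P.cop δ α k * P.diffOp δ - P.resid δ k α := by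
  rw [diffOp, sub_mul, P.numOp_mul_cop (by linarith [h.one_le_R]) _ hα,
    P.DB_mul_cop h hA hc hk hα, resid, wbop_sub_const, ← P.cop_eq hα, mul_sub]
  abel

end PatchDecomposition

theorem hbar_mul_kF_le {kF R δ A : ℝ} {M : ℕ} (h : Regime kF R δ A M) : hbar kF * kF ≤ 2 := by
  have h0 : 0 < (numN kF : ℝ) ^ (1 / 3 : ℝ) := numN_rpow_pos h.kF_pos _
  rw [hbar_eq, inv_mul_le_iff₀ h0, mul_comm]
  exact h.kF_le

theorem inv_kF_le {kF R δ A : ℝ} {M : ℕ} (h : Regime kF R δ A M) : kF⁻¹ ≤ 3 * hbar kF := by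
  have h0 : 0 < (numN kF : ℝ) ^ (1 / 3 : ℝ) := numN_rpow_pos h.kF_pos _
  rw [hbar_eq, inv_le_iff_one_le_mul₀' h.kF_pos, ← mul_assoc, ← div_eq_mul_inv, le_div_iff₀ h0]
  linarith [h.third_le]

theorem sqrt_two_sq_add_two_sq_le {a b g g' : ℝ} (ha : 0 ≤ a) (hb : 0 ≤ b) (hg : 0 ≤ g)
    (hg' : 0 ≤ g') : √(2 * (a ^ 2 * g) + 2 * (b ^ 2 * g')) ≤ 2 * (a * √g + b * √g') := by
  have h1 := Real.sqrt_nonneg g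
  have h2 := Real.sqrt_nonneg g'
  rw [Real.sqrt_le_left (by positivity)]
  have e1 := Real.sq_sqrt hg
  have e2 := Real.sq_sqrt hg'
  have e3 : 0 ≤ a * √g * (b * √g') := by positivity
  have e4 : (a * √g) ^ 2 = a ^ 2 * g := by rw [mul_pow, e1]
  have e5 : (b * √g') ^ 2 = b ^ 2 * g' := by rw [mul_pow, e2]
  nlinarith [sq_nonneg (a * √g), sq_nonneg (b * √g')]

namespace PatchDecomposition

variable {kF R c₀ : ℝ} {M : ℕ} (P : PatchDecomposition kF R c₀ M)

/-! ### Bounds on the commutator with `ℍ₀ - 𝔻_B` -/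

/-- Particle and hole lie on opposite sides of the Fermi sphere, so the absolute values open with
opposite signs and κ² cancels, leaving ħ² times the linearized difference. The 14 is 7 times the
bound 2 on ħkF. -/
theorem abs_weight_le {δ A : ℝ} (h : Regime kF R δ A M) (hA : 1 ≤ A) (hc : 1 ≤ c₀) {k : Mom}
    {α : Fin M} (hk : k ∈ gammaNor R) (hα : α ∈ P.II δ k) {p : Mom}
    (hp : p ∈ P.pairs α (P.keff δ k α)) :
    |disp kF p + disp kF (p - P.keff δ k α) - 2 * kappa kF * hbar kF * (|P.kdot k α|)| ≤
      14 * c₀ * hbar kF * ‖vec k‖ / √(M : ℝ) := by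
  have hw := P.wide_keff h hA hc hk hα
  obtain ⟨⟨h1, hin⟩, ⟨h2, -⟩⟩ := P.mem_pairs.1 hp
  have hl := hw.linearization hA hin
  have hkF := h.kF_pos
  have hh := hbar_pos hkF
  rw [(P.kdot_keff hkF hα).1, P.norm_vec_keff] at hl
  have hd1 : disp kF p = hbar kF ^ 2 * ‖vec p‖ ^ 2 - kappa kF ^ 2 := by
    rw [disp, abs_of_nonneg]
    rw [kappa, mul_pow, mul_comm, ← sub_mul]
    exact mul_nonneg (sub_nonneg.2 (pow_le_pow_left₀ hkF.le h1.le 2)) (sq_nonneg _)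
  have hd2 : disp kF (p - P.keff δ k α) =
      kappa kF ^ 2 - hbar kF ^ 2 * ‖vec (p - P.keff δ k α)‖ ^ 2 := by
    rw [disp, abs_of_nonpos, neg_sub]
    rw [kappa, mul_pow, mul_comm, ← sub_mul]
    exact mul_nonpos_of_nonpos_of_nonneg
      (sub_nonpos.2 (pow_le_pow_left₀ (norm_nonneg _) h2 2)) (sq_nonneg _)
  have e : disp kF p + disp kF (p - P.keff δ k α) - 2 * kappa kF * hbar kF * |P.kdot k α| =
      hbar kF ^ 2 * (‖vec p‖ ^ 2 - ‖vec (p - P.keff δ k α)‖ ^ 2 - 2 * kF * |P.kdot k α|) := by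
    rw [hd1, hd2, kappa]
    ring
  rw [e, abs_mul, abs_of_pos (by positivity)]
  refine (mul_le_mul_of_nonneg_left hl (by positivity)).trans ?_
  calc hbar kF ^ 2 * (7 * c₀ * (kF / √(M : ℝ)) * ‖vec k‖)
      = 7 * c₀ * hbar kF * ‖vec k‖ / √(M : ℝ) * (hbar kF * kF) := by ring
    _ ≤ 7 * c₀ * hbar kF * ‖vec k‖ / √(M : ℝ) * 2 := by
        refine mul_le_mul_of_nonneg_left (hbar_mul_kF_le h) ?_
        have : 0 ≤ c₀ := by linarith
        positivity
    _ = _ := by ring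

/-- Insert the lower bounds on n_α: |l·ω̂_α| cancels, and what is left, |l|/|k·ω̂_α| ≤ N^δ R, is
absorbed by one factor √M of the scaling regime. Thus the power M^{3/2} arises without N^δ; 9216 =
96². -/
theorem kdot_mul_inv_nrm_le {δ A : ℝ} (h : Regime kF R δ A M) (hA : 100 * c₀ ≤ A) (hc : 1 ≤ c₀)
    {k l : Mom} {α : Fin M} (hk : k ∈ gammaNor R) (hl : l ∈ gammaNor R) (hα : α ∈ P.II δ k)
    (hα' : α ∈ P.II δ l) :
    |P.kdot l α| * ((P.nrm α (P.keff δ k α))⁻¹ * (P.nrm α (P.keff δ l α))⁻¹) ≤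
      9216 * c₀ ^ 2 * M * √(M : ℝ) * ‖vec k‖ * kF⁻¹ ^ 2 := by
  have hkF := h.kF_pos
  have hc0 : 0 < c₀ := by linarith
  have hM : (0 : ℝ) < M := by exact_mod_cast h.M_pos
  have hm : 0 < √(M : ℝ) := Real.sqrt_pos.2 hM
  have h1 := (P.wide_keff h (by linarith) hc hk hα).le_nrm hA
  have h2 := (P.wide_keff h (by linarith) hc hl hα').le_nrm hA
  obtain ⟨e1, f1⟩ := P.kdot_keff hkF hα
  obtain ⟨e2, f2⟩ := P.kdot_keff hkF hα'
  rw [e1, P.norm_vec_keff] at h1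
  rw [e2, P.norm_vec_keff] at h2
  have hN := numN_rpow_pos hkF (-δ)
  have hdk : 0 < |P.kdot k α| := hN.trans_le f1
  have hdl : 0 < |P.kdot l α| := hN.trans_le f2
  have hvk := norm_vec_pos (ne_zero_of_mem_gammaNor hk)
  have hvl := norm_vec_pos (ne_zero_of_mem_gammaNor hl)
  have hlR := (mem_gammaNor.1 hl).1.le
  have i1 := inv_anti₀ (by positivity) h1
  have i2 := inv_anti₀ (by positivity) h2
  have hdk' : |P.kdot k α|⁻¹ ≤ (numN kF : ℝ) ^ δ := by
    rw [← inv_inv ((numN kF : ℝ) ^ δ), ← Real.rpow_neg (Nat.cast_nonneg _)]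
    exact inv_anti₀ hN f1
  have hRD : (numN kF : ℝ) ^ δ * R ≤ √(M : ℝ) := by
    have h3 : 0 ≤ (numN kF : ℝ) ^ δ * R := by
      have := h.one_le_D
      have := h.one_le_R
      positivity
    exact (le_mul_of_one_le_left h3 (by linarith)).trans h.le_sqrt
  calc |P.kdot l α| * ((P.nrm α (P.keff δ k α))⁻¹ * (P.nrm α (P.keff δ l α))⁻¹)
      ≤ |P.kdot l α| * ((kF / √(M : ℝ) * (|P.kdot k α| / ‖vec k‖) / (96 * c₀))⁻¹ *
        (kF / √(M : ℝ) * (|P.kdot l α| / ‖vec l‖) / (96 * c₀))⁻¹) := by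
        refine mul_le_mul_of_nonneg_left (mul_le_mul i1 i2 ?_ ?_) hdl.le
        · exact inv_nonneg.2 (Real.sqrt_nonneg _)
        · positivity
    _ = 9216 * c₀ ^ 2 * √(M : ℝ) ^ 2 * ‖vec k‖ * kF⁻¹ ^ 2 * (|P.kdot k α|⁻¹ * ‖vec l‖) := by
        field_simp
        norm_num
    _ ≤ 9216 * c₀ ^ 2 * √(M : ℝ) ^ 2 * ‖vec k‖ * kF⁻¹ ^ 2 * √(M : ℝ) := by
        refine mul_le_mul_of_nonneg_left ?_ (by positivity)
        exact (mul_le_mul hdk' hlR hvl.le (by positivity)).trans hRD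
    _ = _ := by
        rw [Real.sq_sqrt hM.le]
        ring

theorem norm_errOp_cop_le {δ A : ℝ} (h : Regime kF R δ A M) (hA : 100 * c₀ ≤ A) (hc : 1 ≤ c₀)
    {k l : Mom} {α : Fin M} (hk : k ∈ gammaNor R) (hl : l ∈ gammaNor R) (hα : α ∈ P.II δ k)
    (φ : Fock) :
    2 * kappa kF * hbar kF *
        (|P.kdot l α| * ‖P.errOp α (P.keff δ k α) (P.keff δ l α) (P.cop δ α l φ)‖) ≤
      110592 * c₀ ^ 2 * hbar kF ^ 3 * (M * √(M : ℝ)) * ‖vec k‖ *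
        ‖P.cop δ α l (numΛ (latticeBall (kF + R)) φ)‖ := by
  have hR : 0 ≤ R := by linarith [h.one_le_R]
  have hkF := h.kF_pos
  have hh := hbar_pos hkF
  by_cases hα' : α ∈ P.II δ l
  · have h1 := P.norm_errOp_apply_le hR α (P.keff δ k α) (P.keff δ l α) (P.cop δ α l φ)
    have h2 := P.norm_numΛ_cop_le hR δ l α φ
    have h3 := P.kdot_mul_inv_nrm_le h hA hc hk hl hα hα'
    have hn : 0 ≤ (P.nrm α (P.keff δ k α))⁻¹ * (P.nrm α (P.keff δ l α))⁻¹ :=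
      mul_nonneg (inv_nonneg.2 (Real.sqrt_nonneg _)) (inv_nonneg.2 (Real.sqrt_nonneg _))
    have h4 := h1.trans (mul_le_mul_of_nonneg_left h2 (by positivity))
    set y := ‖P.cop δ α l (numΛ (latticeBall (kF + R)) φ)‖ with hy
    have hy0 : 0 ≤ y := norm_nonneg _
    have hκ : 0 ≤ 2 * kappa kF * hbar kF := by rw [kappa]; positivity
    refine (mul_le_mul_of_nonneg_left (mul_le_mul_of_nonneg_left h4 (abs_nonneg _)) hκ).trans ?_
    calc 2 * kappa kF * hbar kF * (|P.kdot l α| *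
          (2 * ((P.nrm α (P.keff δ k α))⁻¹ * (P.nrm α (P.keff δ l α))⁻¹) * y))
        = 4 * kF * hbar kF ^ 2 * y * (|P.kdot l α| *
          ((P.nrm α (P.keff δ k α))⁻¹ * (P.nrm α (P.keff δ l α))⁻¹)) := by
          rw [kappa]
          ring
      _ ≤ 4 * kF * hbar kF ^ 2 * y * (9216 * c₀ ^ 2 * M * √(M : ℝ) * ‖vec k‖ * kF⁻¹ ^ 2) :=
          mul_le_mul_of_nonneg_left h3 (by positivity)
      _ = 36864 * c₀ ^ 2 * hbar kF ^ 2 * (M * √(M : ℝ)) * ‖vec k‖ * y * kF⁻¹ := by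
          field_simp
          ring
      _ ≤ 36864 * c₀ ^ 2 * hbar kF ^ 2 * (M * √(M : ℝ)) * ‖vec k‖ * y * (3 * hbar kF) :=
          mul_le_mul_of_nonneg_left (inv_kF_le h) (by positivity)
      _ = _ := by ring
  · rw [P.cop_eq_zero hα']
    simp

/-- Cauchy–Schwarz in l costs one factor of the cardinality of Γ^nor, and summing the bound on ∑_α
‖c_α(l)𝒩φ‖² over l costs another. After the square root this is the factor 27R³. -/
theorem sum_norm_errDB_sq_le {δ A θ : ℝ} (h : Regime kF R δ A M) (hA : 100 * c₀ ≤ A)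
    (hc : 1 ≤ c₀) (hθ0 : 0 < θ) (hθ1 : θ < 1 / 2) (hAθ : 8 * c₀ < A * (2 - 4 * θ)) {k : Mom}
    (hk : k ∈ gammaNor R) (φ : Fock) :
    ∑ α ∈ P.II δ k, ‖P.errDB δ k α φ‖ ^ 2 ≤
      (2985984 * c₀ ^ 2 * hbar kF ^ 3 * R ^ 3 * (M * √(M : ℝ)) * ‖vec k‖) ^ 2 *
        ∑ q ∈ gapSet kF R δ θ, ‖ann q (numΛ (latticeBall (kF + R)) φ)‖ ^ 2 := by
  have hkF := h.kF_pos
  have hh := hbar_pos hkF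
  have hR := h.one_le_R
  have hκ : 0 ≤ 2 * kappa kF * hbar kF := by rw [kappa]; positivity
  set K := 110592 * c₀ ^ 2 * hbar kF ^ 3 * (M * √(M : ℝ)) * ‖vec k‖ with hK
  have hK0 : 0 ≤ K := by positivity
  set φ' := numΛ (latticeBall (kF + R)) φ with hφ'
  set g' := ∑ q ∈ gapSet kF R δ θ, ‖ann q φ'‖ ^ 2 with hg'
  have hg'0 : 0 ≤ g' := Finset.sum_nonneg fun _ _ => sq_nonneg _
  have h1 : ∀ α ∈ P.II δ k, ‖P.errDB δ k α φ‖ ^ 2 ≤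
      (gammaNor R).card * ∑ l ∈ gammaNor R, (K * ‖P.cop δ α l φ'‖) ^ 2 := by
    intro α hα
    have h2 : ‖P.errDB δ k α φ‖ ≤ ∑ l ∈ gammaNor R, K * ‖P.cop δ α l φ'‖ := by
      rw [errDB, smul_apply, norm_smul, Complex.norm_real, Real.norm_eq_abs, abs_of_nonneg hκ,
        sum_apply]
      refine (mul_le_mul_of_nonneg_left (norm_sum_le _ _) hκ).trans ?_
      rw [Finset.mul_sum]
      refine Finset.sum_le_sum fun l hl => ?_
      rw [smul_apply, norm_smul, Complex.norm_real, Real.norm_eq_abs, abs_abs]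
      exact P.norm_errOp_cop_le h hA hc hk hl hα φ
    exact (pow_le_pow_left₀ (norm_nonneg _) h2 2).trans sq_sum_le_card_mul_sum_sq
  refine (Finset.sum_le_sum h1).trans ?_
  rw [← Finset.mul_sum, Finset.sum_comm]
  have h3 : ∀ l ∈ gammaNor R, ∑ α ∈ P.II δ k, (K * ‖P.cop δ α l φ'‖) ^ 2 ≤ K ^ 2 * g' := by
    intro l hl
    simp_rw [mul_pow]
    rw [← Finset.mul_sum]
    exact mul_le_mul_of_nonneg_left
      (P.sum_norm_cop_sq_le h (by linarith) hc hθ0 hθ1 hAθ hl _ _) (sq_nonneg _)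
  have h4 := Finset.sum_le_sum h3
  rw [Finset.sum_const, nsmul_eq_mul] at h4
  have hcard := card_gammaNor_le hR
  have hc0 : (0 : ℝ) ≤ (gammaNor R).card := Nat.cast_nonneg _
  calc _ ≤ ((gammaNor R).card : ℝ) * ((gammaNor R).card * (K ^ 2 * g')) :=
        mul_le_mul_of_nonneg_left h4 hc0
    _ = ((gammaNor R).card : ℝ) ^ 2 * (K ^ 2 * g') := by ring
    _ ≤ (27 * R ^ 3) ^ 2 * (K ^ 2 * g') :=
        mul_le_mul_of_nonneg_right (pow_le_pow_left₀ hc0 hcard 2) (by positivity)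
    _ = _ := by
        rw [hK]
        ring

theorem sqrt_sum_norm_resid_sq_le {δ A θ : ℝ} (h : Regime kF R δ A M) (hA : 100 * c₀ ≤ A)
    (hc : 1 ≤ c₀) (hθ0 : 0 < θ) (hθ1 : θ < 1 / 2) (hAθ : 8 * c₀ < A * (2 - 4 * θ)) {k : Mom}
    (hk : k ∈ gammaNor R) (φ : Fock) :
    √(∑ s : P.Idx δ k, ‖P.resid δ k (P.lab s) φ‖ ^ 2) ≤
      2 * (14 * c₀ * hbar kF * ‖vec k‖ / √(M : ℝ) * √(∑ q ∈ gapSet kF R δ θ, ‖ann q φ‖ ^ 2) +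
      2985984 * c₀ ^ 2 * hbar kF ^ 3 * R ^ 3 * (M * √(M : ℝ)) * ‖vec k‖ *
        √(∑ q ∈ gapSet kF R δ θ, ‖ann q (numΛ (latticeBall (kF + R)) φ)‖ ^ 2)) := by
  have hkF := h.kF_pos
  have hh := hbar_pos hkF
  have hR := h.one_le_R
  have hA1 : 1 ≤ A := by linarith
  have h1 := P.sum_norm_wbop_keff_sq_le h hA1 hc hθ0 hθ1 hAθ hk
    (fun α p => disp kF p + disp kF (p - P.keff δ k α) - 2 * kappa kF * hbar kF * |P.kdot k α|)
    (fun α hα p hp => P.abs_weight_le h hA1 hc hk hα hp) φ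
  have h2 := P.sum_norm_errDB_sq_le h hA hc hθ0 hθ1 hAθ hk φ
  refine le_trans (Real.sqrt_le_sqrt ?_) (sqrt_two_sq_add_two_sq_le (by positivity)
    (by positivity) (Finset.sum_nonneg fun _ _ => sq_nonneg _)
    (Finset.sum_nonneg fun _ _ => sq_nonneg _))
  refine (P.sum_lab_le hkF (f := fun α => ‖P.resid δ k α φ‖ ^ 2) fun α => sq_nonneg _).trans ?_
  have h3 : ∀ x y : Fock, ‖x - y‖ ^ 2 ≤ 2 * ‖x‖ ^ 2 + 2 * ‖y‖ ^ 2 := fun x y => by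
    have := pow_le_pow_left₀ (norm_nonneg _) (norm_sub_le x y) 2
    nlinarith [sq_nonneg (‖x‖ - ‖y‖)]
  have h4 : ∀ α ∈ P.II δ k, ‖P.resid δ k α φ‖ ^ 2 ≤
      2 * ‖P.wbop α (P.keff δ k α) (fun p => disp kF p + disp kF (p - P.keff δ k α) -
        2 * kappa kF * hbar kF * |P.kdot k α|) φ‖ ^ 2 + 2 * ‖P.errDB δ k α φ‖ ^ 2 := fun α _ => by
    rw [resid, sub_apply]
    exact h3 _ _
  refine (Finset.sum_le_sum h4).trans ?_
  rw [Finset.sum_add_distrib, ← Finset.mul_sum, ← Finset.mul_sum]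
  linarith

end PatchDecomposition

namespace PatchDecomposition

variable {kF R c₀ : ℝ} {M : ℕ} (P : PatchDecomposition kF R c₀ M)

/-! ### Modes far from the Fermi surface -/

theorem commute_ann_pair {p q r : Mom} : Commute (ann p) (ann q * ann r) := by
  rw [commute_iff_eq, ← mul_assoc, ann_anticomm p q, neg_mul, mul_assoc, ann_anticomm p r, mul_neg,
    neg_neg, mul_assoc]

theorem commute_ann_star_pair {p q r : Mom} (hq : p ≠ q) (hr : p ≠ r) :
    Commute (ann p) (star (ann q * ann r)) := by
  rw [star_mul, star_ann, star_ann, commute_iff_eq, ← mul_assoc, ann_cre_of_ne hr, neg_mul,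
    mul_assoc, ann_cre_of_ne hq, mul_neg, neg_neg, mul_assoc]

theorem commute_ann_cop (δ : ℝ) (k : Mom) (α : Fin M) (p : Mom) :
    Commute (ann p) (P.cop δ α k) := by
  by_cases hα : α ∈ P.II δ k
  · rw [P.cop_eq hα, bop]
    exact (Commute.sum_right _ _ _ fun q _ => commute_ann_pair).smul_right _
  · rw [P.cop_eq_zero hα]
    exact Commute.zero_right _

theorem commute_ann_star_cop (hR : 0 ≤ R) (δ : ℝ) (k : Mom) (α : Fin M) {p : Mom}
    (hp : p ∉ latticeBall (kF + R)) : Commute (ann p) (star (P.cop δ α k)) := by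
  by_cases hα : α ∈ P.II δ k
  · rw [P.cop_eq hα, star_bop]
    refine (Commute.sum_right _ _ _ fun q hq => ?_).smul_right _
    obtain ⟨h1, h2⟩ := P.pairs_subset hR hq
    exact commute_ann_star_pair (fun e => hp (e ▸ h2)) (fun e => hp (e ▸ h1))
  · rw [P.cop_eq_zero hα, star_zero]
    exact Commute.zero_right _

/-! ### The generator of `Z` -/

/-- The exponent in the definition of `Z`. -/
def genZ (lg : ℂ → ℂ) (Vhat : Mom → ℝ) (δ : ℝ) : Fock →L[ℂ] Fock :=
  ∑ k ∈ gammaNor R, quadOp (P.matL lg Vhat δ k) (fun s => P.cop δ (P.lab s) k)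

theorem Z_apply (lg : ℂ → ℂ) (Vhat : Mom → ℝ) (δ : ℝ) (ψ : Fock) :
    P.Z lg Vhat δ ψ = flow (P.genZ lg Vhat δ) ψ 1 := by
  rw [flow_one]
  rfl

theorem star_genZ (hkF : 0 < kF) {lg : ℂ → ℂ} (hlg : IsLogBranch lg) {Vhat : Mom → ℝ}
    (hV : ∀ k, 0 ≤ Vhat k) (δ : ℝ) : star (P.genZ lg Vhat δ) = - P.genZ lg Vhat δ := by
  rw [genZ, star_sum, ← Finset.sum_neg_distrib]
  exact Finset.sum_congr rfl fun k hk =>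
    star_quadOp (P.star_matL hkF hlg δ (ne_zero_of_mem_gammaNor hk) (hV k)) _

theorem commute_ann_genZ (hR : 0 ≤ R) (lg : ℂ → ℂ) (Vhat : Mom → ℝ) (δ : ℝ) {p : Mom}
    (hp : p ∉ latticeBall (kF + R)) : Commute (ann p) (P.genZ lg Vhat δ) :=
  Commute.sum_right _ _ _ fun k _ => commute_quadOp _ (fun _ => P.commute_ann_cop δ k _ p)
    fun _ => P.commute_ann_star_cop hR δ k _ hp

theorem commute_numΛ_genZ (hR : 0 ≤ R) (lg : ℂ → ℂ) (Vhat : Mom → ℝ) (δ : ℝ) :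
    Commute (numΛ (latticeBall (kF + R))) (P.genZ lg Vhat δ) :=
  Commute.sum_right _ _ _ fun k _ => commute_quadOp_of_shift _ (star_numOp _ _) 2
    fun _ => P.numΛ_mul_cop hR δ k _

theorem abs_re_inner_comm_genZ_le (lg : ℂ → ℂ) (Vhat : Mom → ℝ) (δ : ℝ) {X : Fock →L[ℂ] Fock}
    (hX : star X = X) {r : Mom → Fin M → Fock →L[ℂ] Fock}
    (h : ∀ k ∈ gammaNor R, ∀ α ∈ P.II δ k, X * P.cop δ α k = P.cop δ α k * X - r k α) (φ : Fock) :
    |(inner ℂ φ ((X * P.genZ lg Vhat δ - P.genZ lg Vhat δ * X) φ)).re| ≤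
      ∑ k ∈ gammaNor R, 2 * (hs (P.matL lg Vhat δ k) * √(∑ s : P.Idx δ k, ‖r k (P.lab s) φ‖ ^ 2) *
        √(∑ s : P.Idx δ k, ‖P.cop δ (P.lab s) k φ‖ ^ 2)) := by
  refine (Complex.abs_re_le_norm _).trans ?_
  rw [genZ, Finset.mul_sum, Finset.sum_mul, ← Finset.sum_sub_distrib, sum_apply, inner_sum]
  refine (norm_sum_le _ _).trans (Finset.sum_le_sum fun k hk => ?_)
  exact norm_inner_comm_quadOp_le _ hX (r := fun s => r k (P.lab s))
    (fun s => h k hk _ (P.lab_mem s)) φ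

open Classical in
/-- The gapped number operator of the modes in the shell that contains the patches. -/
def gapOp (kF R δ θ : ℝ) : Fock →L[ℂ] Fock :=
  numOp (latticeBall (kF + R)) (fun p => if p ∈ gapSet kF R δ θ then 1 else 0)

theorem re_inner_gapOp (kF R δ θ : ℝ) (φ : Fock) :
    (inner ℂ φ (gapOp kF R δ θ φ)).re = ∑ q ∈ gapSet kF R δ θ, ‖ann q φ‖ ^ 2 := by
  classical
  rw [gapOp, re_inner_numOp]
  simp_rw [ite_mul, one_mul, zero_mul]
  rw [← Finset.sum_filter]
  refine Finset.sum_congr ?_ fun _ _ => rfl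
  ext p
  rw [Finset.mem_filter, and_iff_right_iff_imp]
  intro hp
  unfold gapSet at hp
  exact (Finset.mem_filter.1 hp).1

theorem sqrt_sum_norm_cop_sq_le {δ A θ : ℝ} (h : Regime kF R δ A M) (hA : 1 ≤ A) (hc : 1 ≤ c₀)
    (hθ0 : 0 < θ) (hθ1 : θ < 1 / 2) (hAθ : 8 * c₀ < A * (2 - 4 * θ)) {k : Mom}
    (hk : k ∈ gammaNor R) (φ : Fock) :
    √(∑ s : P.Idx δ k, ‖P.cop δ (P.lab s) k φ‖ ^ 2) ≤
      √(∑ q ∈ gapSet kF R δ θ, ‖ann q φ‖ ^ 2) :=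
  Real.sqrt_le_sqrt ((P.sum_lab_le h.kF_pos (f := fun α => ‖P.cop δ α k φ‖ ^ 2)
    fun _ => sq_nonneg _).trans (P.sum_norm_cop_sq_le h hA hc hθ0 hθ1 hAθ hk _ φ))

/-- A pair lowers the gapped number by at most 2, so the commutator with c_α(k) is a weighted pair
operator obeying the same kind of bound as c_α(k). This closes the Grönwall argument. -/
theorem abs_comm_gapOp_le {δ A θ : ℝ} (h : Regime kF R δ A M) (hA : 1 ≤ A) (hc : 1 ≤ c₀)
    (hθ0 : 0 < θ) (hθ1 : θ < 1 / 2) (hAθ : 8 * c₀ < A * (2 - 4 * θ)) {lg : ℂ → ℂ}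
    {Vhat : Mom → ℝ} {S : ℝ} (hS : ∑ k ∈ gammaNor R, hs (P.matL lg Vhat δ k) * (1 + ‖vec k‖) ≤ S)
    (φ : Fock) :
    |(inner ℂ φ ((gapOp kF R δ θ * P.genZ lg Vhat δ - P.genZ lg Vhat δ * gapOp kF R δ θ) φ)).re| ≤
      4 * S * ∑ q ∈ gapSet kF R δ θ, ‖ann q φ‖ ^ 2 := by
  classical
  have hR : 0 ≤ R := by linarith [h.one_le_R]
  set w : Mom → ℝ := fun p => if p ∈ gapSet kF R δ θ then 1 else 0 with hw
  have hw' : ∀ p, 0 ≤ w p ∧ w p ≤ 1 := fun p => by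
    rw [hw]
    dsimp only
    split_ifs <;> norm_num
  set g := ∑ q ∈ gapSet kF R δ θ, ‖ann q φ‖ ^ 2 with hg
  have hg0 : 0 ≤ g := Finset.sum_nonneg fun _ _ => sq_nonneg _
  refine (P.abs_re_inner_comm_genZ_le lg Vhat δ (star_numOp _ _)
    (fun k hk α hα => P.numOp_mul_cop hR w hα) φ).trans ?_
  have h1 : ∀ k ∈ gammaNor R, 2 * (hs (P.matL lg Vhat δ k) *
      √(∑ s : P.Idx δ k, ‖P.wbop (P.lab s) (P.keff δ k (P.lab s))
        (fun p => w p + w (p - P.keff δ k (P.lab s))) φ‖ ^ 2) *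
        √(∑ s : P.Idx δ k, ‖P.cop δ (P.lab s) k φ‖ ^ 2)) ≤
      4 * g * (hs (P.matL lg Vhat δ k) * (1 + ‖vec k‖)) := by
    intro k hk
    have e1 : √(∑ s : P.Idx δ k, ‖P.wbop (P.lab s) (P.keff δ k (P.lab s))
        (fun p => w p + w (p - P.keff δ k (P.lab s))) φ‖ ^ 2) ≤ 2 * √g := by
      have e2 := P.sum_norm_wbop_keff_sq_le h hA hc hθ0 hθ1 hAθ hk
        (fun α p => w p + w (p - P.keff δ k α)) (F := 2) (fun α _ p _ => by
          have f1 := hw' p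
          have f2 := hw' (p - P.keff δ k α)
          rw [abs_of_nonneg (by linarith)]
          linarith) φ
      have e3 := (P.sum_lab_le h.kF_pos (f := fun α => ‖P.wbop α (P.keff δ k α)
        (fun p => w p + w (p - P.keff δ k α)) φ‖ ^ 2) fun _ => sq_nonneg _).trans e2
      refine (Real.sqrt_le_sqrt e3).trans (le_of_eq ?_)
      rw [Real.sqrt_mul (by norm_num), Real.sqrt_sq (by norm_num)]
    have e2 := P.sqrt_sum_norm_cop_sq_le h hA hc hθ0 hθ1 hAθ hk φ
    have hh := hs_nonneg (P.matL lg Vhat δ k)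
    calc _ ≤ 2 * (hs (P.matL lg Vhat δ k) * (2 * √g) * √g) := by gcongr
      _ = 4 * (√g * √g) * (hs (P.matL lg Vhat δ k) * 1) := by ring
      _ = 4 * g * (hs (P.matL lg Vhat δ k) * 1) := by rw [Real.mul_self_sqrt hg0]
      _ ≤ _ := by
        gcongr
        linarith [norm_nonneg (vec k)]
  refine (Finset.sum_le_sum h1).trans ?_
  rw [← Finset.mul_sum]
  calc 4 * g * _ ≤ 4 * g * S := mul_le_mul_of_nonneg_left hS (by positivity)
    _ = _ := by ring

/-- Both residual terms carry a factor |k|, which is why L(k) is summed with the weight 1 + |k|. One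
factor √g comes from c_α(k), the other factor √g or √g' from the residual. -/
theorem abs_comm_diffOp_le {δ A θ : ℝ} (h : Regime kF R δ A M) (hA : 100 * c₀ ≤ A) (hc : 1 ≤ c₀)
    (hθ0 : 0 < θ) (hθ1 : θ < 1 / 2) (hAθ : 8 * c₀ < A * (2 - 4 * θ)) {lg : ℂ → ℂ}
    {Vhat : Mom → ℝ} {S : ℝ} (hS : ∑ k ∈ gammaNor R, hs (P.matL lg Vhat δ k) * (1 + ‖vec k‖) ≤ S)
    (φ : Fock) {g g' : ℝ} (hg : ∑ q ∈ gapSet kF R δ θ, ‖ann q φ‖ ^ 2 ≤ g)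
    (hg' : ∑ q ∈ gapSet kF R δ θ, ‖ann q (numΛ (latticeBall (kF + R)) φ)‖ ^ 2 ≤ g') :
    |(inner ℂ φ ((P.diffOp δ * P.genZ lg Vhat δ - P.genZ lg Vhat δ * P.diffOp δ) φ)).re| ≤
      11943936 * c₀ ^ 2 * S * hbar kF *
        ((√(M : ℝ))⁻¹ * g + R ^ 3 * (M * √(M : ℝ)) * hbar kF ^ 2 * √g' * √g) := by
  have hR := h.one_le_R
  have hh := hbar_pos h.kF_pos
  have hg0 : 0 ≤ g := le_trans (Finset.sum_nonneg fun _ _ => sq_nonneg _) hg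
  refine (P.abs_re_inner_comm_genZ_le lg Vhat δ (P.star_diffOp δ)
    (fun k hk α hα => P.diffOp_mul_cop h hA hc hk hα) φ).trans ?_
  set Y := (√(M : ℝ))⁻¹ * g + R ^ 3 * (M * √(M : ℝ)) * hbar kF ^ 2 * √g' * √g with hY
  have hY0 : 0 ≤ Y := by positivity
  have h1 : ∀ k ∈ gammaNor R, 2 * (hs (P.matL lg Vhat δ k) *
      √(∑ s : P.Idx δ k, ‖P.resid δ k (P.lab s) φ‖ ^ 2) *
        √(∑ s : P.Idx δ k, ‖P.cop δ (P.lab s) k φ‖ ^ 2)) ≤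
      11943936 * c₀ ^ 2 * hbar kF * Y * (hs (P.matL lg Vhat δ k) * (1 + ‖vec k‖)) := by
    intro k hk
    have e1 := P.sqrt_sum_norm_resid_sq_le h hA hc hθ0 hθ1 hAθ hk φ
    have e2 := (P.sqrt_sum_norm_cop_sq_le h (by linarith) hc hθ0 hθ1 hAθ hk φ).trans
      (Real.sqrt_le_sqrt hg)
    have hL := hs_nonneg (P.matL lg Vhat δ k)
    have e3 : √(∑ s : P.Idx δ k, ‖P.resid δ k (P.lab s) φ‖ ^ 2) ≤
        2 * (14 * c₀ * hbar kF * ‖vec k‖ / √(M : ℝ) * √g +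
          2985984 * c₀ ^ 2 * hbar kF ^ 3 * R ^ 3 * (M * √(M : ℝ)) * ‖vec k‖ * √g') := by
      refine e1.trans ?_
      gcongr
    calc _ ≤ 2 * (hs (P.matL lg Vhat δ k) *
          (2 * (14 * c₀ * hbar kF * ‖vec k‖ / √(M : ℝ) * √g +
          2985984 * c₀ ^ 2 * hbar kF ^ 3 * R ^ 3 * (M * √(M : ℝ)) * ‖vec k‖ * √g')) * √g) := by
          gcongr
      _ = hbar kF * (hs (P.matL lg Vhat δ k) * ‖vec k‖) * (56 * c₀ * ((√(M : ℝ))⁻¹ * (√g * √g)) +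
          11943936 * c₀ ^ 2 * (R ^ 3 * (M * √(M : ℝ)) * hbar kF ^ 2 * √g' * √g)) := by ring
      _ ≤ hbar kF * (hs (P.matL lg Vhat δ k) * (1 + ‖vec k‖)) *
          (11943936 * c₀ ^ 2 * ((√(M : ℝ))⁻¹ * g) +
          11943936 * c₀ ^ 2 * (R ^ 3 * (M * √(M : ℝ)) * hbar kF ^ 2 * √g' * √g)) := by
          rw [Real.mul_self_sqrt hg0]
          gcongr
          · linarith
          · norm_num
          · nlinarith
      _ = _ := by
          rw [hY]
          ring
  refine (Finset.sum_le_sum h1).trans ?_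
  rw [← Finset.mul_sum]
  calc _ ≤ 11943936 * c₀ ^ 2 * hbar kF * Y * S := mul_le_mul_of_nonneg_left hS (by positivity)
    _ = _ := by ring

/-- Conjugation with `Z` almost preserves the form of `ℍ₀ - 𝔻_B`. -/
theorem diffForm_Z_sub {δ A θ : ℝ} (h : Regime kF R δ A M) (hA : 100 * c₀ ≤ A) (hc : 1 ≤ c₀)
    (hθ0 : 0 < θ) (hθ1 : θ < 1 / 2) (hAθ : 8 * c₀ < A * (2 - 4 * θ)) {lg : ℂ → ℂ}
    (hlg : IsLogBranch lg) {Vhat : Mom → ℝ} (hV : ∀ k, 0 ≤ Vhat k) {S : ℝ} (hS0 : 0 ≤ S)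
    (hS : ∑ k ∈ gammaNor R, hs (P.matL lg Vhat δ k) * (1 + ‖vec k‖) ≤ S)
    {ψ : Fock} (hψ : kinForm kF ψ < ⊤) :
    kinForm kF (P.Z lg Vhat δ ψ) < ⊤ ∧
    |P.diffForm δ (P.Z lg Vhat δ ψ) - P.diffForm δ ψ| ≤
      11943936 * c₀ ^ 2 * S * Real.exp (4 * S) * hbar kF *
        ((√(M : ℝ))⁻¹ * (∑ q ∈ gapSet kF R δ θ, ‖ann q ψ‖ ^ 2) +
          R ^ 3 * (M * √(M : ℝ)) * hbar kF ^ 2 *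
            √(∑ q ∈ gapSet kF R δ θ, ‖ann q (numΛ (latticeBall (kF + R)) ψ)‖ ^ 2) *
            √(∑ q ∈ gapSet kF R δ θ, ‖ann q ψ‖ ^ 2)) := by
  have hR : 0 ≤ R := by linarith [h.one_le_R]
  have hB := P.star_genZ h.kF_pos hlg hV δ
  -- For p outside the ball, a_p commutes with the generator and the flow is isometric, so the
  -- occupation of p is preserved.
  have hk := kinForm_sub (Λ := latticeBall (kF + R)) (φ := P.Z lg Vhat δ ψ) (fun p hp => by
    rw [Z_apply, map_flow (P.commute_ann_genZ hR lg Vhat δ hp), norm_flow hB]) hψ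
  refine ⟨hk.1, ?_⟩
  have e : P.diffForm δ (P.Z lg Vhat δ ψ) - P.diffForm δ ψ =
      (inner ℂ (flow (P.genZ lg Vhat δ) ψ 1) (P.diffOp δ (flow (P.genZ lg Vhat δ) ψ 1))).re -
        (inner ℂ ψ (P.diffOp δ ψ)).re := by
    rw [diffForm, diffForm, sub_sub_sub_comm, hk.2, ← Z_apply, diffOp, sub_apply, sub_apply,
      inner_sub_right, inner_sub_right, Complex.sub_re, Complex.sub_re]
    ring
  -- Stated for arbitrary x because it is applied both to ψ and to 𝒩ψ, the latter after commuting 𝒩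
  -- with the flow.
  have hgrow : ∀ x : Fock, ∀ t ∈ Set.Icc (0 : ℝ) 1,
      ∑ q ∈ gapSet kF R δ θ, ‖ann q (flow (P.genZ lg Vhat δ) x t)‖ ^ 2 ≤
        Real.exp (4 * S) * ∑ q ∈ gapSet kF R δ θ, ‖ann q x‖ ^ 2 := by
    intro x t ht
    have h1 := re_inner_flow_le (X := gapOp kF R δ θ) (K := 4 * S) hB (fun φ => by
      rw [re_inner_gapOp]
      exact Finset.sum_nonneg fun _ _ => sq_nonneg _) (fun φ => by
      rw [re_inner_gapOp]
      exact P.abs_comm_gapOp_le h (by linarith) hc hθ0 hθ1 hAθ hS φ) x ht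
    rw [re_inner_gapOp, re_inner_gapOp] at h1
    refine h1.trans ?_
    rw [mul_comm]
    refine mul_le_mul_of_nonneg_right (Real.exp_le_exp.2 ?_)
      (Finset.sum_nonneg fun _ _ => sq_nonneg _)
    exact mul_le_of_le_one_right (by positivity) ht.2
  rw [e]
  refine (abs_re_inner_flow_sub_le hB ψ fun t ht =>
    P.abs_comm_diffOp_le h hA hc hθ0 hθ1 hAθ hS _ (hgrow ψ t ht) (by
      rw [map_flow (P.commute_numΛ_genZ hR lg Vhat δ)]
      exact hgrow _ t ht)).trans (le_of_eq ?_)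
  have hE : √(Real.exp (4 * S)) * √(Real.exp (4 * S)) = Real.exp (4 * S) :=
    Real.mul_self_sqrt (Real.exp_nonneg _)
  rw [Real.sqrt_mul (Real.exp_nonneg _), Real.sqrt_mul (Real.exp_nonneg _)]
  linear_combination (11943936 * c₀ ^ 2 * S * hbar kF * (R ^ 3 * (M * √(M : ℝ)) * hbar kF ^ 2 *
            √(∑ q ∈ gapSet kF R δ θ, ‖ann q (numΛ (latticeBall (kF + R)) ψ)‖ ^ 2) *
            √(∑ q ∈ gapSet kF R δ θ, ‖ann q ψ‖ ^ 2))) * hE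

theorem sum_hs_matL_le {δ A : ℝ} (h : Regime kF R δ A M) (hA : 100 * c₀ ≤ A) (hc : 1 ≤ c₀)
    {lg : ℂ → ℂ} {C : ℝ} (hC0 : 0 ≤ C) (hC : ∀ z : ℂ, ‖z‖ = 1 → ‖lg z‖ ≤ C * ‖z - 1‖)
    {Vhat : Mom → ℝ} (hV : ∀ k, 0 ≤ Vhat k)
    (hs' : Summable fun k : Mom => |Vhat k| * (1 + ‖vec k‖)) :
    ∑ k ∈ gammaNor R, hs (P.matL lg Vhat δ k) * (1 + ‖vec k‖) ≤
      C * (4 * (8232 * c₀ ^ 2)) * ∑' k, |Vhat k| * (1 + ‖vec k‖) := by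
  have h1 : ∀ k ∈ gammaNor R, hs (P.matL lg Vhat δ k) * (1 + ‖vec k‖) ≤
      C * (4 * (8232 * c₀ ^ 2)) * (|Vhat k| * (1 + ‖vec k‖)) := by
    intro k hk
    have h2 := P.hs_matL_le_of_regime h hA hc hC0 hC hk (hV k)
    rw [abs_of_nonneg (hV k)]
    refine (mul_le_mul_of_nonneg_right h2 (by positivity)).trans (le_of_eq ?_)
    ring
  refine (Finset.sum_le_sum h1).trans ?_
  rw [← Finset.mul_sum]
  refine mul_le_mul_of_nonneg_left ?_ (by positivity)
  exact hs'.sum_le_tsum _ fun k _ => by positivity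

end PatchDecomposition

/-! ### Transfer to extended nonnegative norms and conclusion -/

theorem ofReal_sqrt_le {g : ℝ} {x : ℝ≥0∞} (hg : 0 ≤ g) (h : ENNReal.ofReal g ≤ x ^ 2) :
    ENNReal.ofReal √g ≤ x := by
  rw [← Real.sq_sqrt hg, ENNReal.ofReal_pow (Real.sqrt_nonneg _)] at h
  exact (ENNReal.pow_le_pow_left_iff two_ne_zero).1 h

theorem ofReal_mul_add_le {C a b b' g g' : ℝ} {x y : ℝ≥0∞} (hC : 0 ≤ C) (ha : 0 ≤ a) (hb : 0 ≤ b)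
    (hbb' : b ≤ b') (hg : 0 ≤ g) (hg' : 0 ≤ g') (hx : ENNReal.ofReal g ≤ x ^ 2)
    (hy : ENNReal.ofReal g' ≤ y ^ 2) :
    ENNReal.ofReal (C * (a * g + b * √g' * √g)) ≤
      ENNReal.ofReal C * (ENNReal.ofReal a * x ^ 2 + ENNReal.ofReal b' * y * x) := by
  rw [ENNReal.ofReal_mul hC, ENNReal.ofReal_add (by positivity) (by positivity),
    ENNReal.ofReal_mul ha, ENNReal.ofReal_mul (by positivity), ENNReal.ofReal_mul hb]
  exact mul_le_mul_right (add_le_add (mul_le_mul_right hx _)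
    (mul_le_mul' (mul_le_mul' (ENNReal.ofReal_le_ofReal hbb') (ofReal_sqrt_le hg' hy))
      (ofReal_sqrt_le hg hx))) _

end FermiPatch

end

theorem lemma7p4
    (Vhat : FermiPatch.Mom → ℝ) (hV0 : ∀ k, 0 ≤ Vhat k)
    (hV : Summable fun k : FermiPatch.Mom => |Vhat k| * (1 + ‖FermiPatch.vec k‖))
    (δ : ℝ) (hδ0 : 0 < δ) (hδ1 : δ < 1 / 6)
    (θ : ℝ) (hθ0 : 0 < θ) (hθ1 : θ < 1 / 2)
    (c₀ : ℝ) (hc₀ : 1 ≤ c₀)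
    (lg : ℂ → ℂ) (hlg : FermiPatch.IsLogBranch lg) :
    ∃ C : ℝ, 0 < C ∧ ∃ ε : ℝ, 0 < ε ∧
      ∀ (kF R : ℝ) (M : ℕ) (P : FermiPatch.PatchDecomposition kF R c₀ M),
        0 < kF →
        1 ≤ ε * R →
        (FermiPatch.numN kF : ℝ) ^ (2 * δ) * R ^ 2 ≤ ε * (M : ℝ) →
        (M : ℝ) ≤ ε * ((FermiPatch.numN kF : ℝ) ^ (2 / 3 - 2 * δ) * R ^ (-4 : ℝ)) →
        ∀ ψ : FermiPatch.Fock, FermiPatch.kinForm kF ψ < ⊤ →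
          FermiPatch.kinForm kF (P.Z lg Vhat δ ψ) < ⊤ ∧
          ENNReal.ofReal |P.diffForm δ (P.Z lg Vhat δ ψ) - P.diffForm δ ψ| ≤
            ENNReal.ofReal (C * FermiPatch.hbar kF) *
              (ENNReal.ofReal ((M : ℝ) ^ (-(1 / 2) : ℝ)) * FermiPatch.gapNorm kF δ θ ψ ^ 2 +
                ENNReal.ofReal (R ^ 3 * (M : ℝ) ^ (3 / 2 : ℝ) *
                    (FermiPatch.numN kF : ℝ) ^ (-(2 / 3) + δ)) *
                  FermiPatch.gapNumNorm kF δ θ ψ * FermiPatch.gapNorm kF δ θ ψ) := by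
  obtain ⟨Cl, hCl0, hCl⟩ := hlg.exists_norm_le
  have h24 : 0 < 2 - 4 * θ := by linarith
  have hc0 : 0 < c₀ := by linarith
  -- The first summand serves the pair counting, the second the gap, which requires A(2 - 4θ) > 8c₀
  -- strictly.
  set A := 100 * c₀ + (8 * c₀ / (2 - 4 * θ) + 1) with hAdef
  have hq : 0 < 8 * c₀ / (2 - 4 * θ) := by positivity
  have hA : 100 * c₀ ≤ A := by linarith
  have hAθ : 8 * c₀ < A * (2 - 4 * θ) := by
    have e : 8 * c₀ / (2 - 4 * θ) * (2 - 4 * θ) = 8 * c₀ := div_mul_cancel₀ _ h24.ne'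
    nlinarith
  obtain ⟨ε, hε, hreg⟩ := FermiPatch.exists_regime (A := A) hδ0 (by linarith)
  -- The added 1 keeps the final constant positive when V̂ vanishes.
  set S := Cl * (4 * (8232 * c₀ ^ 2)) * (∑' k, |Vhat k| * (1 + ‖FermiPatch.vec k‖)) + 1 with hS
  have hT : 0 ≤ ∑' k, |Vhat k| * (1 + ‖FermiPatch.vec k‖) := tsum_nonneg fun k => by positivity
  have hS0 : 0 < S := by positivity
  refine ⟨11943936 * c₀ ^ 2 * S * Real.exp (4 * S), by positivity, ε, hε, ?_⟩
  intro kF R M P hkF h1 h2 h3 ψ hψ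
  have h := hreg kF R M hkF h1 h2 h3
  obtain ⟨hfin, hbd⟩ := P.diffForm_Z_sub h hA hc₀ hθ0 hθ1 hAθ hlg hV0 hS0.le
    ((P.sum_hs_matL_le h hA hc₀ hCl0.le hCl hV0 hV).trans (by linarith)) hψ
  refine ⟨hfin, (ENNReal.ofReal_le_ofReal hbd).trans ?_⟩
  have hh := FermiPatch.hbar_pos hkF
  have hR : 0 < R := by linarith [h.one_le_R]
  have hM : (0 : ℝ) < M := by exact_mod_cast h.M_pos
  have hN : (1 : ℝ) ≤ FermiPatch.numN kF := by exact_mod_cast FermiPatch.numN_pos hkF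
  have hG : ∀ p ∈ FermiPatch.PatchDecomposition.gapSet kF R δ θ,
      θ * (FermiPatch.numN kF : ℝ) ^ (-δ) < |‖FermiPatch.vec p‖ - kF| :=
    fun p hp => FermiPatch.PatchDecomposition.lt_of_mem_gapSet hp
  have hg1 := FermiPatch.sum_norm_ann_sq_le_gapNorm hG ψ
  have hg2 := FermiPatch.sum_norm_ann_sq_le_gapNumNorm hG (FermiPatch.latticeBall (kF + R)) ψ
  have e1 : (√(M : ℝ))⁻¹ = (M : ℝ) ^ (-(1 / 2) : ℝ) := by
    rw [Real.rpow_neg hM.le, Real.sqrt_eq_rpow]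
  -- The estimate gives N^{-2/3}; the weaker N^{-2/3+δ} follows from N ≥ 1 and δ > 0.
  have e2 : R ^ 3 * (M * √(M : ℝ)) * FermiPatch.hbar kF ^ 2 ≤
      R ^ 3 * (M : ℝ) ^ (3 / 2 : ℝ) * (FermiPatch.numN kF : ℝ) ^ (-(2 / 3) + δ) := by
    have f1 : (M * √(M : ℝ)) = (M : ℝ) ^ (3 / 2 : ℝ) := by
      rw [Real.sqrt_eq_rpow, ← Real.rpow_one_add' hM.le (by norm_num)]
      norm_num
    have f2 : FermiPatch.hbar kF ^ 2 ≤ (FermiPatch.numN kF : ℝ) ^ (-(2 / 3) + δ) := by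
      rw [FermiPatch.hbar, ← Real.rpow_natCast, ← Real.rpow_mul (by linarith)]
      refine Real.rpow_le_rpow_of_exponent_le hN ?_
      norm_num
      linarith
    rw [f1]
    gcongr
  rw [← e1]
  exact FermiPatch.ofReal_mul_add_le (by positivity) (by positivity) (by positivity) e2
    (Finset.sum_nonneg fun _ _ => sq_nonneg _) (Finset.sum_nonneg fun _ _ => sq_nonneg _) hg1 hg2
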